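/- Let $X$ be a compact connected Riemann surface with canonical bundle $K$. For $p,q\ge 0$, an $\mathrm{Sp}(2p,2q)$-Higgs bundle on $X$ is a tuple $M=(V,\Omega_V,W,\Omega_W,\beta,\gamma)$, where $(V,\Omega_V)$ and $(W,\Omega_W)$ are holomorphic symplectic vector bundles on $X$ of ranks $2p$ and $2q$, and $\beta:W\to V\otimes K$, $\gamma:V\to W\otimes K$ are holomorphic homomorphisms with $\Omega_V(\beta\,\cdot,\cdot)=-\Omega_W(\cdot,\gamma\,\cdot)$. It is *stable* if $\deg V'+\deg W'<0$ for every pair of isotropic holomorphic subbundles $V'\subset V$, $W'\subset W$, not both zero, with $\beta(W')\subset V'\otimes K$ and $\gamma(V')\subset W'\otimes K$. An isomorphism from $M_1=(V_1,\Omega_{V_1},W_1,\Omega_{W_1},\beta_1,\gamma_1)$ to $M_2=(V_2,\Omega_{V_2},W_2,\Omega_{W_2},\beta_2,\gamma_2)$ is a pair $(f,g)$ of isomorphisms of holomorphic symplectic vector bundles $f:V_1\to V_2$, $g:W_1\to W_2$ with $(f\otimes 1_K)\beta_1=\beta_2 g$ (and then also $(g\otimes 1_K)\gamma_1=\gamma_2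 f$). $M$ is *simple* if its automorphism group $\mathrm{Aut}(M)$ is $\{(1_V,1_W),(-1_V,-1_W)\}$. Direct sums are formed componentwise, with orthogonal sums of the symplectic forms. **Proposition.** An $\mathrm{Sp}(2p,2q)$-Higgs bundle $M$ on $X$ is stable and not simple if and only if $$M\cong\bigoplus_{i=1}^r M_i$$ for some $r>1$ and some stable and simple $\mathrm{Sp}(2p_i,2q_i)$-Higgs bundles $M_i$ with $(p_i,q_i)\neq(0,0)$ and $M_i\not\cong M_j$ for $i\neq j$ (one of $p_i$, $q_i$ may be $0$). Moreover, for every such decomposition, $\mathrm{Aut}(M)\cong(\mathbb{Z}/2)^r$. -/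

import Mathlib

open scoped Manifold ContDiff Bundle ComplexConjugate Laplacian

/-! Throughout, a compact Riemann surface is a compact connected Hausdorff space `X` with an atlas
of charts to `ℂ` whose transition maps are holomorphic (`IsManifold 𝓘(ℂ) ω X`). -/

/-- A holomorphic vector bundle of rank `n` over the complex manifold `X`. -/
structure HolomorphicVectorBundle (X : Type*) [TopologicalSpace X] [ChartedSpace ℂ X]
    (n : ℕ) where
  Fiber : X → Type
  [addCommGroupFiber : ∀ x, AddCommGroup (Fiber x)]
  [moduleFiber : ∀ x, Module ℂ (Fiber x)]
  [topologicalSpaceFiber : ∀ x, TopologicalSpace (Fiber x)]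
  [topologicalSpaceTotal : TopologicalSpace (Bundle.TotalSpace (Fin n → ℂ) Fiber)]
  [fiberBundle : FiberBundle (Fin n → ℂ) Fiber]
  [vectorBundle : VectorBundle ℂ (Fin n → ℂ) Fiber]
  [holomorphic : ContMDiffVectorBundle ω (Fin n → ℂ) Fiber 𝓘(ℂ)]

attribute [instance] HolomorphicVectorBundle.addCommGroupFiber
  HolomorphicVectorBundle.moduleFiber HolomorphicVectorBundle.topologicalSpaceFiber
  HolomorphicVectorBundle.topologicalSpaceTotal HolomorphicVectorBundle.fiberBundle
  HolomorphicVectorBundle.vectorBundle HolomorphicVectorBundle.holomorphic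

/-- The section `s` of `E` is holomorphic on the (open) set `U`. -/
def HolomorphicVectorBundle.IsHolSection {X : Type*} [TopologicalSpace X] [ChartedSpace ℂ X]
    {n : ℕ} (E : HolomorphicVectorBundle X n) (U : Set X) (s : ∀ x, E.Fiber x) : Prop :=
  ContMDiffOn 𝓘(ℂ) (𝓘(ℂ).prod 𝓘(ℂ, Fin n → ℂ)) ω
    (fun x => Bundle.TotalSpace.mk' (Fin n → ℂ) x (s x)) U

/-- The vector field `ξ` is holomorphic on `U`. -/
def IsHolVectorField {X : Type*} [TopologicalSpace X] [ChartedSpace ℂ X] [IsManifold 𝓘(ℂ) ω X]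
    (U : Set X) (ξ : ∀ x : X, TangentSpace 𝓘(ℂ) x) : Prop :=
  ContMDiffOn 𝓘(ℂ) (𝓘(ℂ).prod 𝓘(ℂ)) ω
    (fun x => Bundle.TotalSpace.mk' ℂ (E := TangentSpace (M := X) 𝓘(ℂ)) x (ξ x)) U

/-- A holomorphic subbundle: a family of subspaces of the fibres, spanned near every
point by a holomorphic frame (of constant length). -/
structure HolomorphicVectorBundle.Subbundle {X : Type*} [TopologicalSpace X] [ChartedSpace ℂ X]
    {n : ℕ} (E : HolomorphicVectorBundle X n) where
  fiber : ∀ x, Submodule ℂ (E.Fiber x)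
  rank : ℕ
  exists_frame : ∀ x₀ : X, ∃ U : Set X, IsOpen U ∧ x₀ ∈ U ∧
    ∃ s : Fin rank → ∀ x, E.Fiber x, (∀ i, E.IsHolSection U (s i)) ∧
      ∀ x ∈ U, LinearIndependent ℂ (fun i => s i x) ∧
        Submodule.span ℂ (Set.range fun i => s i x) = fiber x

/-! ### Degree, by Chern--Weil theory -/

/-- A smooth hermitian metric on `E` (conjugate-linear in the first argument). -/
structure HermitianMetric {X : Type*} [TopologicalSpace X] [ChartedSpace ℂ X]
    {n : ℕ} (E : HolomorphicVectorBundle X n) where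
  form : ∀ x, E.Fiber x →ₗ⋆[ℂ] E.Fiber x →ₗ[ℂ] ℂ
  conj_symm : ∀ x v w, conj (form x v w) = form x w v
  pos : ∀ x v, v ≠ 0 → 0 < (form x v v).re
  smooth : ∀ (U : Set X) (s t : ∀ x, E.Fiber x), IsOpen U → E.IsHolSection U s →
    E.IsHolSection U t →
      ContMDiffOn 𝓘(ℝ, ℂ) 𝓘(ℝ, ℂ) ∞ (fun x => form x (s x) (t x)) U

section Existence

variable {X : Type*} [TopologicalSpace X] [ChartedSpace ℂ X]

theorem isManifold_real [IsManifold 𝓘(ℂ) ω X] : IsManifold 𝓘(ℝ, ℂ) ∞ X := by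
  apply isManifold_of_contDiffOn
  intro e e' he he'
  have h := (contDiffGroupoid ω 𝓘(ℂ)).compatible he he'
  rw [contDiffGroupoid, mem_groupoid_of_pregroupoid] at h
  have h1 := h.1
  simp only [contDiffPregroupoid] at h1
  exact (h1.restrict_scalars ℝ).of_le le_top

theorem ContMDiffAt.real_of_complex {F : Type*} [NormedAddCommGroup F] [NormedSpace ℂ F]
    {f : X → F} {x : X} (h : ContMDiffAt 𝓘(ℂ) 𝓘(ℂ, F) ω f x) :
    ContMDiffAt 𝓘(ℝ, ℂ) 𝓘(ℝ, F) ∞ f x := by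
  rw [contMDiffAt_iff] at h ⊢
  exact ⟨h.1, (h.2.restrict_scalars ℝ).of_le le_top⟩

variable {n : ℕ} (E : HolomorphicVectorBundle X n)

/-- The standard hermitian form of `ℂⁿ` seen in the trivialization around `i`. -/
noncomputable def HolomorphicVectorBundle.localForm (i x : X) :
    E.Fiber x →ₗ⋆[ℂ] E.Fiber x →ₗ[ℂ] ℂ :=
  LinearMap.mk₂'ₛₗ (starRingEnd ℂ) (RingHom.id ℂ)
    (fun v w => ∑ k, conj ((trivializationAt (Fin n → ℂ) E.Fiber i).linearMapAt ℂ x v k) *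
      (trivializationAt (Fin n → ℂ) E.Fiber i).linearMapAt ℂ x w k)
    (by intro a b c; simp [add_mul, Finset.sum_add_distrib])
    (by intro a b c; simp [Finset.mul_sum, mul_assoc])
    (by intro a b c; simp [mul_add, Finset.sum_add_distrib])
    (by intro a b c; simp [Finset.mul_sum, mul_left_comm])

theorem HolomorphicVectorBundle.localForm_smooth {U : Set X} {s t : ∀ x, E.Fiber x} {i x : X}
    (hU : IsOpen U) (hs : E.IsHolSection U s) (ht : E.IsHolSection U t) (hx : x ∈ U)
    (hi : x ∈ (trivializationAt (Fin n → ℂ) E.Fiber i).baseSet) :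
    ContMDiffAt 𝓘(ℝ, ℂ) 𝓘(ℝ, ℂ) ∞ (fun y => E.localForm i y (s y) (t y)) x := by
  set e := trivializationAt (Fin n → ℂ) E.Fiber i
  have key : ∀ r : ∀ x, E.Fiber x, E.IsHolSection U r → ∀ k,
      ContMDiffAt 𝓘(ℝ, ℂ) 𝓘(ℝ, ℂ) ∞ (fun y => e.linearMapAt ℂ y (r y) k) x := by
    intro r hr k
    have h1 : ContMDiffAt 𝓘(ℂ) (𝓘(ℂ).prod 𝓘(ℂ, Fin n → ℂ)) ω
      (fun x => Bundle.TotalSpace.mk' (Fin n → ℂ) x (r x)) x := hr.contMDiffAt (hU.mem_nhds hx)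
    have h2 := (e.contMDiffAt_section_iff hi).1 h1
    have h3 : ContMDiffAt 𝓘(ℂ) 𝓘(ℂ) ω (fun y => (e ⟨y, r y⟩).2 k) x :=
      contMDiffAt_pi_space.1 h2 k
    refine (ContMDiffAt.real_of_complex h3).congr_of_eventuallyEq ?_
    filter_upwards [e.open_baseSet.mem_nhds hi] with y hy
    rw [Bundle.Trivialization.linearMapAt_apply, if_pos hy]
  have hc : ContDiff ℝ ∞ (fun p : ℂ × ℂ => conj p.1 * p.2) :=
    (Complex.conjCLE.contDiff.comp contDiff_fst).mul contDiff_snd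
  have : (fun y => E.localForm i y (s y) (t y)) =
      fun y => ∑ k, conj (e.linearMapAt ℂ y (s y) k) * e.linearMapAt ℂ y (t y) k := by
    funext y; simp [HolomorphicVectorBundle.localForm, e]
  rw [this]
  refine ContMDiffAt.sum fun k _ => ?_
  exact hc.contDiffAt.contMDiffAt.comp x ((key s hs k).prodMk_space (key t ht k))

theorem HermitianMetric.nonempty [T2Space X] [CompactSpace X] [IsManifold 𝓘(ℂ) ω X] :
    Nonempty (HermitianMetric E) := by
  have : IsManifold 𝓘(ℝ, ℂ) ∞ X := isManifold_real
  obtain ⟨ρ, hρ⟩ := SmoothPartitionOfUnity.exists_isSubordinate 𝓘(ℝ, ℂ)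
    (isClosed_univ (X := X))
    (fun i : X => (trivializationAt (Fin n → ℂ) E.Fiber i).baseSet)
    (fun i => (trivializationAt (Fin n → ℂ) E.Fiber i).open_baseSet)
    (fun x _ => Set.mem_iUnion.2 ⟨x, FiberBundle.mem_baseSet_trivializationAt' x⟩)
  have hfin : {i | (Function.support (ρ i)).Nonempty}.Finite :=
    ρ.locallyFinite.finite_nonempty_of_compact
  set T := hfin.toFinset
  have happ : ∀ x v w, (∑ i ∈ T, (ρ i x : ℂ) • E.localForm i x) v w =
      ∑ i ∈ T, (ρ i x : ℂ) * E.localForm i x v w := by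
    intro x v w; simp [LinearMap.sum_apply]
  have hre : ∀ i x v, (E.localForm i x v v) = ((∑ k, Complex.normSq
      ((trivializationAt (Fin n → ℂ) E.Fiber i).linearMapAt ℂ x v k) : ℝ) : ℂ) := by
    intro i x v
    simp only [HolomorphicVectorBundle.localForm, LinearMap.mk₂'ₛₗ_apply]
    push_cast
    exact Finset.sum_congr rfl fun k _ => by rw [mul_comm, Complex.mul_conj]
  refine ⟨⟨fun x => ∑ i ∈ T, (ρ i x : ℂ) • E.localForm i x, ?_, ?_, ?_⟩⟩
  · intro x v w
    rw [happ, happ, map_sum]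
    refine Finset.sum_congr rfl fun i _ => ?_
    rw [map_mul, Complex.conj_ofReal]
    simp [HolomorphicVectorBundle.localForm, mul_comm]
  · intro x v hv
    rw [happ]
    have hsum : ∑ i ∈ T, (ρ i x : ℂ) * E.localForm i x v v = ((∑ i ∈ T, ρ i x * ∑ k, Complex.normSq
      ((trivializationAt (Fin n → ℂ) E.Fiber i).linearMapAt ℂ x v k) : ℝ) : ℂ) := by
      simp only [hre]; push_cast; rfl
    rw [hsum, Complex.ofReal_re]
    obtain ⟨i, hi⟩ := ρ.exists_pos_of_mem (Set.mem_univ x)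
    refine Finset.sum_pos' (fun j _ => mul_nonneg (ρ.nonneg j x)
      (Finset.sum_nonneg fun k _ => Complex.normSq_nonneg _)) ⟨i, ?_, ?_⟩
    · simp only [T, Set.Finite.mem_toFinset]
      exact ⟨x, hi.ne'⟩
    · refine mul_pos hi ?_
      have hx : x ∈ (trivializationAt (Fin n → ℂ) E.Fiber i).baseSet :=
        hρ i (subset_tsupport _ hi.ne')
      have hne : (trivializationAt (Fin n → ℂ) E.Fiber i).linearMapAt ℂ x v ≠ 0 := by
        intro h0
        apply hv
        have := (trivializationAt (Fin n → ℂ) E.Fiber i).symmₗ_linearMapAt (R := ℂ) hx v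
        rw [← this, h0, map_zero]
      obtain ⟨k, hk⟩ := Function.ne_iff.1 hne
      exact Finset.sum_pos' (fun k _ => Complex.normSq_nonneg _)
        ⟨k, Finset.mem_univ _, Complex.normSq_pos.2 hk⟩
  · intro U s t hU hs ht x hx
    apply ContMDiffAt.contMDiffWithinAt
    simp only [happ]
    refine ContMDiffAt.sum fun i _ => ?_
    by_cases hi : x ∈ tsupport (ρ i)
    · have h1 := E.localForm_smooth hU hs ht hx (hρ i hi)
      have h2 : ContMDiffAt 𝓘(ℝ, ℂ) 𝓘(ℝ, ℂ) ∞ (fun y => (ρ i y : ℂ)) x :=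
        Complex.ofRealCLM.contDiff.contDiffAt.contMDiffAt.comp x (ρ i).contMDiff.contMDiffAt
      exact ((contDiff_mul (𝕜 := ℝ) (𝔸 := ℂ)).contDiffAt.contMDiffAt).comp x (h2.prodMk_space h1)
    · refine (contMDiffAt_const (c := (0 : ℂ))).congr_of_eventuallyEq ?_
      filter_upwards [(isClosed_tsupport (ρ i)).isOpen_compl.mem_nhds hi] with y hy
      rw [image_eq_zero_of_notMem_tsupport hy]
      simp

theorem exists_partition_subordinate_charts (X : Type*) [TopologicalSpace X] [ChartedSpace ℂ X]
    [T2Space X] [CompactSpace X] [IsManifold 𝓘(ℂ) ω X] :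
    ∃ ρ : SmoothPartitionOfUnity X 𝓘(ℝ, ℂ) X Set.univ,
      ρ.IsSubordinate (fun x => (chartAt ℂ x).source) := by
  have : IsManifold 𝓘(ℝ, ℂ) ∞ X := isManifold_real
  exact SmoothPartitionOfUnity.exists_isSubordinate_chartAt_source 𝓘(ℝ, ℂ) X

end Existence


section Degree

variable {X : Type*} [TopologicalSpace X] [ChartedSpace ℂ X] {n : ℕ}
  {E : HolomorphicVectorBundle X n}

/-- A holomorphic frame of the subbundle `S` near `x₀`. -/
noncomputable def HolomorphicVectorBundle.Subbundle.frame (S : E.Subbundle) (x₀ : X) :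
    Fin S.rank → ∀ x, E.Fiber x :=
  (S.exists_frame x₀).choose_spec.2.2.choose

/-- The Gram determinant of a tuple of sections. -/
noncomputable def HermitianMetric.gramDet (H : HermitianMetric E) {k : ℕ}
    (s : Fin k → ∀ x, E.Fiber x) (x : X) : ℝ :=
  (Matrix.of fun i j => H.form x (s i x) (s j x)).det.re

/-- The first Chern form of the subbundle `S` with the metric induced by `H`, at the point with
coordinate `z` in the chart around `c`, as a multiple of `dx ∧ dy`. For a holomorphic frame with
Gram determinant `G` it is `(i / 2π) ∂̄∂ log G = -(1 / 4π) Δ(log G) dx ∧ dy`; this does not depend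
on the frame, because `log |det g|²` is harmonic for a holomorphic change of frame `g`. -/
noncomputable def HolomorphicVectorBundle.Subbundle.chernDensity (S : E.Subbundle)
    (H : HermitianMetric E) (c : X) (z : ℂ) : ℝ :=
  -(1 / (4 * Real.pi)) * (Δ (fun w : ℂ => Real.log
    (H.gramDet (S.frame ((chartAt ℂ c).symm z)) ((chartAt ℂ c).symm w)))) z

/-- The integral over `X` of the first Chern form, computed in the charts of `X` by means of a
smooth partition of unity. -/
noncomputable def HolomorphicVectorBundle.Subbundle.chernIntegral (S : E.Subbundle)
    (H : HermitianMetric E) (ρ : SmoothPartitionOfUnity X 𝓘(ℝ, ℂ) X Set.univ) : ℝ :=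
  ∑ᶠ c : X, ∫ z in (chartAt ℂ c).target, ρ c ((chartAt ℂ c).symm z) * S.chernDensity H c z

/-- The degree `∫_X c₁(S)` of a holomorphic subbundle over a compact Riemann surface. Neither the
metric nor the partition of unity matters. The degree of `E` itself is that of the subbundle with
all fibres `⊤`. -/
noncomputable def HolomorphicVectorBundle.Subbundle.degree [T2Space X] [CompactSpace X]
    [IsManifold 𝓘(ℂ) ω X] (S : E.Subbundle) : ℝ :=
  S.chernIntegral (Classical.choice (HermitianMetric.nonempty E))
    (exists_partition_subordinate_charts X).choose

end Degree

/-! ### `Sp(2p,2q)`-Higgs bundles -/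

/-- A holomorphic symplectic vector bundle of rank `2p`. -/
structure SymplecticVectorBundle (X : Type*) [TopologicalSpace X] [ChartedSpace ℂ X] (p : ℕ)
    extends HolomorphicVectorBundle X (2 * p) where
  form : ∀ x, Fiber x →ₗ[ℂ] Fiber x →ₗ[ℂ] ℂ
  form_alt : ∀ x, (form x).IsAlt
  form_nondegenerate : ∀ x, (form x).Nondegenerate
  form_holomorphic : ∀ (U : Set X) (s t : ∀ x, Fiber x), IsOpen U →
    toHolomorphicVectorBundle.IsHolSection U s → toHolomorphicVectorBundle.IsHolSection U t →
      ContMDiffOn 𝓘(ℂ) 𝓘(ℂ) ω (fun x => form x (s x) (t x)) U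

/-- A holomorphic homomorphism `E → F ⊗ K`, where `K` is the dual of the holomorphic tangent
bundle: it takes a tangent vector and a vector of `E` to a vector of `F`, linearly in both. -/
structure TwistedHom {X : Type*} [TopologicalSpace X] [ChartedSpace ℂ X] [IsManifold 𝓘(ℂ) ω X]
    {m n : ℕ} (E : HolomorphicVectorBundle X m) (F : HolomorphicVectorBundle X n) where
  toFun : ∀ x : X, TangentSpace 𝓘(ℂ) x →ₗ[ℂ] E.Fiber x →ₗ[ℂ] F.Fiber x
  holomorphic : ∀ (U : Set X) (ξ : ∀ x : X, TangentSpace 𝓘(ℂ) x) (s : ∀ x, E.Fiber x),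
    IsOpen U → IsHolVectorField U ξ → E.IsHolSection U s →
      F.IsHolSection U (fun x => toFun x (ξ x) (s x))

/-- `φ(E') ⊆ F' ⊗ K`. -/
def TwistedHom.MapsInto {X : Type*} [TopologicalSpace X] [ChartedSpace ℂ X]
    [IsManifold 𝓘(ℂ) ω X] {m n : ℕ} {E : HolomorphicVectorBundle X m}
    {F : HolomorphicVectorBundle X n} (φ : TwistedHom E F) (E' : E.Subbundle) (F' : F.Subbundle) :
    Prop :=
  ∀ (x : X) (ξ : TangentSpace 𝓘(ℂ) x), ∀ v ∈ E'.fiber x, φ.toFun x ξ v ∈ F'.fiber x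

/-- A subbundle is isotropic if the symplectic form vanishes on it. -/
def SymplecticVectorBundle.IsIsotropic {X : Type*} [TopologicalSpace X] [ChartedSpace ℂ X] {p : ℕ}
    (V : SymplecticVectorBundle X p) (S : V.toHolomorphicVectorBundle.Subbundle) : Prop :=
  ∀ x, ∀ v ∈ S.fiber x, ∀ w ∈ S.fiber x, V.form x v w = 0

/-- An `Sp(2p,2q)`-Higgs bundle `(V, Ω_V, W, Ω_W, β, γ)`. -/
structure SpHiggsBundle (X : Type*) [TopologicalSpace X] [ChartedSpace ℂ X]
    [IsManifold 𝓘(ℂ) ω X] (p q : ℕ) where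
  V : SymplecticVectorBundle X p
  W : SymplecticVectorBundle X q
  β : TwistedHom W.toHolomorphicVectorBundle V.toHolomorphicVectorBundle
  γ : TwistedHom V.toHolomorphicVectorBundle W.toHolomorphicVectorBundle
  skew : ∀ (x : X) (ξ : TangentSpace 𝓘(ℂ) x) (w : W.Fiber x) (v : V.Fiber x),
    V.form x (β.toFun x ξ w) v = -W.form x w (γ.toFun x ξ v)

namespace SpHiggsBundle

variable {X : Type*} [TopologicalSpace X] [ChartedSpace ℂ X] [IsManifold 𝓘(ℂ) ω X]

/-- Stability: `deg V' + deg W' < 0` for all isotropic subbundles `V' ⊆ V`, `W' ⊆ W`, not both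
zero, such that `V' ⊕ W'` is invariant under the Higgs field `(β, γ)`. -/
def IsStable [T2Space X] [CompactSpace X] {p q : ℕ} (M : SpHiggsBundle X p q) : Prop :=
  ∀ (V' : M.V.toHolomorphicVectorBundle.Subbundle) (W' : M.W.toHolomorphicVectorBundle.Subbundle),
    M.V.IsIsotropic V' → M.W.IsIsotropic W' → (V'.rank ≠ 0 ∨ W'.rank ≠ 0) →
    M.β.MapsInto W' V' → M.γ.MapsInto V' W' → V'.degree + W'.degree < 0

/-- A fibrewise linear isomorphism of symplectic vector bundles that is biholomorphic and
compatible with the forms. -/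
def IsSymplecticIso {p p' : ℕ} {V : SymplecticVectorBundle X p} {V' : SymplecticVectorBundle X p'}
    (f : ∀ x, V.Fiber x ≃ₗ[ℂ] V'.Fiber x) : Prop :=
  (∀ (U : Set X) (s : ∀ x, V.Fiber x), IsOpen U →
    (V'.IsHolSection U (fun x => f x (s x)) ↔ V.IsHolSection U s)) ∧
  ∀ x v w, V'.form x (f x v) (f x w) = V.form x v w

/-- `M ≅ M'`. Compatibility with `γ` follows from that with `β`. -/
def Isomorphic {p q p' q' : ℕ} (M : SpHiggsBundle X p q) (M' : SpHiggsBundle X p' q') : Prop :=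
  ∃ (f : ∀ x, M.V.Fiber x ≃ₗ[ℂ] M'.V.Fiber x) (g : ∀ x, M.W.Fiber x ≃ₗ[ℂ] M'.W.Fiber x),
    IsSymplecticIso f ∧ IsSymplecticIso g ∧
    ∀ x ξ w, M'.β.toFun x ξ (g x w) = f x (M.β.toFun x ξ w)

/-- The automorphism group of `M`: pairs `(f, g)` of automorphisms of the symplectic vector bundles
`V` and `W` with `f β = β g`. -/
def Aut {p q : ℕ} (M : SpHiggsBundle X p q) :
    Subgroup ((∀ x, M.V.Fiber x ≃ₗ[ℂ] M.V.Fiber x) × (∀ x, M.W.Fiber x ≃ₗ[ℂ] M.W.Fiber x)) where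
  carrier := {a | IsSymplecticIso a.1 ∧ IsSymplecticIso a.2 ∧
    ∀ x ξ w, a.1 x (M.β.toFun x ξ w) = M.β.toFun x ξ (a.2 x w)}
  one_mem' := ⟨⟨fun _ _ _ => Iff.rfl, fun _ _ _ => rfl⟩, ⟨fun _ _ _ => Iff.rfl, fun _ _ _ => rfl⟩,
    fun _ _ _ => rfl⟩
  mul_mem' := by
    rintro a b ⟨⟨ha1, ha2⟩, ⟨ha3, ha4⟩, ha5⟩ ⟨⟨hb1, hb2⟩, ⟨hb3, hb4⟩, hb5⟩
    refine ⟨⟨fun U s hU => ?_, fun x v w => ?_⟩, ⟨fun U s hU => ?_, fun x v w => ?_⟩,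
      fun x ξ w => ?_⟩
    · exact (ha1 U (fun x => b.1 x (s x)) hU).trans (hb1 U s hU)
    · exact (ha2 x (b.1 x v) (b.1 x w)).trans (hb2 x v w)
    · exact (ha3 U (fun x => b.2 x (s x)) hU).trans (hb3 U s hU)
    · exact (ha4 x (b.2 x v) (b.2 x w)).trans (hb4 x v w)
    · exact (congrArg (a.1 x) (hb5 x ξ w)).trans (ha5 x ξ (b.2 x w))
  inv_mem' := by
    rintro a ⟨⟨ha1, ha2⟩, ⟨ha3, ha4⟩, ha5⟩
    refine ⟨⟨fun U s hU => ?_, fun x v w => ?_⟩, ⟨fun U s hU => ?_, fun x v w => ?_⟩,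
      fun x ξ w => ?_⟩
    · have h := ha1 U (fun x => (a.1 x).symm (s x)) hU
      simp only [LinearEquiv.apply_symm_apply] at h
      exact h.symm
    · have h := ha2 x ((a.1 x).symm v) ((a.1 x).symm w)
      simp only [LinearEquiv.apply_symm_apply] at h
      exact h.symm
    · have h := ha3 U (fun x => (a.2 x).symm (s x)) hU
      simp only [LinearEquiv.apply_symm_apply] at h
      exact h.symm
    · have h := ha4 x ((a.2 x).symm v) ((a.2 x).symm w)
      simp only [LinearEquiv.apply_symm_apply] at h
      exact h.symm
    · have h := ha5 x ξ ((a.2 x).symm w)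
      simp only [LinearEquiv.apply_symm_apply] at h
      exact (LinearEquiv.symm_apply_eq _).2 h.symm

/-- Simplicity: `Aut M = {(1, 1), (-1, -1)}`, which is `ℤ/2` unless `V = W = 0`. -/
def IsSimple {p q : ℕ} (M : SpHiggsBundle X p q) : Prop :=
  ∀ a, a ∈ M.Aut ↔ a = 1 ∨ a = (fun _ => LinearEquiv.neg ℂ, fun _ => LinearEquiv.neg ℂ)

/-- `M` is isomorphic to the direct sum `⨁ᵢ N i`, whose bundles are the direct sums of those of
the `N i` (a section is holomorphic iff its components are), with the orthogonal direct sums of the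
symplectic forms and the componentwise `β` (and hence `γ`). -/
def IsDirectSum {p q : ℕ} (M : SpHiggsBundle X p q) {r : ℕ} {P Q : Fin r → ℕ}
    (N : ∀ i, SpHiggsBundle X (P i) (Q i)) : Prop :=
  ∃ (f : ∀ x, (∀ i, (N i).V.Fiber x) ≃ₗ[ℂ] M.V.Fiber x)
    (g : ∀ x, (∀ i, (N i).W.Fiber x) ≃ₗ[ℂ] M.W.Fiber x),
    (∀ (U : Set X) (s : ∀ x i, (N i).V.Fiber x), IsOpen U →
      (M.V.IsHolSection U (fun x => f x (s x)) ↔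
        ∀ i, (N i).V.IsHolSection U (fun x => s x i))) ∧
    (∀ (U : Set X) (s : ∀ x i, (N i).W.Fiber x), IsOpen U →
      (M.W.IsHolSection U (fun x => g x (s x)) ↔
        ∀ i, (N i).W.IsHolSection U (fun x => s x i))) ∧
    (∀ x v v', M.V.form x (f x v) (f x v') = ∑ i, (N i).V.form x (v i) (v' i)) ∧
    (∀ x w w', M.W.form x (g x w) (g x w') = ∑ i, (N i).W.form x (w i) (w' i)) ∧
    ∀ x ξ w, M.β.toFun x ξ (g x w) = f x (fun i => (N i).β.toFun x ξ (w i))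

/-- `M ≅ ⨁ᵢ N i` with `r > 1` nonzero, stable, simple and mutually non-isomorphic summands. -/
def IsStableSimpleSum [T2Space X] [CompactSpace X] {p q : ℕ} (M : SpHiggsBundle X p q) {r : ℕ}
    {P Q : Fin r → ℕ} (N : ∀ i, SpHiggsBundle X (P i) (Q i)) : Prop :=
  1 < r ∧ (∀ i, P i ≠ 0 ∨ Q i ≠ 0) ∧ (∀ i, (N i).IsStable ∧ (N i).IsSimple) ∧
    (∀ i j, i ≠ j → ¬ (N i).Isomorphic (N j)) ∧ M.IsDirectSum N

end SpHiggsBundle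

/-! Everything rests on one inequality between degrees. Let a holomorphic pairing be restricted to
subbundles S and S′, with saturated left and right kernels K ⊆ S and K′ ⊆ S′. It induces a
generically perfect pairing of S/K with S′/K′, whose determinant is a nonzero section of a line
bundle of degree deg K + deg K′ − deg S − deg S′. Hence deg S + deg S′ ≤ deg K + deg K′, with
equality exactly when the determinant has no zero, that is, when K is the kernel at every point
(`degree_pairing`, `degree_kernel`).

Since the degree is a curvature integral, the sign of the degree of a line bundle with a section has
to be proved analytically. The integral of a Laplacian over X vanishes
(`densityIntegral_laplacian_eq_zero`). If F is the squared norm of the section, log F has the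
curvature as its Laplacian where F ≠ 0, and the regularization log (F + ε) handles the zeros. A zero
makes the inequality strict because the section can be divided by a coordinate.

Let M be stable and S an invariant subbundle. Pairing S with itself gives deg S ≤ deg R, where the
radical R is isotropic and invariant. So deg S ≤ 0, and deg S = 0 forces the form to be
nondegenerate on S (`degree_nonpos`). As deg M = 0, the kernel of a homomorphism of stable Higgs
bundles is a subbundle of degree 0 (`exists_ker`). A skew-adjoint endomorphism a of M is therefore
zero (`IsStable.eq_zero_of_skew`): its eigenbundles for nonzero eigenvalues are isotropic, its image
is orthogonal to its kernel, and the form is nondegenerate on all of these kernels.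

For an automorphism φ the difference φ − φ⁻¹ is skew-adjoint, so φ² = 1 and (1 + φ)/2 is an
orthogonal projection. Thus M is simple if and only if it has no orthogonal projections besides 0
and 1. A decomposition of 1 into the largest possible number of orthogonal projections has simple
summands. They are stable as summands of M, and an isomorphism between two of them would give a
nonzero skew-adjoint endomorphism of M.

Conversely, let M be a sum of pairwise non-isomorphic stable and simple N i, and let S be a nonzero
isotropic invariant subbundle of degree ≥ 0 and of minimal rank. Each projection S → N i is zero or
an isomorphism. Two isomorphisms would identify two summands, up to a scalar that makes the
identification symplectic. A single one makes the form nondegenerate on S. Both are absurd, so M is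
stable (`IsHiggsSum.degree_neg`). All automorphisms of M are then involutions, hence commute with
the projections to the summands, and act on each simple summand by a sign. This gives the group
(ℤ/2)^r. -/

open Filter Topology

set_option linter.unusedSectionVars false

/-! ### The Laplacian in the plane -/

theorem laplacian_apply_fderiv (f : ℂ → ℝ) (z : ℂ) :
    (Δ f) z = fderiv ℝ (fderiv ℝ f) z 1 1 +
      fderiv ℝ (fderiv ℝ f) z Complex.I Complex.I := by
  rw [InnerProductSpace.laplacian_eq_iteratedFDeriv_complexPlane]
  simp [iteratedFDeriv_two_apply]

theorem ContDiffAt.differentiableAt_fderiv {E F : Type*} [NormedAddCommGroup E] [NormedSpace ℝ E]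
    [NormedAddCommGroup F] [NormedSpace ℝ F] {f : E → F} {z : E} (h : ContDiffAt ℝ 2 f z) :
    DifferentiableAt ℝ (fderiv ℝ f) z :=
  (h.fderiv_right (m := 1) (by norm_num)).differentiableAt one_ne_zero

theorem ContDiffAt.eventually_differentiableAt {E F : Type*} [NormedAddCommGroup E]
    [NormedSpace ℝ E] [NormedAddCommGroup F] [NormedSpace ℝ F] {f : E → F} {z : E}
    (h : ContDiffAt ℝ 2 f z) : ∀ᶠ y in 𝓝 z, DifferentiableAt ℝ f y := by
  filter_upwards [h.eventually (by simp)] with y hy using hy.differentiableAt two_ne_zero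

theorem fderiv_fderiv_comp_real {ψ : ℝ → ℝ} {u : ℂ → ℝ} {z : ℂ} (hψ : ContDiffAt ℝ 2 ψ (u z))
    (hu : ContDiffAt ℝ 2 u z) (v w : ℂ) :
    fderiv ℝ (fderiv ℝ (ψ ∘ u)) z v w = deriv ψ (u z) * fderiv ℝ (fderiv ℝ u) z v w +
      deriv (deriv ψ) (u z) * (fderiv ℝ u z v * fderiv ℝ u z w) := by
  have h1 : fderiv ℝ (ψ ∘ u) =ᶠ[𝓝 z] fun y => deriv ψ (u y) • fderiv ℝ u y := by
    filter_upwards [hu.continuousAt.eventually hψ.eventually_differentiableAt,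
      hu.eventually_differentiableAt] with y h1 h2
    ext v
    rw [fderiv_comp y h1 h2]
    simp [mul_comm]
  rw [h1.fderiv_eq]
  have h2 : HasDerivAt (deriv ψ) (deriv (deriv ψ) (u z)) (u z) := by
    have : ContDiffAt ℝ 1 (deriv ψ) (u z) := by
      have := hψ.fderiv_right (m := 1) (by norm_num)
      have h3 : deriv ψ = fun x => fderiv ℝ ψ x 1 := by ext; simp
      rw [h3]
      exact this.clm_apply contDiffAt_const
    exact (this.differentiableAt one_ne_zero).hasDerivAt
  have h3 := h2.comp_hasFDerivAt z (hu.differentiableAt two_ne_zero).hasFDerivAt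
  have h4 := h3.smul hu.differentiableAt_fderiv.hasFDerivAt
  have h5 : fderiv ℝ (fun y => deriv ψ (u y) • fderiv ℝ u y) z = _ := h4.fderiv
  rw [h5]
  simp
  ring

theorem laplacian_comp_real {ψ : ℝ → ℝ} {u : ℂ → ℝ} {z : ℂ} (hψ : ContDiffAt ℝ 2 ψ (u z))
    (hu : ContDiffAt ℝ 2 u z) :
    (Δ (ψ ∘ u)) z = deriv ψ (u z) * (Δ u) z +
      deriv (deriv ψ) (u z) * (fderiv ℝ u z 1 ^ 2 + fderiv ℝ u z Complex.I ^ 2) := by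
  rw [laplacian_apply_fderiv, laplacian_apply_fderiv, fderiv_fderiv_comp_real hψ hu,
    fderiv_fderiv_comp_real hψ hu]
  ring

theorem AnalyticAt.contDiffAt_real {T : ℂ → ℂ} {z : ℂ} (hT : AnalyticAt ℂ T z) {n : ℕ∞ω} :
    ContDiffAt ℝ n T z :=
  hT.contDiffAt.restrict_scalars ℝ

theorem fderiv_fderiv_comp_analytic {T : ℂ → ℂ} {u : ℂ → ℝ} {z : ℂ} (hT : AnalyticAt ℂ T z)
    (hu : ContDiffAt ℝ 2 u (T z)) (v : ℂ) :
    fderiv ℝ (fderiv ℝ (u ∘ T)) z v v =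
      fderiv ℝ (fderiv ℝ u) (T z) (deriv T z * v) (deriv T z * v) +
        fderiv ℝ u (T z) (deriv (deriv T) z * v * v) := by
  have hT' : ∀ᶠ y in 𝓝 z, HasFDerivAt T
      ((ContinuousLinearMap.toSpanSingleton ℂ (deriv T y)).restrictScalars ℝ) y := by
    filter_upwards [hT.eventually_analyticAt] with y hy
    exact hy.differentiableAt.hasDerivAt.hasFDerivAt.restrictScalars ℝ
  have h1 : (fun y => fderiv ℝ (u ∘ T) y v) =ᶠ[𝓝 z]
      fun y => fderiv ℝ u (T y) (deriv T y * v) := by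
    filter_upwards [hT', hT.continuousAt.eventually hu.eventually_differentiableAt] with y h1 h2
    rw [(h2.hasFDerivAt.comp y h1).fderiv]
    simp [mul_comm]
  have h0 : ContDiffAt ℝ 2 (u ∘ T) z := hu.comp z hT.contDiffAt_real
  have h2 : fderiv ℝ (fderiv ℝ (u ∘ T)) z v v = fderiv ℝ (fun y => fderiv ℝ (u ∘ T) y v) z v := by
    have := (h0.differentiableAt_fderiv.hasFDerivAt.clm_apply (hasFDerivAt_const v z)).fderiv
    rw [this]; simp
  rw [h2, h1.fderiv_eq]
  have h3 : HasFDerivAt (fun y => deriv T y * v)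
      (((ContinuousLinearMap.toSpanSingleton ℂ (deriv (deriv T) z * v))).restrictScalars ℝ) z :=
    ((hT.deriv.differentiableAt.hasDerivAt.mul_const v).hasFDerivAt).restrictScalars ℝ
  have h4 := (hu.differentiableAt_fderiv.hasFDerivAt.comp z hT'.self_of_nhds).clm_apply h3
  have h5 : fderiv ℝ (fun y => fderiv ℝ u (T y) (deriv T y * v)) z = _ := h4.fderiv
  rw [h5]
  simp [mul_comm, add_comm]

/-- The gradient terms for the directions 1 and i cancel because i² = −1. The Hessian is evaluated
at T′ and iT′, which are orthogonal of length ‖T′‖. -/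
theorem laplacian_comp_analytic {T : ℂ → ℂ} {u : ℂ → ℝ} {z : ℂ} (hT : AnalyticAt ℂ T z)
    (hu : ContDiffAt ℝ 2 u (T z)) :
    (Δ (u ∘ T)) z = ‖deriv T z‖ ^ 2 * (Δ u) (T z) := by
  rw [laplacian_apply_fderiv, laplacian_apply_fderiv, fderiv_fderiv_comp_analytic hT hu,
    fderiv_fderiv_comp_analytic hT hu]
  set D := fderiv ℝ (fderiv ℝ u) (T z)
  set a := deriv T z
  have e1 : deriv (deriv T) z * Complex.I * Complex.I = -(deriv (deriv T) z * 1 * 1) := by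
    rw [mul_assoc, Complex.I_mul_I]; ring
  rw [e1, map_neg]
  have ea : a * 1 = a.re • (1 : ℂ) + a.im • Complex.I := by
    simp [Complex.re_add_im]
  have eb : a * Complex.I = (-a.im) • (1 : ℂ) + a.re • Complex.I := by
    apply Complex.ext <;> simp
  rw [ea, eb]
  have hn : ‖a‖ ^ 2 = a.re ^ 2 + a.im ^ 2 := by
    rw [← Complex.normSq_eq_norm_sq, Complex.normSq_apply]; ring
  rw [hn]
  simp only [map_add, map_smul, add_apply, smul_apply,
    smul_eq_mul]
  ring

/-- This is what makes curvature independent of the holomorphic frame in which it is computed. -/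
theorem laplacian_log_norm_sq {h : ℂ → ℂ} {z : ℂ} (hh : AnalyticAt ℂ h z) (h0 : h z ≠ 0) :
    (Δ fun w => Real.log (‖h w‖ ^ 2)) z = 0 := by
  have h1 : (fun w => Real.log (‖h w‖ ^ 2)) = (2 : ℝ) • fun w => Real.log ‖h w‖ := by
    ext w; simp
  rw [h1]
  have h2 := ((hh.harmonicAt_log_norm h0).const_smul (c := (2 : ℝ))).2
  exact h2.self_of_nhds

theorem AnalyticAt.contDiffAt_log_norm_sq {h : ℂ → ℂ} {z : ℂ} (hh : AnalyticAt ℂ h z)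
    (h0 : h z ≠ 0) {n : ℕ∞ω} : ContDiffAt ℝ n (fun w => Real.log (‖h w‖ ^ 2)) z :=
  (hh.contDiffAt_real.norm_sq ℝ).log (by simpa using h0)

theorem ContDiffAt.continuousAt_laplacian {η : ℂ → ℝ} {z : ℂ} (hη : ContDiffAt ℝ 2 η z) :
    ContinuousAt (Δ η) z := by
  have h1 : ContDiffAt ℝ 1 (fderiv ℝ η) z := hη.fderiv_right (by norm_num)
  have h2 : ContinuousAt (fderiv ℝ (fderiv ℝ η)) z :=
    (h1.fderiv_right (m := 0) (by norm_num)).continuousAt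
  have : Δ η = fun z => fderiv ℝ (fderiv ℝ η) z 1 1 +
      fderiv ℝ (fderiv ℝ η) z Complex.I Complex.I := funext (laplacian_apply_fderiv η)
  rw [this]
  fun_prop

/-- Integration by parts against the constant function 1. -/
theorem integral_fderiv_apply_eq_zero {g : ℂ → ℝ} (hg : ContDiff ℝ 1 g) (hc : HasCompactSupport g)
    (v : ℂ) : ∫ z, fderiv ℝ g z v = 0 := by
  have h1 : Continuous fun z => fderiv ℝ g z v :=
    (hg.continuous_fderiv one_ne_zero).clm_apply continuous_const
  have h2 : HasCompactSupport fun z => fderiv ℝ g z v := hc.fderiv_apply ℝ v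
  have := integral_mul_fderiv_eq_neg_fderiv_mul_of_integrable (μ := MeasureTheory.volume)
    (f := fun _ : ℂ => (1 : ℝ)) (g := g) (v := v) (by simp)
    (by simpa using h1.integrable_of_hasCompactSupport h2)
    (by simpa using hg.continuous.integrable_of_hasCompactSupport hc)
    (fun _ _ => differentiableAt_const _)
    (fun x _ => hg.differentiable one_ne_zero x)
  simpa using this

theorem integral_laplacian_eq_zero {η : ℂ → ℝ} (hη : ContDiff ℝ 2 η) (hc : HasCompactSupport η) :
    ∫ z, (Δ η) z = 0 := by
  have h1 : ContDiff ℝ 1 (fderiv ℝ η) := hη.fderiv_right (by norm_num)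
  have hD : ∀ v : ℂ, ContDiff ℝ 1 (fun z => fderiv ℝ η z v) := fun v =>
    h1.clm_apply contDiff_const
  have hC : ∀ v : ℂ, HasCompactSupport (fun z => fderiv ℝ η z v) := fun v => hc.fderiv_apply ℝ v
  have key : ∀ v z, fderiv ℝ (fun z => fderiv ℝ η z v) z v = fderiv ℝ (fderiv ℝ η) z v v := by
    intro v z
    have := ((h1.differentiable one_ne_zero z).hasFDerivAt.clm_apply (hasFDerivAt_const v z)).fderiv
    rw [this]; simp
  have hI : ∀ v, MeasureTheory.Integrable fun z => fderiv ℝ (fun z => fderiv ℝ η z v) z v := fun v =>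
    (((hD v).continuous_fderiv one_ne_zero).clm_apply
      continuous_const).integrable_of_hasCompactSupport ((hC v).fderiv_apply ℝ v)
  simp only [laplacian_apply_fderiv, ← key]
  rw [MeasureTheory.integral_add (hI 1) (hI _), integral_fderiv_apply_eq_zero (hD 1) (hC 1),
    integral_fderiv_apply_eq_zero (hD _) (hC _), add_zero]

/-- The regularized logarithm is subharmonic up to the curvature term. -/
theorem laplacian_log_add_ge {f φ : ℂ → ℝ} {h : ℂ → ℂ} {z : ℂ} {ε : ℝ} (hε : 0 < ε)
    (hh : AnalyticAt ℂ h z) (h0 : h z ≠ 0) (hφ : ContDiffAt ℝ 2 φ z)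
    (hf : ∀ᶠ w in 𝓝 z, f w = ‖h w‖ ^ 2 * Real.exp (φ w)) :
    f z / (f z + ε) * (Δ φ) z ≤ (Δ fun w => Real.log (f w + ε)) z := by
  -- Write f = exp u and log (f + ε) = ψ ∘ u. The chain rule gives ψ′ Δu + ψ″ |∇u|², where ψ′ = f/(f
  -- + ε), ψ is convex, and Δu = Δφ because log ‖h‖² is harmonic.
  set u : ℂ → ℝ := fun w => Real.log (‖h w‖ ^ 2) + φ w with hu
  set ψ : ℝ → ℝ := fun t => Real.log (Real.exp t + ε) with hψ
  have huC : ContDiffAt ℝ 2 u z := (hh.contDiffAt_log_norm_sq h0).add hφ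
  have hpos : ∀ t, Real.exp t + ε ≠ 0 := fun t => by positivity
  have hψC : ContDiff ℝ 2 ψ := (Real.contDiff_exp.add contDiff_const).log hpos
  have hd : ∀ t, HasDerivAt ψ (Real.exp t / (Real.exp t + ε)) t := fun t =>
    ((Real.hasDerivAt_exp t).add_const ε).log (hpos t)
  have hd1 : deriv ψ = fun t => Real.exp t / (Real.exp t + ε) := funext fun t => (hd t).deriv
  have hd2 : ∀ t, deriv (deriv ψ) t = ε * Real.exp t / (Real.exp t + ε) ^ 2 := by
    intro t
    rw [hd1]
    refine ((Real.hasDerivAt_exp t).div ((Real.hasDerivAt_exp t).add_const ε)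
      (hpos t)).deriv.trans ?_
    ring
  have hne : ∀ᶠ w in 𝓝 z, h w ≠ 0 := hh.continuousAt.eventually_ne h0
  have hexp : ∀ᶠ w in 𝓝 z, f w = Real.exp (u w) := by
    filter_upwards [hf, hne] with w h1 h2
    rw [h1, hu, Real.exp_add, Real.exp_log (by positivity)]
  have he : (fun w => Real.log (f w + ε)) =ᶠ[𝓝 z] ψ ∘ u := by
    filter_upwards [hexp] with w h1
    simp [hψ, h1]
  rw [InnerProductSpace.laplacian_congr_nhds he |>.self_of_nhds,
    laplacian_comp_real hψC.contDiffAt huC]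
  have hΔ : (Δ u) z = (Δ φ) z := by
    have : u = (fun w => Real.log (‖h w‖ ^ 2)) + φ := rfl
    rw [this, (hh.contDiffAt_log_norm_sq h0).laplacian_add hφ, laplacian_log_norm_sq hh h0, zero_add]
  rw [hΔ, hd2, hd1, hexp.self_of_nhds]
  have : 0 ≤ ε * Real.exp (u z) / (Real.exp (u z) + ε) ^ 2 *
      (fderiv ℝ u z 1 ^ 2 + fderiv ℝ u z Complex.I ^ 2) := by positivity
  simpa using this

theorem two_le_smooth : (2 : ℕ∞ω) ≤ ∞ := by
  have : ((2 : ℕ∞) : ℕ∞ω) ≤ ∞ := WithTop.coe_le_coe.2 le_top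
  exact this

/-! ### Functions on a Riemann surface in charts -/

section Charts

variable {X : Type*} [TopologicalSpace X] [ChartedSpace ℂ X]

/-- `f` is holomorphic near `x`. -/
def HolFnAt (f : X → ℂ) (x : X) : Prop := ContMDiffAt 𝓘(ℂ) 𝓘(ℂ) ω f x

/-- `f` is smooth near `x`. -/
def SmoothFnAt (f : X → ℝ) (x : X) : Prop := ContMDiffAt 𝓘(ℝ, ℂ) 𝓘(ℝ, ℝ) ∞ f x

variable [IsManifold 𝓘(ℂ) ω X]

theorem SmoothFnAt.contDiffAt {f : X → ℝ} {c : X} {z : ℂ} (hz : z ∈ (chartAt ℂ c).target)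
    (hf : SmoothFnAt f ((chartAt ℂ c).symm z)) :
    ContDiffAt ℝ ∞ (fun w => f ((chartAt ℂ c).symm w)) z := by
  have : IsManifold 𝓘(ℝ, ℂ) ∞ X := isManifold_real
  have h1 : ContMDiffAt 𝓘(ℝ, ℂ) 𝓘(ℝ, ℂ) ∞ (chartAt ℂ c).symm z :=
    (contMDiffOn_chart_symm (I := 𝓘(ℝ, ℂ)) (x := c)).contMDiffAt
      ((chartAt ℂ c).open_target.mem_nhds hz)
  exact (ContMDiffAt.comp z hf h1).contDiffAt

theorem smoothFnAt_of_contDiffAt {f : X → ℝ} {c x : X} (hx : x ∈ (chartAt ℂ c).source)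
    (hf : ContDiffAt ℝ ∞ (fun w => f ((chartAt ℂ c).symm w)) (chartAt ℂ c x)) :
    SmoothFnAt f x := by
  have : IsManifold 𝓘(ℝ, ℂ) ∞ X := isManifold_real
  have h1 : ContMDiffAt 𝓘(ℝ, ℂ) 𝓘(ℝ, ℂ) ∞ (chartAt ℂ c) x :=
    (contMDiffOn_chart (I := 𝓘(ℝ, ℂ)) (x := c)).contMDiffAt
      ((chartAt ℂ c).open_source.mem_nhds hx)
  refine (ContMDiffAt.comp x (hf.contMDiffAt) h1).congr_of_eventuallyEq ?_
  filter_upwards [(chartAt ℂ c).open_source.mem_nhds hx] with y hy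
  simp [(chartAt ℂ c).left_inv hy]

theorem HolFnAt.analyticAt {f : X → ℂ} {c : X} {z : ℂ} (hz : z ∈ (chartAt ℂ c).target)
    (hf : HolFnAt f ((chartAt ℂ c).symm z)) :
    AnalyticAt ℂ (fun w => f ((chartAt ℂ c).symm w)) z := by
  have h1 : ContMDiffAt 𝓘(ℂ) 𝓘(ℂ) ω (chartAt ℂ c).symm z :=
    (contMDiffOn_chart_symm (I := 𝓘(ℂ)) (x := c)).contMDiffAt
      ((chartAt ℂ c).open_target.mem_nhds hz)
  exact (ContMDiffAt.comp z hf h1).contDiffAt.analyticAt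

theorem holFnAt_of_analyticAt {f : X → ℂ} {c x : X} (hx : x ∈ (chartAt ℂ c).source)
    (hf : AnalyticAt ℂ (fun w => f ((chartAt ℂ c).symm w)) (chartAt ℂ c x)) :
    HolFnAt f x := by
  have h1 : ContMDiffAt 𝓘(ℂ) 𝓘(ℂ) ω (chartAt ℂ c) x :=
    (contMDiffOn_chart (I := 𝓘(ℂ)) (x := c)).contMDiffAt
      ((chartAt ℂ c).open_source.mem_nhds hx)
  refine (ContMDiffAt.comp x hf.contDiffAt.contMDiffAt h1).congr_of_eventuallyEq ?_
  filter_upwards [(chartAt ℂ c).open_source.mem_nhds hx] with y hy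
  simp [(chartAt ℂ c).left_inv hy]

theorem holFnAt_chart {c x : X} (hx : x ∈ (chartAt ℂ c).source) :
    HolFnAt (fun y => chartAt ℂ c y) x :=
  (contMDiffOn_chart (I := 𝓘(ℂ)) (x := c)).contMDiffAt
      ((chartAt ℂ c).open_source.mem_nhds hx)

theorem analyticAt_transition {c d : X} {w : ℂ} (hw : w ∈ (chartAt ℂ d).target)
    (hc : (chartAt ℂ d).symm w ∈ (chartAt ℂ c).source) :
    AnalyticAt ℂ (fun w => chartAt ℂ c ((chartAt ℂ d).symm w)) w :=
  (holFnAt_chart hc).analyticAt hw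

theorem eventually_chart_symm {c : X} {z : ℂ} (hz : z ∈ (chartAt ℂ c).target) {p : X → Prop}
    (hp : ∀ᶠ y in 𝓝 ((chartAt ℂ c).symm z), p y) : ∀ᶠ w in 𝓝 z, p ((chartAt ℂ c).symm w) :=
  ((chartAt ℂ c).symm.continuousAt hz).eventually hp

theorem HolFnAt.eventually {f : X → ℂ} {x : X} (hf : HolFnAt f x) :
    ∀ᶠ y in 𝓝 x, HolFnAt f y :=
  (contMDiffAt_iff_contMDiffAt_nhds (by simp)).1 hf

end Charts

/-! ### Densities and their integrals -/

section Density

open MeasureTheory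

variable {X : Type*} [TopologicalSpace X] [ChartedSpace ℂ X]

/-- The integral over `X` of a density given by its expression in each chart. -/
noncomputable def densityIntegral (ρ : SmoothPartitionOfUnity X 𝓘(ℝ, ℂ) X Set.univ)
    (D : X → ℂ → ℝ) : ℝ :=
  ∑ᶠ c : X, ∫ z in (chartAt ℂ c).target, ρ c ((chartAt ℂ c).symm z) * D c z

variable {ρ : SmoothPartitionOfUnity X 𝓘(ℝ, ℂ) X Set.univ}

/-- The finite set of members of the partition of unity that are not zero. -/
noncomputable def partitionSupport [CompactSpace X]
    (ρ : SmoothPartitionOfUnity X 𝓘(ℝ, ℂ) X Set.univ) : Finset X :=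
  (ρ.locallyFinite.finite_nonempty_of_compact).toFinset

theorem eq_zero_of_notMem_partitionSupport [CompactSpace X] {c : X}
    (hc : c ∉ partitionSupport ρ) (x : X) : ρ c x = 0 := by
  by_contra h
  exact hc ((ρ.locallyFinite.finite_nonempty_of_compact).mem_toFinset.2 ⟨x, h⟩)

theorem sum_partitionSupport [CompactSpace X] (x : X) :
    ∑ c ∈ partitionSupport ρ, ρ c x = 1 := by
  rw [← ρ.sum_eq_one (Set.mem_univ x)]
  refine (finsum_eq_sum_of_support_subset _ fun c hc => ?_).symm
  by_contra h
  exact hc (eq_zero_of_notMem_partitionSupport h x)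

theorem densityIntegral_eq_sum [CompactSpace X] (D : X → ℂ → ℝ) :
    densityIntegral ρ D = ∑ c ∈ partitionSupport ρ,
      ∫ z in (chartAt ℂ c).target, ρ c ((chartAt ℂ c).symm z) * D c z := by
  refine finsum_eq_sum_of_support_subset _ fun c hc => ?_
  by_contra h
  exact hc (by simp [eq_zero_of_notMem_partitionSupport h])

/-- The density may be unbounded near the boundary of the chart, but the cutoff is supported in a
compact subset of the target. -/
theorem integrableOn_density [CompactSpace X] [T2Space X]
    (hρ : ρ.IsSubordinate (fun x => (chartAt ℂ x).source)) {D : X → ℂ → ℝ} {c : X}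
    (hD : ContinuousOn (D c) (chartAt ℂ c).target) :
    IntegrableOn (fun z => ρ c ((chartAt ℂ c).symm z) * D c z) (chartAt ℂ c).target := by
  set e := chartAt ℂ c
  have hK : IsCompact (e '' tsupport (ρ c)) :=
    (isClosed_tsupport _).isCompact.image_of_continuousOn (e.continuousOn.mono (hρ c))
  have hsub : e '' tsupport (ρ c) ⊆ e.target := by
    rintro _ ⟨x, hx, rfl⟩
    exact e.map_source (hρ c hx)
  have hcont : ContinuousOn (fun z => ρ c (e.symm z) * D c z) e.target :=
    ((ρ c).contMDiff.continuous.comp_continuousOn e.continuousOn_symm).mul hD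
  refine IntegrableOn.of_forall_sdiff_eq_zero
    ((hcont.mono hsub).integrableOn_compact hK) e.open_target.measurableSet ?_
  rintro z ⟨hz, hz'⟩
  have : ρ c (e.symm z) = 0 := by
    apply image_eq_zero_of_notMem_tsupport
    intro h
    exact hz' ⟨e.symm z, h, e.right_inv hz⟩
  simp [this]

variable [CompactSpace X] [T2Space X]

theorem densityIntegral_add (hρ : ρ.IsSubordinate (fun x => (chartAt ℂ x).source))
    {D D' : X → ℂ → ℝ} (hD : ∀ c, ContinuousOn (D c) (chartAt ℂ c).target)
    (hD' : ∀ c, ContinuousOn (D' c) (chartAt ℂ c).target) :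
    densityIntegral ρ (fun c z => D c z + D' c z) =
      densityIntegral ρ D + densityIntegral ρ D' := by
  simp only [densityIntegral_eq_sum, ← Finset.sum_add_distrib]
  refine Finset.sum_congr rfl fun c _ => ?_
  rw [← integral_add (integrableOn_density hρ (hD c)) (integrableOn_density hρ (hD' c))]
  simp only [mul_add]

theorem densityIntegral_const_mul (a : ℝ) (D : X → ℂ → ℝ) :
    densityIntegral ρ (fun c z => a * D c z) = a * densityIntegral ρ D := by
  simp only [densityIntegral_eq_sum, Finset.mul_sum, ← integral_const_mul]
  simp only [mul_left_comm]

theorem densityIntegral_congr {D D' : X → ℂ → ℝ}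
    (h : ∀ c, ∀ z ∈ (chartAt ℂ c).target, D c z = D' c z) :
    densityIntegral ρ D = densityIntegral ρ D' := by
  unfold densityIntegral
  refine finsum_congr fun c => setIntegral_congr_fun (chartAt ℂ c).open_target.measurableSet ?_
  intro z hz
  simp [h c z hz]

theorem finite_chart_preimage {Z : Set X} (hZ : Z.Finite) (c : X) :
    ((chartAt ℂ c).target ∩ (chartAt ℂ c).symm ⁻¹' Z).Finite := by
  refine Set.Finite.subset (hZ.image (chartAt ℂ c)) ?_
  rintro z ⟨hz, hz'⟩
  exact ⟨_, hz', (chartAt ℂ c).right_inv hz⟩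

theorem ae_chart_notMem {Z : Set X} (hZ : Z.Finite) (c : X) :
    ∀ᵐ z ∂(volume.restrict (chartAt ℂ c).target), (chartAt ℂ c).symm z ∉ Z := by
  rw [ae_restrict_iff' (chartAt ℂ c).open_target.measurableSet]
  filter_upwards [(finite_chart_preimage hZ c).countable.ae_notMem volume] with z hz hzt h
  exact hz ⟨hzt, h⟩

/-- A finite set is null in every chart. It will be the set of zeros of a section, where the
comparison of densities is not available. -/
theorem densityIntegral_mono (hρ : ρ.IsSubordinate (fun x => (chartAt ℂ x).source))
    {D D' : X → ℂ → ℝ} (hD : ∀ c, ContinuousOn (D c) (chartAt ℂ c).target)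
    (hD' : ∀ c, ContinuousOn (D' c) (chartAt ℂ c).target) {Z : Set X} (hZ : Z.Finite)
    (h : ∀ c, ∀ z ∈ (chartAt ℂ c).target, (chartAt ℂ c).symm z ∉ Z → D c z ≤ D' c z) :
    densityIntegral ρ D ≤ densityIntegral ρ D' := by
  simp only [densityIntegral_eq_sum]
  refine Finset.sum_le_sum fun c _ => ?_
  refine integral_mono_ae (integrableOn_density hρ (hD c)) (integrableOn_density hρ (hD' c)) ?_
  filter_upwards [ae_chart_notMem hZ c,
    ae_restrict_mem (chartAt ℂ c).open_target.measurableSet] with z h1 h2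
  exact mul_le_mul_of_nonneg_left (h c z h2 h1) (ρ.nonneg _ _)

/-- Some cutoff is positive at x. By continuity its product with the density stays positive on a
neighbourhood, which has positive measure. -/
theorem densityIntegral_pos (hρ : ρ.IsSubordinate (fun x => (chartAt ℂ x).source))
    {D : X → ℂ → ℝ} (hD : ∀ c, ContinuousOn (D c) (chartAt ℂ c).target)
    (h : ∀ c, ∀ z ∈ (chartAt ℂ c).target, 0 ≤ D c z) {x : X}
    (hx : ∀ c, x ∈ (chartAt ℂ c).source → 0 < D c (chartAt ℂ c x)) :
    0 < densityIntegral ρ D := by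
  rw [densityIntegral_eq_sum]
  obtain ⟨c, hc⟩ := ρ.exists_pos_of_mem (Set.mem_univ x)
  have hcS : c ∈ partitionSupport ρ := by
    by_contra h
    exact hc.ne' (eq_zero_of_notMem_partitionSupport h x)
  have hnn : ∀ c, 0 ≤ᵐ[volume.restrict (chartAt ℂ c).target]
      fun z => ρ c ((chartAt ℂ c).symm z) * D c z := by
    intro c
    filter_upwards [ae_restrict_mem (chartAt ℂ c).open_target.measurableSet] with z h2
    exact mul_nonneg (ρ.nonneg _ _) (h c z h2)
  refine Finset.sum_pos' (fun c _ => integral_nonneg_of_ae (hnn c)) ⟨c, hcS, ?_⟩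
  have hxs : x ∈ (chartAt ℂ c).source := hρ c (subset_tsupport _ hc.ne')
  rw [integral_pos_iff_support_of_nonneg_ae (hnn c) (integrableOn_density hρ (hD c))]
  rw [Measure.restrict_apply' (chartAt ℂ c).open_target.measurableSet]
  have hcont : ContinuousOn (fun z => ρ c ((chartAt ℂ c).symm z) * D c z) (chartAt ℂ c).target :=
    ((ρ c).contMDiff.continuous.comp_continuousOn (chartAt ℂ c).continuousOn_symm).mul (hD c)
  have hzt := (chartAt ℂ c).map_source hxs
  have hpos : 0 < ρ c ((chartAt ℂ c).symm (chartAt ℂ c x)) * D c (chartAt ℂ c x) := by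
    rw [(chartAt ℂ c).left_inv hxs]; exact mul_pos hc (hx c hxs)
  have hev := (hcont.continuousAt ((chartAt ℂ c).open_target.mem_nhds hzt)).eventually_ne hpos.ne'
  refine volume.measure_pos_of_mem_nhds (x := chartAt ℂ c x) (inter_mem hev ?_)
  exact (chartAt ℂ c).open_target.mem_nhds hzt

/-! ### Change of charts and the vanishing of integrals of Laplacians -/

variable [IsManifold 𝓘(ℂ) ω X]

/-- The density of the Laplacian of a smooth function transforms like a `2`-form. -/
theorem laplacian_chart_change {η : X → ℝ} {c d : X} {w : ℂ} (hw : w ∈ (chartAt ℂ d).target)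
    (hc : (chartAt ℂ d).symm w ∈ (chartAt ℂ c).source)
    (hη : SmoothFnAt η ((chartAt ℂ d).symm w)) :
    (Δ fun w => η ((chartAt ℂ d).symm w)) w =
      ‖deriv (fun w => chartAt ℂ c ((chartAt ℂ d).symm w)) w‖ ^ 2 *
        (Δ fun z => η ((chartAt ℂ c).symm z)) (chartAt ℂ c ((chartAt ℂ d).symm w)) := by
  have hT := analyticAt_transition hw hc
  have hu : ContDiffAt ℝ 2 (fun z => η ((chartAt ℂ c).symm z))
      (chartAt ℂ c ((chartAt ℂ d).symm w)) := by
    refine (SmoothFnAt.contDiffAt ((chartAt ℂ c).map_source hc) ?_).of_le two_le_smooth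
    rwa [(chartAt ℂ c).left_inv hc]
  rw [← laplacian_comp_analytic hT hu]
  refine (InnerProductSpace.laplacian_congr_nhds ?_).self_of_nhds
  filter_upwards [eventually_chart_symm hw ((chartAt ℂ c).open_source.mem_nhds hc)] with y hy
  simp [(chartAt ℂ c).left_inv hy]

theorem continuousOn_laplacian_chart {η : X → ℝ} (hη : ∀ x, SmoothFnAt η x) (c : X) :
    ContinuousOn (Δ fun z => η ((chartAt ℂ c).symm z)) (chartAt ℂ c).target := fun _ hz =>
  (((SmoothFnAt.contDiffAt hz (hη _)).of_le two_le_smooth).continuousAt_laplacian).continuousWithinAt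

theorem abs_det_restrictScalars_toSpanSingleton (a : ℂ) :
    |((ContinuousLinearMap.toSpanSingleton ℂ a).restrictScalars ℝ : ℂ →L[ℝ] ℂ).det| = ‖a‖ ^ 2 := by
  have : ((ContinuousLinearMap.toSpanSingleton ℂ a).restrictScalars ℝ : ℂ →L[ℝ] ℂ).det =
      Algebra.norm ℝ a := by
    rw [ContinuousLinearMap.det]
    have h2 : (((ContinuousLinearMap.toSpanSingleton ℂ a).restrictScalars ℝ : ℂ →L[ℝ] ℂ) :
      ℂ →ₗ[ℝ] ℂ) = (LinearMap.toSpanSingleton ℂ ℂ a).restrictScalars ℝ := rfl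
    rw [h2, LinearMap.det_restrictScalars]
    simp
  rw [this, Algebra.norm_complex_apply, Complex.normSq_eq_norm_sq, abs_of_nonneg (by positivity)]

/-- Change of charts in the integral of a function times the Laplacian of a function supported in
one chart. -/
theorem integral_laplacian_chart_change {ρ η : X → ℝ} {c d : X}
    (hρ : Function.support ρ ⊆ (chartAt ℂ c).source) (hη : ∀ x, SmoothFnAt η x)
    (hs : tsupport η ⊆ (chartAt ℂ d).source) :
    ∫ z in (chartAt ℂ c).target, ρ ((chartAt ℂ c).symm z) *
        (Δ fun z => η ((chartAt ℂ c).symm z)) z =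
      ∫ w in (chartAt ℂ d).target, ρ ((chartAt ℂ d).symm w) *
        (Δ fun w => η ((chartAt ℂ d).symm w)) w := by
  set e := chartAt ℂ c
  set e' := chartAt ℂ d
  -- `S` and `S'` are the overlap of the two charts seen in each of them. Off the overlap the first
  -- integrand vanishes because of `η`, the second because of `ρ`.
  set S : Set ℂ := e.target ∩ e.symm ⁻¹' e'.source with hS
  set S' : Set ℂ := e'.target ∩ e'.symm ⁻¹' e.source with hS'
  have hSS : (fun w => e (e'.symm w)) '' S' = S := by
    ext z
    constructor
    · rintro ⟨w, ⟨h1, h2⟩, rfl⟩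
      refine ⟨e.map_source h2, ?_⟩
      simp only [Set.mem_preimage, e.left_inv h2]
      exact e'.map_target h1
    · rintro ⟨h1, h2⟩
      refine ⟨e' (e.symm z), ⟨e'.map_source h2, ?_⟩, ?_⟩
      · simp only [Set.mem_preimage, e'.left_inv h2]
        exact e.map_target h1
      · simp only [e'.left_inv h2, e.right_inv h1]
  have hinj : Set.InjOn (fun w => e (e'.symm w)) S' := by
    rintro w ⟨h1, h2⟩ w' ⟨h1', h2'⟩ h
    exact e'.symm.injOn h1 h1' (e.injOn h2 h2' h)
  have hm' : MeasurableSet S' :=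
    (e'.isOpen_inter_preimage_symm e.open_source).measurableSet
  have e1 : ∫ z in e.target, ρ (e.symm z) * (Δ fun z => η (e.symm z)) z =
      ∫ z in S, ρ (e.symm z) * (Δ fun z => η (e.symm z)) z := by
    refine (setIntegral_eq_of_subset_of_forall_sdiff_eq_zero e.open_target.measurableSet
      Set.inter_subset_left ?_)
    rintro z ⟨hz, hz'⟩
    have : e.symm z ∉ tsupport η := fun h => hz' ⟨hz, hs h⟩
    have h0 : (fun z => η (e.symm z)) =ᶠ[𝓝 z] fun _ => 0 := by
      filter_upwards [eventually_chart_symm hz ((isClosed_tsupport η).isOpen_compl.mem_nhds this)]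
        with y hy
      exact image_eq_zero_of_notMem_tsupport hy
    rw [(InnerProductSpace.laplacian_congr_nhds h0).self_of_nhds]
    simp
  have e2 : ∫ z in e'.target, ρ (e'.symm z) * (Δ fun z => η (e'.symm z)) z =
      ∫ z in S', ρ (e'.symm z) * (Δ fun z => η (e'.symm z)) z := by
    refine (setIntegral_eq_of_subset_of_forall_sdiff_eq_zero e'.open_target.measurableSet
      Set.inter_subset_left ?_)
    rintro z ⟨hz, hz'⟩
    have : ρ (e'.symm z) = 0 := by
      by_contra h
      exact hz' ⟨hz, hρ h⟩
    simp [this]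
  rw [e1, e2, ← hSS, integral_image_eq_integral_abs_det_fderiv_smul volume hm'
    (f' := fun w => (ContinuousLinearMap.toSpanSingleton ℂ
      (deriv (fun w => e (e'.symm w)) w)).restrictScalars ℝ) ?_ hinj]
  · refine setIntegral_congr_fun hm' ?_
    rintro w ⟨h1, h2⟩
    simp only [abs_det_restrictScalars_toSpanSingleton, smul_eq_mul]
    -- The Jacobian of the substitution is exactly the factor by which the Laplacian transforms.
    rw [laplacian_chart_change h1 h2 (hη _), e.left_inv h2]
    ring
  · rintro w ⟨h1, h2⟩
    exact ((analyticAt_transition h1 h2).differentiableAt.hasDerivAt.hasFDerivAt.restrictScalars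
      ℝ).hasFDerivWithinAt

/-- Extended by zero outside the chart, the function is twice continuously differentiable with
compact support in the plane, so `integral_laplacian_eq_zero` applies. -/
theorem setIntegral_laplacian_chart_eq_zero {η : X → ℝ} {d : X} (hη : ∀ x, SmoothFnAt η x)
    (hs : tsupport η ⊆ (chartAt ℂ d).source) :
    ∫ w in (chartAt ℂ d).target, (Δ fun w => η ((chartAt ℂ d).symm w)) w = 0 := by
  set e := chartAt ℂ d
  set ζ : ℂ → ℝ := e.target.indicator fun w => η (e.symm w) with hζ
  have hK : IsCompact (e '' tsupport η) :=
    (isClosed_tsupport _).isCompact.image_of_continuousOn (e.continuousOn.mono hs)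
  have hout : ∀ z ∉ e '' tsupport η, ζ z = 0 := by
    intro z hz
    by_cases hzt : z ∈ e.target
    · rw [hζ, Set.indicator_of_mem hzt]
      apply image_eq_zero_of_notMem_tsupport
      exact fun h => hz ⟨_, h, e.right_inv hzt⟩
    · rw [hζ, Set.indicator_of_notMem hzt]
  have hcs : HasCompactSupport ζ := HasCompactSupport.intro hK hout
  have heq : ∀ z ∈ e.target, ζ =ᶠ[𝓝 z] fun w => η (e.symm w) := fun z hz => by
    filter_upwards [e.open_target.mem_nhds hz] with y hy
    rw [hζ, Set.indicator_of_mem hy]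
  have hsm : ContDiff ℝ 2 ζ := by
    rw [contDiff_iff_contDiffAt]
    intro z
    by_cases hz : z ∈ e.target
    · exact (((hη _).contDiffAt hz).of_le two_le_smooth).congr_of_eventuallyEq
        (heq z hz)
    · have hz' : z ∉ e '' tsupport η := by
        rintro ⟨x, hx, rfl⟩
        exact hz (e.map_source (hs hx))
      refine (contDiffAt_const (c := (0 : ℝ))).congr_of_eventuallyEq ?_
      filter_upwards [hK.isClosed.isOpen_compl.mem_nhds hz'] with y hy using hout y hy
  rw [← integral_laplacian_eq_zero hsm hcs]
  rw [← setIntegral_eq_integral_of_forall_compl_eq_zero (s := e.target) (f := Δ ζ)]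
  · refine setIntegral_congr_fun e.open_target.measurableSet fun z hz => ?_
    exact (InnerProductSpace.laplacian_congr_nhds (heq z hz)).self_of_nhds.symm
  · intro z hz
    have hz' : z ∉ e '' tsupport η := by
      rintro ⟨x, hx, rfl⟩
      exact hz (e.map_source (hs hx))
    have h0 : ζ =ᶠ[𝓝 z] fun _ => 0 := by
      filter_upwards [hK.isClosed.isOpen_compl.mem_nhds hz'] with y hy using hout y hy
    rw [(InnerProductSpace.laplacian_congr_nhds h0).self_of_nhds]
    simp

/-- The integral of the Laplacian of a smooth function vanishes. -/
theorem densityIntegral_laplacian_eq_zero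
    (hρ : ρ.IsSubordinate (fun x => (chartAt ℂ x).source)) {η : X → ℝ}
    (hη : ∀ x, SmoothFnAt η x) :
    densityIntegral ρ (fun c => Δ fun z => η ((chartAt ℂ c).symm z)) = 0 := by
  set T := partitionSupport ρ
  have hρs : ∀ d x, SmoothFnAt (ρ d) x := fun d x => (ρ d).contMDiff.contMDiffAt
  have hηd : ∀ d x, SmoothFnAt (fun x => ρ d x * η x) x := fun d x =>
    ((contDiff_mul (𝕜 := ℝ) (𝔸 := ℝ)).contDiffAt.contMDiffAt).comp x
      ((hρs d x).prodMk_space (hη x))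
  -- Each piece `ρ d * η` is supported in the chart around `d`. All the integrals of its Laplacian
  -- can be moved to that chart, where the outer cutoffs add up to 1.
  have hsplit : ∀ c, ∀ z ∈ (chartAt ℂ c).target, (Δ fun z => η ((chartAt ℂ c).symm z)) z =
      ∑ d ∈ T, (Δ fun z => ρ d ((chartAt ℂ c).symm z) * η ((chartAt ℂ c).symm z)) z := by
    intro c z hz
    have hsum : ∀ S : Finset X,
        (Δ fun z => ∑ d ∈ S, ρ d ((chartAt ℂ c).symm z) * η ((chartAt ℂ c).symm z)) z =
        ∑ d ∈ S, (Δ fun z => ρ d ((chartAt ℂ c).symm z) * η ((chartAt ℂ c).symm z)) z := by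
      classical
      intro S
      have hC : ∀ d, ContDiffAt ℝ 2
          (fun z => ρ d ((chartAt ℂ c).symm z) * η ((chartAt ℂ c).symm z)) z := fun d =>
        ((hηd d _).contDiffAt hz).of_le two_le_smooth
      induction S using Finset.induction_on with
      | empty => simp
      | insert a S ha ih =>
        simp only [Finset.sum_insert ha]
        rw [← ih]
        exact (hC a).laplacian_add (ContDiffAt.sum fun i _ => hC i)
    rw [← hsum]
    simp only [← Finset.sum_mul, T, sum_partitionSupport, one_mul]
  rw [densityIntegral_congr hsplit]
  have hadd : ∀ S : Finset X, densityIntegral ρ (fun c z =>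
      ∑ d ∈ S, (Δ fun z => ρ d ((chartAt ℂ c).symm z) * η ((chartAt ℂ c).symm z)) z) =
      ∑ d ∈ S, densityIntegral ρ (fun c z =>
        (Δ fun z => ρ d ((chartAt ℂ c).symm z) * η ((chartAt ℂ c).symm z)) z) := by
    classical
    intro S
    induction S using Finset.induction_on with
    | empty => simp [densityIntegral_eq_sum]
    | insert a S ha ih =>
      simp only [Finset.sum_insert ha]
      rw [← ih]
      exact densityIntegral_add hρ (fun c => continuousOn_laplacian_chart (hηd a) c)
        (fun c => continuousOn_finsetSum _ fun i _ => continuousOn_laplacian_chart (hηd i) c)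
  rw [hadd]
  refine Finset.sum_eq_zero fun d _ => ?_
  have hs : tsupport (fun x => ρ d x * η x) ⊆ (chartAt ℂ d).source :=
    (tsupport_mul_subset_left).trans (hρ d)
  rw [densityIntegral_eq_sum]
  have h1 : ∀ c ∈ T, _ := fun c _ => integral_laplacian_chart_change (c := c) (d := d)
    ((subset_tsupport (ρ c)).trans (hρ c)) (hηd d) hs
  rw [Finset.sum_congr rfl h1, ← integral_finsetSum]
  · rw [← setIntegral_laplacian_chart_eq_zero (hηd d) hs]
    refine setIntegral_congr_fun (chartAt ℂ d).open_target.measurableSet fun z _ => ?_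
    rw [← Finset.sum_mul, sum_partitionSupport, one_mul]
  · intro c _
    set e := chartAt ℂ d
    have hK : IsCompact (e '' tsupport (fun x => ρ d x * η x)) :=
      (isClosed_tsupport _).isCompact.image_of_continuousOn (e.continuousOn.mono hs)
    have hsub : e '' tsupport (fun x => ρ d x * η x) ⊆ e.target := by
      rintro _ ⟨x, hx, rfl⟩
      exact e.map_source (hs hx)
    have hcont : ContinuousOn (fun z => ρ c (e.symm z) *
        (Δ fun w => ρ d (e.symm w) * η (e.symm w)) z) e.target :=
      ((ρ c).contMDiff.continuous.comp_continuousOn e.continuousOn_symm).mul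
        (continuousOn_laplacian_chart (hηd d) d)
    refine IntegrableOn.of_forall_sdiff_eq_zero
      ((hcont.mono hsub).integrableOn_compact hK) e.open_target.measurableSet ?_
    rintro z ⟨hz, hz'⟩
    have : e.symm z ∉ tsupport (fun x => ρ d x * η x) :=
      fun h => hz' ⟨_, h, e.right_inv hz⟩
    have h0 : (fun z => ρ d (e.symm z) * η (e.symm z)) =ᶠ[𝓝 z] fun _ => 0 := by
      filter_upwards [eventually_chart_symm hz ((isClosed_tsupport _).isOpen_compl.mem_nhds this)]
        with y hy
      exact image_eq_zero_of_notMem_tsupport (f := fun x => ρ d x * η x) hy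
    rw [(InnerProductSpace.laplacian_congr_nhds h0).self_of_nhds]
    simp

end Density

/-! ### Metrized line bundles with a holomorphic section -/

section Potential

variable {X : Type*} [TopologicalSpace X] [ChartedSpace ℂ X]

/-- Near `x` the functions `f` and `g` differ by the logarithm of the squared absolute value of an
invertible holomorphic function. -/
def LogEquivAt (f g : X → ℝ) (x : X) : Prop :=
  ∃ h : X → ℂ, HolFnAt h x ∧ h x ≠ 0 ∧ ∀ᶠ y in 𝓝 x, f y = g y + Real.log (‖h y‖ ^ 2)

/-- Local potentials `φ x`, defined near `x`, of a closed `(1,1)`-form. -/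
structure IsPotential (φ : X → X → ℝ) : Prop where
  smooth : ∀ x, SmoothFnAt (φ x) x
  equiv : ∀ x, ∀ᶠ y in 𝓝 x, LogEquivAt (φ x) (φ y) y

/-- The density of the Laplacian of a family of local potentials. -/
noncomputable def curvature (φ : X → X → ℝ) (c : X) (z : ℂ) : ℝ :=
  (Δ fun w : ℂ => φ ((chartAt ℂ c).symm z) ((chartAt ℂ c).symm w)) z

theorem holFnAt_const (a : ℂ) (x : X) : HolFnAt (fun _ => a) x := contMDiffAt_const

theorem HolFnAt.mul {f g : X → ℂ} {x : X} (hf : HolFnAt f x) (hg : HolFnAt g x) :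
    HolFnAt (fun y => f y * g y) x :=
  ((contDiff_mul (𝕜 := ℂ) (𝔸 := ℂ)).contDiffAt.contMDiffAt).comp x (hf.prodMk_space hg)

theorem HolFnAt.add {f g : X → ℂ} {x : X} (hf : HolFnAt f x) (hg : HolFnAt g x) :
    HolFnAt (fun y => f y + g y) x :=
  ContMDiffAt.add hf hg

theorem HolFnAt.sub {f g : X → ℂ} {x : X} (hf : HolFnAt f x) (hg : HolFnAt g x) :
    HolFnAt (fun y => f y - g y) x :=
  ContMDiffAt.sub hf hg

theorem HolFnAt.inv {f : X → ℂ} {x : X} (hf : HolFnAt f x) (h0 : f x ≠ 0) :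
    HolFnAt (fun y => (f y)⁻¹) x :=
  ((contDiffAt_inv ℂ h0).contMDiffAt).comp x hf

theorem HolFnAt.sum {ι : Type*} {s : Finset ι} {f : ι → X → ℂ} {x : X}
    (hf : ∀ i ∈ s, HolFnAt (f i) x) : HolFnAt (fun y => ∑ i ∈ s, f i y) x :=
  ContMDiffAt.sum hf

theorem HolFnAt.prod {ι : Type*} {s : Finset ι} {f : ι → X → ℂ} {x : X}
    (hf : ∀ i ∈ s, HolFnAt (f i) x) : HolFnAt (fun y => ∏ i ∈ s, f i y) x := by
  classical
  induction s using Finset.induction_on with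
  | empty => simpa using holFnAt_const 1 x
  | insert a s ha ih =>
    simp only [Finset.prod_insert ha]
    exact (hf a (by simp)).mul (ih fun i hi => hf i (by simp [hi]))

theorem HolFnAt.congr {f g : X → ℂ} {x : X} (hf : HolFnAt f x) (h : ∀ᶠ y in 𝓝 x, g y = f y) :
    HolFnAt g x :=
  ContMDiffAt.congr_of_eventuallyEq hf h

theorem HolFnAt.continuousAt {f : X → ℂ} {x : X} (hf : HolFnAt f x) : ContinuousAt f x :=
  ContMDiffAt.continuousAt hf

theorem SmoothFnAt.add {f g : X → ℝ} {x : X} (hf : SmoothFnAt f x) (hg : SmoothFnAt g x) :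
    SmoothFnAt (fun y => f y + g y) x :=
  ContMDiffAt.add hf hg

theorem SmoothFnAt.neg {f : X → ℝ} {x : X} (hf : SmoothFnAt f x) :
    SmoothFnAt (fun y => -f y) x :=
  ContMDiffAt.neg hf

theorem SmoothFnAt.congr {f g : X → ℝ} {x : X} (hf : SmoothFnAt f x)
    (h : ∀ᶠ y in 𝓝 x, g y = f y) : SmoothFnAt g x :=
  ContMDiffAt.congr_of_eventuallyEq hf h

theorem LogEquivAt.refl (f : X → ℝ) (x : X) : LogEquivAt f f x :=
  ⟨fun _ => 1, holFnAt_const 1 x, one_ne_zero, by simp⟩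

theorem LogEquivAt.add {f g f' g' : X → ℝ} {x : X} (h : LogEquivAt f g x)
    (h' : LogEquivAt f' g' x) : LogEquivAt (fun y => f y + f' y) (fun y => g y + g' y) x := by
  obtain ⟨a, ha, ha0, hae⟩ := h
  obtain ⟨b, hb, hb0, hbe⟩ := h'
  refine ⟨fun y => a y * b y, ha.mul hb, mul_ne_zero ha0 hb0, ?_⟩
  filter_upwards [hae, hbe, ha.continuousAt.eventually_ne ha0,
    hb.continuousAt.eventually_ne hb0] with y h1 h2 h3 h4
  rw [h1, h2, norm_mul, mul_pow, Real.log_mul (by simpa using h3) (by simpa using h4)]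
  ring

theorem LogEquivAt.neg {f g : X → ℝ} {x : X} (h : LogEquivAt f g x) :
    LogEquivAt (fun y => -f y) (fun y => -g y) x := by
  obtain ⟨a, ha, ha0, hae⟩ := h
  refine ⟨fun y => (a y)⁻¹, ha.inv ha0, inv_ne_zero ha0, ?_⟩
  filter_upwards [hae] with y h1
  rw [h1, norm_inv, inv_pow, Real.log_inv]
  ring

theorem IsPotential.add {φ ψ : X → X → ℝ} (hφ : IsPotential φ) (hψ : IsPotential ψ) :
    IsPotential (fun x y => φ x y + ψ x y) where
  smooth x := (hφ.smooth x).add (hψ.smooth x)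
  equiv x := by
    filter_upwards [hφ.equiv x, hψ.equiv x] with y h1 h2 using h1.add h2

theorem IsPotential.neg {φ : X → X → ℝ} (hφ : IsPotential φ) :
    IsPotential (fun x y => -φ x y) where
  smooth x := (hφ.smooth x).neg
  equiv x := by
    filter_upwards [hφ.equiv x] with y h1 using h1.neg

variable [IsManifold 𝓘(ℂ) ω X]

theorem LogEquivAt.laplacian_eq {f g : X → ℝ} {c : X} {z : ℂ} (hz : z ∈ (chartAt ℂ c).target)
    (h : LogEquivAt f g ((chartAt ℂ c).symm z)) (hg : SmoothFnAt g ((chartAt ℂ c).symm z)) :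
    (Δ fun w => f ((chartAt ℂ c).symm w)) z = (Δ fun w => g ((chartAt ℂ c).symm w)) z := by
  obtain ⟨a, ha, ha0, hae⟩ := h
  have h1 : (fun w => f ((chartAt ℂ c).symm w)) =ᶠ[𝓝 z] (fun w => g ((chartAt ℂ c).symm w)) +
      fun w => Real.log (‖a ((chartAt ℂ c).symm w)‖ ^ 2) := eventually_chart_symm hz hae
  rw [(InnerProductSpace.laplacian_congr_nhds h1).self_of_nhds,
    ((hg.contDiffAt hz).of_le two_le_smooth).laplacian_add
      ((ha.analyticAt hz).contDiffAt_log_norm_sq ha0),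
    laplacian_log_norm_sq (ha.analyticAt hz) ha0, add_zero]

/-- In `curvature` the potential changes with the point. Near `z` a single one suffices, which
yields continuity. -/
theorem IsPotential.curvature_eventually {φ : X → X → ℝ} (hφ : IsPotential φ) {c : X} {z : ℂ}
    (hz : z ∈ (chartAt ℂ c).target) : ∀ᶠ w in 𝓝 z, curvature φ c w =
      (Δ fun w => φ ((chartAt ℂ c).symm z) ((chartAt ℂ c).symm w)) w := by
  filter_upwards [eventually_chart_symm hz (hφ.equiv _), (chartAt ℂ c).open_target.mem_nhds hz]
    with w h1 h2
  exact (h1.laplacian_eq h2 (hφ.smooth _)).symm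

theorem IsPotential.continuousOn_curvature {φ : X → X → ℝ} (hφ : IsPotential φ) (c : X) :
    ContinuousOn (curvature φ c) (chartAt ℂ c).target := by
  intro z hz
  refine ContinuousAt.continuousWithinAt ?_
  exact ((((hφ.smooth _).contDiffAt hz).of_le two_le_smooth).continuousAt_laplacian).congr
    ((hφ.curvature_eventually hz).mono fun _ h => h.symm)

theorem IsPotential.curvature_add {φ ψ : X → X → ℝ} (hφ : IsPotential φ) (hψ : IsPotential ψ)
    {c : X} {z : ℂ} (hz : z ∈ (chartAt ℂ c).target) :
    curvature (fun x y => φ x y + ψ x y) c z = curvature φ c z + curvature ψ c z :=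
  (((hφ.smooth _).contDiffAt hz).of_le two_le_smooth).laplacian_add
    (((hψ.smooth _).contDiffAt hz).of_le two_le_smooth)

theorem curvature_neg {φ : X → X → ℝ} {c : X} {z : ℂ} :
    curvature (fun x y => -φ x y) c z = -1 * curvature φ c z := by
  have : (fun w => -φ ((chartAt ℂ c).symm z) ((chartAt ℂ c).symm w)) =
    -fun w => φ ((chartAt ℂ c).symm z) ((chartAt ℂ c).symm w) := rfl
  rw [curvature, this, InnerProductSpace.laplacian_neg]
  simp [curvature]

/-- `F` is the squared norm of a holomorphic section of a line bundle with metric `exp φ`. -/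
def IsSectionNorm (φ : X → X → ℝ) (F : X → ℝ) : Prop :=
  ∀ x, ∃ h : X → ℂ, HolFnAt h x ∧ ∀ᶠ y in 𝓝 x, F y = ‖h y‖ ^ 2 * Real.exp (φ x y)

theorem eventually_nhdsNE_chart {x : X} {p : ℂ → Prop} {c : X} (hx : x ∈ (chartAt ℂ c).source)
    (hp : ∀ᶠ w in 𝓝[≠] (chartAt ℂ c x), p w) : ∀ᶠ y in 𝓝[≠] x, p (chartAt ℂ c y) := by
  rw [eventually_nhdsWithin_iff] at hp ⊢
  filter_upwards [((chartAt ℂ c).continuousAt hx).eventually hp,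
    (chartAt ℂ c).open_source.mem_nhds hx] with y h1 h2 h3
  exact h1 fun h => h3 ((chartAt ℂ c).injOn h2 hx h)

theorem nhdsNE_neBot_surface (x : X) : (𝓝[≠] x).NeBot := by
  set e := chartAt ℂ x
  rw [← frequently_true_iff_neBot]
  have h1 : ∃ᶠ w in 𝓝[≠] (e x), True := frequently_true_iff_neBot _ |>.2 inferInstance
  intro h
  apply h1
  have hx := mem_chart_source ℂ x
  have ht := mem_chart_target ℂ x
  rw [eventually_nhdsWithin_iff] at h ⊢
  have h2 : ∀ᶠ w in 𝓝 (e x), e.symm w ∈ ({x}ᶜ : Set X) → ¬True :=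
    eventually_chart_symm ht (by rwa [(chartAt ℂ x).left_inv hx])
  filter_upwards [h2, e.open_target.mem_nhds ht] with w h3 h4 h5
  refine h3 fun h6 => h5 ?_
  have : e.symm w = x := h6
  rw [Set.mem_singleton_iff, ← this, e.right_inv h4]

theorem HolFnAt.eventually_zero_or_ne {h : X → ℂ} {x : X} (hh : HolFnAt h x) :
    (∀ᶠ y in 𝓝 x, h y = 0) ∨ ∀ᶠ y in 𝓝[≠] x, h y ≠ 0 := by
  have hx := mem_chart_source ℂ x
  have h1 : AnalyticAt ℂ (fun w => h ((chartAt ℂ x).symm w)) (chartAt ℂ x x) :=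
    HolFnAt.analyticAt (mem_chart_target ℂ x) (by rwa [(chartAt ℂ x).left_inv hx])
  rcases h1.eventually_eq_zero_or_eventually_ne_zero with h2 | h2
  · left
    filter_upwards [((chartAt ℂ x).continuousAt hx).eventually h2,
      (chartAt ℂ x).open_source.mem_nhds hx] with y h3 h4
    rwa [(chartAt ℂ x).left_inv h4] at h3
  · right
    filter_upwards [eventually_nhdsNE_chart hx h2,
      mem_nhdsWithin_of_mem_nhds ((chartAt ℂ x).open_source.mem_nhds hx)] with y h3 h4
    rwa [(chartAt ℂ x).left_inv h4] at h3

/-! ### Norms of holomorphic sections and the sign of the degree -/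

variable {φ : X → X → ℝ} {F : X → ℝ}

theorem IsSectionNorm.nonneg (hF : IsSectionNorm φ F) (x : X) : 0 ≤ F x := by
  obtain ⟨h, -, he⟩ := hF x
  rw [he.self_of_nhds]
  positivity

/-- The identity theorem: near each point F either vanishes identically or has no zero except
possibly the point itself, so the set of points near which F vanishes is open and closed. -/
theorem IsSectionNorm.eventually_ne [PreconnectedSpace X] (hF : IsSectionNorm φ F)
    (h0 : ∃ x, F x ≠ 0) (x : X) : ∀ᶠ y in 𝓝[≠] x, F y ≠ 0 := by
  have hdich : ∀ x, (∀ᶠ y in 𝓝 x, F y = 0) ∨ ∀ᶠ y in 𝓝[≠] x, F y ≠ 0 := by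
    intro x
    obtain ⟨h, hh, he⟩ := hF x
    rcases hh.eventually_zero_or_ne with h1 | h1
    · left
      filter_upwards [h1, he] with y h2 h3
      simp [h3, h2]
    · right
      filter_upwards [h1, mem_nhdsWithin_of_mem_nhds he] with y h2 h3
      rw [h3]
      have := norm_pos_iff.2 h2
      positivity
  set A : Set X := {x | ∀ᶠ y in 𝓝 x, F y = 0}
  have hcl : IsClopen A := by
    refine ⟨⟨?_⟩, isOpen_iff_mem_nhds.2 fun x hx => eventually_eventually_nhds.2 hx⟩
    rw [isOpen_iff_mem_nhds]
    intro x hx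
    have h1 := (hdich x).resolve_left hx
    rw [eventually_nhdsWithin_iff] at h1
    filter_upwards [h1] with y hy
    by_cases hyx : y = x
    · rwa [hyx]
    · exact fun h => hy hyx h.self_of_nhds
  rcases isClopen_iff.1 hcl with h | h
  · refine (hdich x).resolve_left fun hx => ?_
    have : x ∈ A := hx
    simp [h] at this
  · obtain ⟨y, hy⟩ := h0
    have : y ∈ A := by simp [h]
    exact absurd (this : ∀ᶠ y in 𝓝 y, F y = 0).self_of_nhds hy

theorem finite_of_eventually_nhdsNE {X : Type*} [TopologicalSpace X] [CompactSpace X]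
    {p : X → Prop} (h : ∀ x, ∀ᶠ y in 𝓝[≠] x, ¬ p y) : {x | p x}.Finite := by
  obtain ⟨t, ht⟩ := CompactSpace.elim_nhds_subcover (fun x => {y | y ≠ x → ¬ p y})
    (fun x => eventually_nhdsWithin_iff.1 (h x))
  refine t.finite_toSet.subset fun y hy => ?_
  have : y ∈ ⋃ x ∈ t, {y | y ≠ x → ¬ p y} := by rw [ht]; trivial
  simp only [Set.mem_iUnion] at this
  obtain ⟨x, hx, hyx⟩ := this
  by_cases hxy : y = x
  · simpa [hxy] using hx
  · exact absurd hy (hyx hxy)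

theorem IsSectionNorm.smooth (hφ : IsPotential φ) (hF : IsSectionNorm φ F) (x : X) :
    SmoothFnAt F x := by
  obtain ⟨h, hh, he⟩ := hF x
  refine SmoothFnAt.congr ?_ he
  have hx := mem_chart_source ℂ x
  have ht := mem_chart_target ℂ x
  refine smoothFnAt_of_contDiffAt (c := x) hx ?_
  have h1 : AnalyticAt ℂ (fun w => h ((chartAt ℂ x).symm w)) (chartAt ℂ x x) :=
    HolFnAt.analyticAt ht (by rwa [(chartAt ℂ x).left_inv hx])
  have h2 := SmoothFnAt.contDiffAt (f := φ x) (c := x) ht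
    (by rw [(chartAt ℂ x).left_inv hx]; exact hφ.smooth x)
  exact (h1.contDiffAt_real.norm_sq ℝ).mul h2.exp

theorem SmoothFnAt.log {f : X → ℝ} {x : X} (hf : SmoothFnAt f x) (h0 : f x ≠ 0) :
    SmoothFnAt (fun y => Real.log (f y)) x :=
  ((contDiffAt_id.log h0).contMDiffAt (n := ∞)).comp x hf

variable [CompactSpace X] [T2Space X] {ρ : SmoothPartitionOfUnity X 𝓘(ℝ, ℂ) X Set.univ}

theorem densityIntegral_curvature_add (hρ : ρ.IsSubordinate (fun x => (chartAt ℂ x).source))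
    {φ ψ : X → X → ℝ} (hφ : IsPotential φ) (hψ : IsPotential ψ) :
    densityIntegral ρ (curvature fun x y => φ x y + ψ x y) =
      densityIntegral ρ (curvature φ) + densityIntegral ρ (curvature ψ) := by
  rw [← densityIntegral_add hρ hφ.continuousOn_curvature hψ.continuousOn_curvature]
  exact densityIntegral_congr fun c z hz => hφ.curvature_add hψ hz

theorem densityIntegral_curvature_neg {φ : X → X → ℝ} :
    densityIntegral ρ (curvature fun x y => -φ x y) = -densityIntegral ρ (curvature φ) := by
  rw [densityIntegral_congr fun c z _ => curvature_neg, densityIntegral_const_mul]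
  ring

/-- Where F is nonzero, log F differs from the potential by the harmonic function log ‖h‖². -/
theorem IsSectionNorm.curvature_eq (hφ : IsPotential φ) (hF : IsSectionNorm φ F) {c : X} {z : ℂ}
    (hz : z ∈ (chartAt ℂ c).target) (h0 : F ((chartAt ℂ c).symm z) ≠ 0) :
    curvature φ c z = (Δ fun w => Real.log (F ((chartAt ℂ c).symm w))) z := by
  obtain ⟨h, hh, he⟩ := hF ((chartAt ℂ c).symm z)
  have hh0 : h ((chartAt ℂ c).symm z) ≠ 0 := by
    intro hn
    apply h0
    rw [he.self_of_nhds]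
    simp [hn]
  refine (LogEquivAt.laplacian_eq (f := fun y => Real.log (F y)) hz ⟨h, hh, hh0, ?_⟩
    (hφ.smooth _)).symm
  filter_upwards [he, hh.continuousAt.eventually_ne hh0] with y h1 h2
  rw [h1, Real.log_mul (by simpa using h2) (Real.exp_pos _).ne', Real.log_exp, add_comm]

/-- The degree of a line bundle with a nowhere vanishing section is zero. -/
theorem IsSectionNorm.integral_eq_zero (hρ : ρ.IsSubordinate (fun x => (chartAt ℂ x).source))
    (hφ : IsPotential φ) (hF : IsSectionNorm φ F) (h0 : ∀ x, F x ≠ 0) :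
    densityIntegral ρ (curvature φ) = 0 := by
  rw [← densityIntegral_laplacian_eq_zero hρ (η := fun y => Real.log (F y))
    fun x => (hF.smooth hφ x).log (h0 x)]
  exact densityIntegral_congr fun c z hz => hF.curvature_eq hφ hz (h0 _)

open MeasureTheory in
/-- The degree of a line bundle with a nonzero section is nonnegative. -/
theorem IsSectionNorm.integral_nonpos [PreconnectedSpace X]
    (hρ : ρ.IsSubordinate (fun x => (chartAt ℂ x).source))
    (hφ : IsPotential φ) (hF : IsSectionNorm φ F) (h0 : ∃ x, F x ≠ 0) :
    densityIntegral ρ (curvature φ) ≤ 0 := by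
  have hZ : {x | F x = 0}.Finite := finite_of_eventually_nhdsNE (hF.eventually_ne h0)
  have hFc : Continuous F := continuous_iff_continuousAt.2 fun x =>
    ContMDiffAt.continuousAt (hF.smooth hφ x)
  have hFcc : ∀ c : X, ContinuousOn (fun z => F ((chartAt ℂ c).symm z)) (chartAt ℂ c).target :=
    fun c => hFc.comp_continuousOn (chartAt ℂ c).continuousOn_symm
  set ε : ℕ → ℝ := fun n => 1 / ((n : ℝ) + 1) with hεdef
  have hε : ∀ n, 0 < ε n := fun n => by positivity
  have hDc : ∀ n c, ContinuousOn (fun z => F ((chartAt ℂ c).symm z) /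
      (F ((chartAt ℂ c).symm z) + ε n) * curvature φ c z) (chartAt ℂ c).target := fun n c =>
    (((hFcc c).div ((hFcc c).add continuousOn_const) fun z _ =>
      (add_pos_of_nonneg_of_pos (hF.nonneg _) (hε n)).ne')).mul (hφ.continuousOn_curvature c)
  have hη : ∀ n x, SmoothFnAt (fun y => Real.log (F y + ε n)) x := fun n x => by
    have h1 : SmoothFnAt (fun y => F y + ε n) x := (hF.smooth hφ x).add contMDiffAt_const
    have h2 : F x + ε n ≠ 0 := (add_pos_of_nonneg_of_pos (hF.nonneg x) (hε n)).ne'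
    exact h1.log h2
  -- log F is singular at the zeros of F, but log (F + ε) is smooth on X. Its Laplacian integrates
  -- to 0 and dominates F/(F + ε) times the curvature off the zeros.
  have hle : ∀ n, densityIntegral ρ (fun c z => F ((chartAt ℂ c).symm z) /
      (F ((chartAt ℂ c).symm z) + ε n) * curvature φ c z) ≤ 0 := by
    intro n
    rw [← densityIntegral_laplacian_eq_zero hρ (hη n)]
    have hc : ∀ c : X, ContinuousOn (Δ fun z => Real.log (F ((chartAt ℂ c).symm z) + ε n))
        (chartAt ℂ c).target := fun c => continuousOn_laplacian_chart (hη n) c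
    refine densityIntegral_mono hρ (hDc n) hc hZ ?_
    intro c z hz hzF
    obtain ⟨h, hh, he⟩ := hF ((chartAt ℂ c).symm z)
    have hh0 : h ((chartAt ℂ c).symm z) ≠ 0 := by
      intro hn
      apply hzF
      show F _ = 0
      rw [he.self_of_nhds]
      simp [hn]
    exact laplacian_log_add_ge (f := fun w => F ((chartAt ℂ c).symm w)) (hε n) (hh.analyticAt hz)
      hh0 (((hφ.smooth _).contDiffAt hz).of_le two_le_smooth) (eventually_chart_symm hz he)
  -- As ε tends to 0 the weights F/(F + ε), bounded by 1, tend to 1 off the finitely many zeros, and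
  -- dominated convergence gives the bound for the curvature itself.
  refine le_of_tendsto' (x := atTop) ?_ hle
  simp only [densityIntegral_eq_sum]
  refine tendsto_finsetSum _ fun c _ => ?_
  refine tendsto_integral_of_dominated_convergence
    (fun z => ‖ρ c ((chartAt ℂ c).symm z) * curvature φ c z‖)
    (fun n => (integrableOn_density (D := fun c z => F ((chartAt ℂ c).symm z) /
      (F ((chartAt ℂ c).symm z) + ε n) * curvature φ c z) hρ (hDc n c)).aestronglyMeasurable)
    (integrableOn_density hρ (hφ.continuousOn_curvature c)).norm ?_ ?_
  · intro n
    refine Eventually.of_forall fun z => ?_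
    have h1 := hF.nonneg ((chartAt ℂ c).symm z)
    have h2 : |F ((chartAt ℂ c).symm z) / (F ((chartAt ℂ c).symm z) + ε n)| ≤ 1 := by
      rw [abs_of_nonneg (div_nonneg h1 (add_nonneg h1 (hε n).le))]
      exact div_le_one_of_le₀ (by linarith [hε n]) (add_nonneg h1 (hε n).le)
    simp only [Real.norm_eq_abs, abs_mul]
    refine mul_le_mul_of_nonneg_left ?_ (abs_nonneg _)
    exact mul_le_of_le_one_left (abs_nonneg _) h2
  · filter_upwards [ae_chart_notMem hZ c] with z hz
    refine Tendsto.const_mul _ ?_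
    have h1 : F ((chartAt ℂ c).symm z) ≠ 0 := hz
    have h2 : Tendsto (fun n => F ((chartAt ℂ c).symm z) / (F ((chartAt ℂ c).symm z) + ε n)) atTop
        (𝓝 (F ((chartAt ℂ c).symm z) / (F ((chartAt ℂ c).symm z) + 0))) :=
      tendsto_const_nhds.div (tendsto_const_nhds.add tendsto_one_div_add_atTop_nhds_zero_nat)
        (by simpa using h1)
    rw [add_zero, div_self h1] at h2
    simpa using h2.mul_const (curvature φ c z)

end Potential

/-- A smooth function that agrees with `log` on `[1, ∞)` and is subharmonic, but not harmonic, as a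
function of `|z|²`. -/
theorem exists_smooth_log_extension : ∃ k : ℝ → ℝ, ContDiff ℝ ∞ k ∧
    (∀ t, 1 ≤ t → k t = Real.log t) ∧ (∀ t, 0 ≤ deriv k t + t * deriv (deriv k) t) ∧
    ∃ t, 0 < t ∧ t < 1 ∧ 0 < deriv k t + t * deriv (deriv k) t := by
  -- A smooth step from 0 on t ≤ 1/2 to 1 on t ≥ 1. The function k is the primitive of θ(t)/t
  -- vanishing at 1, so t k′ = θ and k′ + t k″ = θ′.
  set θ : ℝ → ℝ := fun t => Real.smoothTransition (2 * t - 1) with hθ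
  have hθC : ContDiff ℝ ∞ θ :=
    Real.smoothTransition.contDiff.comp ((contDiff_const.mul contDiff_id).sub contDiff_const)
  have hθ1 : ∀ t, 1 ≤ t → θ t = 1 := fun t ht => Real.smoothTransition.one_of_one_le (by linarith)
  have hθ0 : ∀ t, t ≤ 1 / 2 → θ t = 0 := fun t ht =>
    Real.smoothTransition.zero_of_nonpos (by linarith)
  have hθm : Monotone θ := fun s t hst => Real.smoothTransition.monotone (by linarith)
  set g : ℝ → ℝ := fun t => θ t / t with hg
  have hgC : ContDiff ℝ ∞ g := by
    rw [contDiff_iff_contDiffAt]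
    intro t
    by_cases ht : t = 0
    · refine (contDiffAt_const (c := (0 : ℝ))).congr_of_eventuallyEq ?_
      filter_upwards [gt_mem_nhds (show t < 1 / 2 by rw [ht]; norm_num)] with s hs
      simp [hg, hθ0 s hs.le]
    · exact hθC.contDiffAt.div contDiffAt_id ht
  set k : ℝ → ℝ := fun t => ∫ s in (1 : ℝ)..t, g s with hk
  have hkd : ∀ t, HasDerivAt k (g t) t := fun t =>
    hgC.continuous.integral_hasStrictDerivAt 1 t |>.hasDerivAt
  have hdk : deriv k = g := funext fun t => (hkd t).deriv
  have hkC : ContDiff ℝ ∞ k := by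
    rw [contDiff_infty_iff_deriv]
    exact ⟨fun t => (hkd t).differentiableAt, by rwa [hdk]⟩
  have hprod : ∀ t, deriv k t + t * deriv (deriv k) t = deriv θ t := by
    intro t
    have h1 : θ = fun t => t * g t := by
      funext s
      by_cases hs : s = 0
      · simp [hs, hθ0 0 (by norm_num)]
      · simp only [hg]; field_simp
    have h2 : HasDerivAt (fun t => t * g t) (1 * g t + t * deriv g t) t :=
      (hasDerivAt_id t).mul (hgC.differentiable (by simp) t).hasDerivAt
    rw [hdk]
    conv_rhs => rw [h1, h2.deriv]
    ring
  refine ⟨k, hkC, ?_, ?_, ?_⟩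
  · intro t ht
    have h1 : k t = ∫ s in (1 : ℝ)..t, 1 / s := by
      refine intervalIntegral.integral_congr fun s hs => ?_
      rw [Set.uIcc_of_le ht] at hs
      simp [hg, hθ1 s hs.1]
    rw [h1, integral_one_div_of_pos one_pos (by linarith)]
    simp
  · intro t
    rw [hprod]
    exact hθm.deriv_nonneg
  -- θ climbs from 0 at 1/2 to 1 at 1, so its derivative is positive somewhere in between.
  · obtain ⟨t, ⟨h1, h2⟩, ht⟩ := exists_deriv_eq_slope θ (show (1 / 2 : ℝ) < 1 by norm_num)
      hθC.continuous.continuousOn (hθC.differentiable (by simp)).differentiableOn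
    refine ⟨t, by linarith, h2, ?_⟩
    rw [hprod, ht, hθ1 1 le_rfl, hθ0 _ le_rfl]
    norm_num

theorem hasFDerivAt_normSq_sub (z₀ z : ℂ) (δ : ℝ) : HasFDerivAt (fun z : ℂ => ‖z - z₀‖ ^ 2 / δ)
    ((2 / δ) • innerSL ℝ (z - z₀)) z := by
  have h1 := ((hasFDerivAt_id (𝕜 := ℝ) z).sub_const z₀).norm_sq
  have h2 := h1.const_mul (δ⁻¹)
  refine (h2.congr_fderiv ?_).congr_of_eventuallyEq (Eventually.of_forall fun w => ?_)
  · ext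
    simp [div_eq_mul_inv]
    ring
  · simp [div_eq_inv_mul]

theorem laplacian_normSq_sub (z₀ z : ℂ) (δ : ℝ) :
    (Δ fun z : ℂ => ‖z - z₀‖ ^ 2 / δ) z = 4 / δ := by
  rw [laplacian_apply_fderiv]
  have h1 : fderiv ℝ (fun z : ℂ => ‖z - z₀‖ ^ 2 / δ) = fun z => (2 / δ) • innerSL ℝ (z - z₀) :=
    funext fun z => (hasFDerivAt_normSq_sub z₀ z δ).fderiv
  have h2 : HasFDerivAt (fun z : ℂ => (2 / δ) • innerSL ℝ (z - z₀))
      ((2 / δ) • ((innerSL ℝ : ℂ →L[ℝ] ℂ →L[ℝ] ℝ))) z :=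
    (((innerSL ℝ : ℂ →L[ℝ] ℂ →L[ℝ] ℝ).hasFDerivAt (x := z - z₀)).comp z
      ((hasFDerivAt_id (𝕜 := ℝ) z).sub_const z₀)).const_smul (2 / δ)
  rw [h1, h2.fderiv]
  have hI : ∀ v : ℂ, ((2 / δ) • (innerSL ℝ : ℂ →L[ℝ] ℂ →L[ℝ] ℝ)) v v = 2 / δ * inner ℝ v v :=
    fun v => rfl
  rw [hI, hI]
  simp only [real_inner_self_eq_norm_sq, norm_one, Complex.norm_I]
  ring

/-- The bracket is the quantity whose sign is controlled in `exists_smooth_log_extension`. -/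
theorem laplacian_comp_normSq {k : ℝ → ℝ} (hk : ContDiff ℝ ∞ k) (z₀ z : ℂ) (δ : ℝ) :
    (Δ fun z : ℂ => k (‖z - z₀‖ ^ 2 / δ)) z = 4 / δ * (deriv k (‖z - z₀‖ ^ 2 / δ) +
      ‖z - z₀‖ ^ 2 / δ * deriv (deriv k) (‖z - z₀‖ ^ 2 / δ)) := by
  have hu : ContDiffAt ℝ 2 (fun z : ℂ => ‖z - z₀‖ ^ 2 / δ) z :=
    ((contDiff_id.sub contDiff_const).norm_sq ℝ).div_const δ |>.contDiffAt
  have h := laplacian_comp_real (hk.contDiffAt.of_le two_le_smooth) hu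
  refine h.trans ?_
  rw [laplacian_normSq_sub, (hasFDerivAt_normSq_sub z₀ z δ).fderiv]
  have hn : ‖z - z₀‖ ^ 2 = (z - z₀).re ^ 2 + (z - z₀).im ^ 2 := by
    rw [← Complex.normSq_eq_norm_sq, Complex.normSq_apply]; ring
  rw [hn]
  simp [Complex.inner]
  ring

theorem deriv_transition_ne_zero {X : Type*} [TopologicalSpace X] [ChartedSpace ℂ X]
    [IsManifold 𝓘(ℂ) ω X] {c d : X} {w : ℂ} (hw : w ∈ (chartAt ℂ d).target)
    (hc : (chartAt ℂ d).symm w ∈ (chartAt ℂ c).source) :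
    deriv (fun w => chartAt ℂ c ((chartAt ℂ d).symm w)) w ≠ 0 := by
  set T := fun w => chartAt ℂ c ((chartAt ℂ d).symm w) with hT
  set T' := fun w => chartAt ℂ d ((chartAt ℂ c).symm w) with hT'
  have h1 : HasDerivAt T (deriv T w) w :=
    (analyticAt_transition hw hc).differentiableAt.hasDerivAt
  have hTw : (chartAt ℂ c).symm (T w) = (chartAt ℂ d).symm w := (chartAt ℂ c).left_inv hc
  have h2 : HasDerivAt T' (deriv T' (T w)) (T w) := by
    refine (analyticAt_transition ((chartAt ℂ c).map_source hc) ?_).differentiableAt.hasDerivAt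
    rw [hTw]
    exact (chartAt ℂ d).map_target hw
  have h3 := h2.comp w h1
  have h4 : T' ∘ T =ᶠ[𝓝 w] id := by
    filter_upwards [eventually_chart_symm hw ((chartAt ℂ c).open_source.mem_nhds hc),
      (chartAt ℂ d).open_target.mem_nhds hw] with y h5 h6
    simp [hT, hT', (chartAt ℂ c).left_inv h5, (chartAt ℂ d).right_inv h6]
  have h5 := h3.unique ((hasDerivAt_id w).congr_of_eventuallyEq h4)
  intro h
  simp [h] at h5

/-! ### Sections with a zero -/

section Strict

variable {X : Type*} [TopologicalSpace X] [ChartedSpace ℂ X] [IsManifold 𝓘(ℂ) ω X]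

theorem HolFnAt.exists_eq_mul_chart {h : X → ℂ} {x : X} (hh : HolFnAt h x) (h0 : h x = 0) :
    ∃ h₁ : X → ℂ, HolFnAt h₁ x ∧
      ∀ᶠ y in 𝓝 x, h y = (chartAt ℂ x y - chartAt ℂ x x) * h₁ y := by
  have hx := mem_chart_source ℂ x
  have h1 : AnalyticAt ℂ (fun w => h ((chartAt ℂ x).symm w)) (chartAt ℂ x x) :=
    HolFnAt.analyticAt (mem_chart_target ℂ x) (by rwa [(chartAt ℂ x).left_inv hx])
  have h2 : 1 ≤ analyticOrderAt (fun w => h ((chartAt ℂ x).symm w)) (chartAt ℂ x x) := by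
    rw [Order.one_le_iff_ne_zero, Ne, h1.analyticOrderAt_eq_zero, not_not,
      (chartAt ℂ x).left_inv hx]
    exact h0
  obtain ⟨g, hg, hge⟩ := (natCast_le_analyticOrderAt (n := 1) h1).1 (by exact_mod_cast h2)
  refine ⟨fun y => g (chartAt ℂ x y), holFnAt_of_analyticAt hx (c := x) ?_, ?_⟩
  · refine hg.congr ?_
    filter_upwards [(chartAt ℂ x).open_target.mem_nhds (mem_chart_target ℂ x)] with w hw
    simp [(chartAt ℂ x).right_inv hw]
  · filter_upwards [((chartAt ℂ x).continuousAt hx).eventually hge,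
      (chartAt ℂ x).open_source.mem_nhds hx] with y h3 h4
    rw [(chartAt ℂ x).left_inv h4] at h3
    simpa using h3

variable [CompactSpace X] [T2Space X] [PreconnectedSpace X]
  {ρ : SmoothPartitionOfUnity X 𝓘(ℝ, ℂ) X Set.univ} {φ : X → X → ℝ} {F : X → ℝ}

open Classical in
/-- The degree of a line bundle with a nonzero section that has a zero is positive. -/
theorem IsSectionNorm.integral_neg (hρ : ρ.IsSubordinate (fun x => (chartAt ℂ x).source))
    (hφ : IsPotential φ) (hF : IsSectionNorm φ F) (h0 : ∃ x, F x ≠ 0) {x₀ : X} (hx₀ : F x₀ = 0) :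
    densityIntegral ρ (curvature φ) < 0 := by
  -- The section is divided by a coordinate at `x₀`. The quotient is a section of the line bundle
  -- twisted by −x₀, which has potential φ + κ for a κ supported near `x₀` whose curvature has
  -- positive integral. The nonstrict inequality for φ + κ then becomes strict for φ.
  obtain ⟨k, hkC, hklog, hknn, t₁, ht₁, ht₁', hkpos⟩ := exists_smooth_log_extension
  set e := chartAt ℂ x₀ with he
  have hxs := mem_chart_source ℂ x₀
  have hxt := mem_chart_target ℂ x₀
  obtain ⟨R, hR, hRt⟩ := Metric.nhds_basis_closedBall.mem_iff.1 (e.open_target.mem_nhds hxt)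
  set r := R / 2 with hr
  have hr0 : 0 < r := by positivity
  set τ : X → ℝ := fun y => ‖e y - e x₀‖ ^ 2 / r ^ 2 with hτ
  set V : Set X := e.source ∩ e ⁻¹' Metric.ball (e x₀) R with hV
  have hVo : IsOpen V := e.isOpen_inter_preimage Metric.isOpen_ball
  set K : Set X := e.symm '' Metric.closedBall (e x₀) r with hK
  have hKc : IsClosed K := ((isCompact_closedBall _ _).image_of_continuousOn
    (e.continuousOn_symm.mono ((Metric.closedBall_subset_closedBall (by linarith)).trans
      hRt))).isClosed
  have hKV : K ⊆ V := by
    rintro _ ⟨z, hz, rfl⟩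
    have hzt : z ∈ e.target := hRt (Metric.closedBall_subset_closedBall (by linarith) hz)
    refine ⟨e.map_target hzt, ?_⟩
    simp only [Set.mem_preimage, e.right_inv hzt]
    exact Metric.closedBall_subset_ball (by linarith) hz
  have hτ1 : ∀ y ∈ V, y ∉ K → 1 < τ y := by
    intro y hy hyK
    have : ¬ ‖e y - e x₀‖ ≤ r := fun h => hyK ⟨e y, by simpa [dist_eq_norm] using h, e.left_inv hy.1⟩
    rw [hτ, lt_div_iff₀ (by positivity), one_mul]
    exact pow_lt_pow_left₀ (not_le.1 this) hr0.le two_ne_zero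
  have hcoord : ∀ y ∈ V, HolFnAt (fun y => (e y - e x₀) * (r : ℂ)⁻¹) y := fun y hy =>
    (((holFnAt_chart hy.1).sub (holFnAt_const _ _)).mul (holFnAt_const _ _))
  have hτn : ∀ y, ‖(e y - e x₀) * (r : ℂ)⁻¹‖ ^ 2 = τ y := fun y => by
    simp [hτ, div_eq_mul_inv, mul_pow]
  have hne : ∀ y ∈ V, y ≠ x₀ → e y - e x₀ ≠ 0 := fun y hy hyx h =>
    hyx (e.injOn hy.1 hxs (sub_eq_zero.1 h))
  have hx₀V : x₀ ∈ V := ⟨hxs, by simpa using hR⟩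
  have hrc : (r : ℂ)⁻¹ ≠ 0 := inv_ne_zero (by exact_mod_cast hr0.ne')
  -- On `V` outside `K` one has τ > 1, so k(τ) = log τ is the logarithm of the squared absolute
  -- value of the rescaled coordinate, which is holomorphic and invertible there. Hence the two
  -- definitions of κ fit together as potentials.
  set κ : X → X → ℝ := fun x y => if x ∈ V then k (τ y) else 0 with hκ
  have hτC : ContDiff ℝ ∞ (fun w : ℂ => ‖w - e x₀‖ ^ 2 / r ^ 2) :=
    ((contDiff_id.sub contDiff_const).norm_sq ℝ).div_const _
  have hκp : IsPotential κ := by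
    refine ⟨fun x => ?_, fun x => ?_⟩
    · by_cases hx : x ∈ V
      · simp only [hκ, if_pos hx]
        refine smoothFnAt_of_contDiffAt (c := x₀) hx.1 ?_
        refine (hkC.comp hτC).contDiffAt.congr_of_eventuallyEq ?_
        filter_upwards [e.open_target.mem_nhds (e.map_source hx.1)] with w hw
        simp only [hτ, Function.comp]
        rw [e.right_inv hw]
      · simp only [hκ, if_neg hx]
        exact contMDiffAt_const
    · by_cases hx : x ∈ V
      · filter_upwards [hVo.mem_nhds hx] with y hy
        simp only [hκ, if_pos hx, if_pos hy]
        exact LogEquivAt.refl _ _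
      · filter_upwards [hKc.isOpen_compl.mem_nhds fun h => hx (hKV h)] with y hyK
        by_cases hy : y ∈ V
        · simp only [hκ, if_neg hx, if_pos hy]
          have hyx : y ≠ x₀ := by
            rintro rfl
            exact hyK ⟨e y, by simpa using hr0.le, e.left_inv hy.1⟩
          have hn0 : (e y - e x₀) * (r : ℂ)⁻¹ ≠ 0 := mul_ne_zero (hne y hy hyx) hrc
          refine ⟨fun y => ((e y - e x₀) * (r : ℂ)⁻¹)⁻¹, (hcoord y hy).inv hn0,
            inv_ne_zero hn0, ?_⟩
          filter_upwards [hKc.isOpen_compl.mem_nhds hyK, hVo.mem_nhds hy] with w hwK hwV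
          rw [norm_inv, inv_pow, hτn, Real.log_inv, hklog _ (hτ1 w hwV hwK).le]
          ring
        · simp only [hκ, if_neg hx, if_neg hy]
          exact LogEquivAt.refl _ _
  obtain ⟨h, hh, hhe⟩ := hF x₀
  have hh0 : h x₀ = 0 := by
    have := hhe.self_of_nhds
    rw [hx₀] at this
    have h2 := (mul_eq_zero.1 this.symm).resolve_right (Real.exp_pos _).ne'
    simpa using h2
  obtain ⟨h₁, hh₁, hh₁e⟩ := hh.exists_eq_mul_chart hh0
  -- The squared norm of the quotient by (e y − e x₀)/r. At `x₀` the formula with τ in the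
  -- denominator is meaningless, and the value comes from the factorization of `h` through `h₁`.
  set F' : X → ℝ := fun y => if y = x₀ then ‖(r : ℂ) * h₁ x₀‖ ^ 2 * Real.exp (φ x₀ x₀ + κ x₀ x₀)
    else if y ∈ V then F y * (Real.exp (k (τ y)) / τ y) else F y with hF'
  have hFn : IsSectionNorm (fun x y => φ x y + κ x y) F' := by
    intro x
    by_cases hx : x ∈ V
    · by_cases hxx : x = x₀
      · subst hxx
        refine ⟨fun y => (r : ℂ) * h₁ y, (holFnAt_const _ _).mul hh₁, ?_⟩
        filter_upwards [hhe, hh₁e, hVo.mem_nhds hx] with y h1 h2 hy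
        by_cases hyx : y = x
        · simp [hF', hyx]
        · have h3 := norm_pos_iff.2 (hne y hy hyx)
          simp only [hF', if_neg hyx, if_pos hy, hκ, if_pos hx]
          rw [h1, h2, Real.exp_add, ← he]
          simp only [norm_mul, mul_pow, hτ, Complex.norm_real, Real.norm_eq_abs, sq_abs]
          field_simp
      · obtain ⟨h, hh, hhe⟩ := hF x
        have hn0 : (e x - e x₀) * (r : ℂ)⁻¹ ≠ 0 := mul_ne_zero (hne x hx hxx) hrc
        refine ⟨fun y => h y * ((e y - e x₀) * (r : ℂ)⁻¹)⁻¹, hh.mul ((hcoord x hx).inv hn0), ?_⟩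
        filter_upwards [hhe, hVo.mem_nhds hx, isOpen_ne.mem_nhds hxx] with y h1 hy hyx
        simp only [hF', if_neg hyx, if_pos hy, hκ, if_pos hx]
        rw [h1, norm_mul, norm_inv, mul_pow, inv_pow, hτn, Real.exp_add]
        ring
    · obtain ⟨h, hh, hhe⟩ := hF x
      refine ⟨h, hh, ?_⟩
      filter_upwards [hhe, hKc.isOpen_compl.mem_nhds fun h => hx (hKV h)] with y h1 hyK
      have hyx : y ≠ x₀ := by
        rintro rfl
        exact hyK ⟨e y, by simpa using hr0.le, e.left_inv hxs⟩
      simp only [hF', if_neg hyx, hκ, if_neg hx, add_zero, ← h1]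
      split_ifs with hy
      · have := hτ1 y hy hyK
        rw [hklog _ this.le, Real.exp_log (by linarith), div_self (by linarith), mul_one]
      · rfl
  have hF'0 : ∃ x, F' x ≠ 0 := by
    obtain ⟨y, hy⟩ := h0
    have hyx : y ≠ x₀ := by rintro rfl; exact hy hx₀
    refine ⟨y, ?_⟩
    simp only [hF', if_neg hyx]
    split_ifs with hyV
    · have h3 := norm_pos_iff.2 (hne y hyV hyx)
      refine mul_ne_zero hy (div_pos (Real.exp_pos _) ?_).ne'
      simp only [hτ]
      positivity
    · exact hy
  have hle := hFn.integral_nonpos hρ (hφ.add hκp) hF'0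
  rw [densityIntegral_curvature_add hρ hφ hκp] at hle
  have hcurv : ∀ c, ∀ z ∈ (chartAt ℂ c).target, (chartAt ℂ c).symm z ∈ V → curvature κ c z =
      ‖deriv (fun w => e ((chartAt ℂ c).symm w)) z‖ ^ 2 * (4 / r ^ 2 *
        (deriv k (τ ((chartAt ℂ c).symm z)) +
          τ ((chartAt ℂ c).symm z) * deriv (deriv k) (τ ((chartAt ℂ c).symm z)))) := by
    intro c z hz hzV
    rw [← laplacian_comp_normSq hkC (e x₀) (e ((chartAt ℂ c).symm z)) (r ^ 2)]
    refine Eq.trans ?_ (laplacian_comp_analytic (analyticAt_transition hz hzV.1)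
        ((hkC.comp hτC).contDiffAt.of_le two_le_smooth))
    simp only [curvature, hκ, if_pos hzV]
    rfl
  have hpos : 0 < densityIntegral ρ (curvature κ) := by
    -- A point with τ = t₁, where k′ + t k″ is positive.
    set z₁ : ℂ := e x₀ + ((r * √t₁ : ℝ) : ℂ) with hz₁
    have hn : ‖z₁ - e x₀‖ = r * √t₁ := by
      rw [hz₁, add_sub_cancel_left, Complex.norm_real, Real.norm_eq_abs, abs_of_nonneg (by positivity)]
    have hlt : r * √t₁ < r := by
      have : √t₁ < 1 := by rw [Real.sqrt_lt' one_pos]; simpa using ht₁'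
      nlinarith
    have hz₁t : z₁ ∈ e.target := hRt (by
      rw [Metric.mem_closedBall, dist_eq_norm, hn]; linarith)
    have hx₁ : e.symm z₁ ∈ V := hKV ⟨z₁, by rw [Metric.mem_closedBall, dist_eq_norm, hn]; exact hlt.le, rfl⟩
    refine densityIntegral_pos hρ hκp.continuousOn_curvature ?_ (x := e.symm z₁) ?_
    · intro c z hz
      by_cases hzV : (chartAt ℂ c).symm z ∈ V
      · rw [hcurv c z hz hzV]
        have := hknn (τ ((chartAt ℂ c).symm z))
        positivity
      · simp only [curvature, hκ, if_neg hzV]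
        simp
    · intro c hc
      have hz := (chartAt ℂ c).map_source hc
      have hzx := (chartAt ℂ c).left_inv hc
      rw [hcurv c _ hz (by rwa [hzx]), hzx]
      have hτt : τ (e.symm z₁) = t₁ := by
        simp only [hτ]
        rw [e.right_inv hz₁t, hn, mul_pow, Real.sq_sqrt ht₁.le]
        field_simp
      rw [hτt]
      have hd := deriv_transition_ne_zero (c := x₀) hz (by rw [hzx]; exact hx₁.1)
      have := norm_pos_iff.2 hd
      positivity
  linarith

end Strict

/-! ### Germs of holomorphic sections -/

namespace HolomorphicVectorBundle

variable {X : Type*} [TopologicalSpace X] [ChartedSpace ℂ X] {n m : ℕ}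

/-- The section `s` is holomorphic near `x`. -/
def HolAt (E : HolomorphicVectorBundle X n) (s : ∀ x, E.Fiber x) (x : X) : Prop :=
  ContMDiffAt 𝓘(ℂ) (𝓘(ℂ).prod 𝓘(ℂ, Fin n → ℂ)) ω
    (fun y => Bundle.TotalSpace.mk' (Fin n → ℂ) y (s y)) x

variable (E : HolomorphicVectorBundle X n)

/-- The domain of the local trivialization around `x`. -/
def baseSet (x : X) : Set X := (trivializationAt (Fin n → ℂ) E.Fiber x).baseSet

/-- The coordinates on the fibres given by the local trivialization around `x`. -/
noncomputable def coord (x y : X) : E.Fiber y →ₗ[ℂ] (Fin n → ℂ) :=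
  (trivializationAt (Fin n → ℂ) E.Fiber x).linearMapAt ℂ y

/-- The inverse of the coordinates on the fibres given by the local trivialization around `x`. -/
noncomputable def ofCoord (x y : X) : (Fin n → ℂ) →ₗ[ℂ] E.Fiber y :=
  (trivializationAt (Fin n → ℂ) E.Fiber x).symmₗ ℂ y

theorem isOpen_baseSet (x : X) : IsOpen (E.baseSet x) :=
  (trivializationAt (Fin n → ℂ) E.Fiber x).open_baseSet

theorem mem_baseSet (x : X) : x ∈ E.baseSet x := FiberBundle.mem_baseSet_trivializationAt' x

theorem eventually_mem_baseSet (x : X) : ∀ᶠ y in 𝓝 x, y ∈ E.baseSet x :=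
  (E.isOpen_baseSet x).mem_nhds (E.mem_baseSet x)

variable {E}

theorem ofCoord_coord {x y : X} (hy : y ∈ E.baseSet x) (v : E.Fiber y) :
    E.ofCoord x y (E.coord x y v) = v :=
  (trivializationAt (Fin n → ℂ) E.Fiber x).symmₗ_linearMapAt hy v

theorem coord_ofCoord {x y : X} (hy : y ∈ E.baseSet x) (v : Fin n → ℂ) :
    E.coord x y (E.ofCoord x y v) = v :=
  (trivializationAt (Fin n → ℂ) E.Fiber x).linearMapAt_symmₗ hy v

theorem holAt_iff_of_mem {s : ∀ x, E.Fiber x} {x y : X} (hy : y ∈ E.baseSet x) :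
    E.HolAt s y ↔ ∀ k, HolFnAt (fun w => E.coord x w (s w) k) y := by
  rw [HolAt, (trivializationAt (Fin n → ℂ) E.Fiber x).contMDiffAt_section_iff hy,
    contMDiffAt_pi_space]
  refine forall_congr' fun k => ?_
  have h1 : (fun w => E.coord x w (s w) k) =ᶠ[𝓝 y]
      fun w => (trivializationAt (Fin n → ℂ) E.Fiber x ⟨w, s w⟩).2 k := by
    filter_upwards [(E.isOpen_baseSet x).mem_nhds hy] with w hw
    rw [coord, Bundle.Trivialization.linearMapAt_apply,
      if_pos (show w ∈ (trivializationAt (Fin n → ℂ) E.Fiber x).baseSet from hw)]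
  exact ⟨fun h => h.congr_of_eventuallyEq h1, fun h => ContMDiffAt.congr_of_eventuallyEq h h1.symm⟩

theorem holAt_iff {s : ∀ x, E.Fiber x} {x : X} :
    E.HolAt s x ↔ ∀ k, HolFnAt (fun w => E.coord x w (s w) k) x :=
  holAt_iff_of_mem (E.mem_baseSet x)

theorem isHolSection_iff {U : Set X} (hU : IsOpen U) {s : ∀ x, E.Fiber x} :
    E.IsHolSection U s ↔ ∀ x ∈ U, E.HolAt s x :=
  ⟨fun h _ hx => h.contMDiffAt (hU.mem_nhds hx), fun h x hx => (h x hx).contMDiffWithinAt⟩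

theorem HolAt.congr {s t : ∀ x, E.Fiber x} {x : X} (hs : E.HolAt s x)
    (h : ∀ᶠ y in 𝓝 x, t y = s y) : E.HolAt t x :=
  ContMDiffAt.congr_of_eventuallyEq hs (h.mono fun y hy => by simp only [hy])

theorem HolAt.add {s t : ∀ x, E.Fiber x} {x : X} (hs : E.HolAt s x) (ht : E.HolAt t x) :
    E.HolAt (fun y => s y + t y) x := by
  rw [holAt_iff] at *
  intro k
  simpa using (hs k).add (ht k)

theorem HolAt.smul {f : X → ℂ} {s : ∀ x, E.Fiber x} {x : X} (hf : HolFnAt f x)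
    (hs : E.HolAt s x) : E.HolAt (fun y => f y • s y) x := by
  rw [holAt_iff] at *
  intro k
  simpa using hf.mul (hs k)

theorem HolAt.const_smul (a : ℂ) {s : ∀ x, E.Fiber x} {x : X}
    (hs : E.HolAt s x) : E.HolAt (fun y => a • s y) x :=
  HolAt.smul (holFnAt_const a x) hs

theorem HolAt.neg {s : ∀ x, E.Fiber x} {x : X} (hs : E.HolAt s x) :
    E.HolAt (fun y => -s y) x := by
  simpa using hs.const_smul (-1)

theorem HolAt.sub {s t : ∀ x, E.Fiber x} {x : X} (hs : E.HolAt s x) (ht : E.HolAt t x) :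
    E.HolAt (fun y => s y - t y) x := by
  simpa [sub_eq_add_neg] using hs.add ht.neg

theorem holAt_zero (x : X) : E.HolAt (fun _ => 0) x := by
  rw [holAt_iff]
  intro k
  simpa using holFnAt_const 0 x

theorem HolAt.sum {ι : Type*} {S : Finset ι} {s : ι → ∀ x, E.Fiber x} {x : X}
    (hs : ∀ i ∈ S, E.HolAt (s i) x) : E.HolAt (fun y => ∑ i ∈ S, s i y) x := by
  classical
  induction S using Finset.induction_on with
  | empty => simpa using holAt_zero x
  | insert a S ha ih =>
    simp only [Finset.sum_insert ha]
    exact (hs a (by simp)).add (ih fun i hi => hs i (by simp [hi]))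

theorem holAt_ofCoord {x y : X} (hy : y ∈ E.baseSet x) (v : Fin n → ℂ) :
    E.HolAt (fun w => E.ofCoord x w v) y := by
  rw [holAt_iff_of_mem hy]
  intro k
  refine (holFnAt_const (v k) y).congr ?_
  filter_upwards [(E.isOpen_baseSet x).mem_nhds hy] with w hw
  rw [coord_ofCoord hw]

theorem finiteDimensional_fiber (E : HolomorphicVectorBundle X n) (x : X) :
    FiniteDimensional ℂ (E.Fiber x) :=
  Module.Finite.of_surjective (E.ofCoord x x)
    fun v => ⟨_, ofCoord_coord (E.mem_baseSet x) v⟩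

instance (x : X) : FiniteDimensional ℂ (E.Fiber x) := E.finiteDimensional_fiber x

theorem finrank_fiber (E : HolomorphicVectorBundle X n) (x : X) :
    Module.finrank ℂ (E.Fiber x) = n := by
  have e : E.Fiber x ≃ₗ[ℂ] (Fin n → ℂ) := LinearEquiv.ofLinearMap (E.coord x x) (E.ofCoord x x)
    (LinearMap.ext fun v => coord_ofCoord (E.mem_baseSet x) v)
    (LinearMap.ext fun v => ofCoord_coord (E.mem_baseSet x) v)
  rw [e.finrank_eq]
  simp

/-- A family of linear functionals on the fibres that is holomorphic near `x`. -/
def HolFunctionalAt (E : HolomorphicVectorBundle X n) (l : ∀ y, E.Fiber y →ₗ[ℂ] ℂ) (x : X) : Prop :=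
  ∀ t, E.HolAt t x → HolFnAt (fun y => l y (t y)) x

/-- A homomorphism of holomorphic vector bundles. -/
def IsHolHom (E : HolomorphicVectorBundle X n) (E' : HolomorphicVectorBundle X m)
    (f : ∀ x, E.Fiber x →ₗ[ℂ] E'.Fiber x) : Prop :=
  ∀ x s, E.HolAt s x → E'.HolAt (fun y => f y (s y)) x

/-- A holomorphic pairing of holomorphic vector bundles. -/
def IsHolPairing (E : HolomorphicVectorBundle X n) (E' : HolomorphicVectorBundle X m)
    (b : ∀ x, E.Fiber x →ₗ[ℂ] E'.Fiber x →ₗ[ℂ] ℂ) : Prop :=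
  ∀ x s t, E.HolAt s x → E'.HolAt t x → HolFnAt (fun y => b y (s y) (t y)) x

theorem IsHolPairing.flip {E' : HolomorphicVectorBundle X m}
    {b : ∀ x, E.Fiber x →ₗ[ℂ] E'.Fiber x →ₗ[ℂ] ℂ} (hb : E.IsHolPairing E' b) :
    E'.IsHolPairing E (fun x => (b x).flip) :=
  fun x s t hs ht => hb x t s ht hs

theorem HolAt.eq_zero_of_nhdsNE [IsManifold 𝓘(ℂ) ω X] {s : ∀ y, E.Fiber y} {x : X}
    (hs : E.HolAt s x) (h : ∀ᶠ y in 𝓝[≠] x, s y = 0) : s x = 0 := by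
  have : (𝓝[≠] x).NeBot := nhdsNE_neBot_surface x
  have hc : E.coord x x (s x) = 0 := by
    funext k
    have h1 : Tendsto (fun w => E.coord x w (s w) k) (𝓝[≠] x) (𝓝 (E.coord x x (s x) k)) :=
      (holAt_iff.1 hs k).continuousAt.tendsto.mono_left nhdsWithin_le_nhds
    have h2 : Tendsto (fun w => E.coord x w (s w) k) (𝓝[≠] x) (𝓝 0) :=
      tendsto_const_nhds.congr' (h.mono fun y hy => by simp [hy])
    exact tendsto_nhds_unique h1 h2
  rw [← ofCoord_coord (E.mem_baseSet x) (s x), hc, map_zero]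

section

variable [IsManifold 𝓘(ℂ) ω X]

theorem HolAt.eventually {s : ∀ x, E.Fiber x} {x : X} (hs : E.HolAt s x) :
    ∀ᶠ y in 𝓝 x, E.HolAt s y := by
  have h1 := eventually_all.2 fun k => (holAt_iff.1 hs k).eventually
  filter_upwards [h1, E.eventually_mem_baseSet x] with y h2 h3
  exact (holAt_iff_of_mem h3).2 h2

theorem HolAt.exists_isOpen {s : ∀ x, E.Fiber x} {x : X} (hs : E.HolAt s x) :
    ∃ U, IsOpen U ∧ x ∈ U ∧ E.IsHolSection U s := by
  obtain ⟨U, hU, hUo, hxU⟩ := eventually_nhds_iff.1 hs.eventually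
  exact ⟨U, hUo, hxU, (isHolSection_iff hUo).2 hU⟩

theorem isHolHom_of_isHolSection {E' : HolomorphicVectorBundle X m}
    {f : ∀ x, E.Fiber x →ₗ[ℂ] E'.Fiber x}
    (h : ∀ (U : Set X) (s : ∀ x, E.Fiber x), IsOpen U → E.IsHolSection U s →
      E'.IsHolSection U (fun x => f x (s x))) : E.IsHolHom E' f := by
  intro x s hs
  obtain ⟨U, hU, hxU, hsU⟩ := hs.exists_isOpen
  exact (isHolSection_iff hU).1 (h U s hU hsU) x hxU

theorem IsHolHom.isHolSection {E' : HolomorphicVectorBundle X m}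
    {f : ∀ x, E.Fiber x →ₗ[ℂ] E'.Fiber x} (h : E.IsHolHom E' f) {U : Set X} (hU : IsOpen U)
    {s : ∀ x, E.Fiber x} (hs : E.IsHolSection U s) : E'.IsHolSection U (fun x => f x (s x)) :=
  (isHolSection_iff hU).2 fun x hx => h x s ((isHolSection_iff hU).1 hs x hx)

theorem isHolPairing_of_isHolSection {E' : HolomorphicVectorBundle X m}
    {b : ∀ x, E.Fiber x →ₗ[ℂ] E'.Fiber x →ₗ[ℂ] ℂ}
    (h : ∀ (U : Set X) (s : ∀ x, E.Fiber x) (t : ∀ x, E'.Fiber x), IsOpen U → E.IsHolSection U s →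
      E'.IsHolSection U t → ContMDiffOn 𝓘(ℂ) 𝓘(ℂ) ω (fun x => b x (s x) (t x)) U) :
    E.IsHolPairing E' b := by
  intro x s t hs ht
  obtain ⟨U, hU, hxU, hsU⟩ := hs.exists_isOpen
  obtain ⟨U', hU', hxU', htU⟩ := ht.exists_isOpen
  exact (h (U ∩ U') s t (hU.inter hU') (hsU.mono Set.inter_subset_left)
    (htU.mono Set.inter_subset_right)).contMDiffAt ((hU.inter hU').mem_nhds ⟨hxU, hxU'⟩)

end

theorem holFnAt_det {ι : Type*} [Fintype ι] [DecidableEq ι] {A : X → Matrix ι ι ℂ} {x : X}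
    (hA : ∀ i j, HolFnAt (fun y => A y i j) x) : HolFnAt (fun y => (A y).det) x := by
  simp only [Matrix.det_apply']
  exact HolFnAt.sum fun σ _ => (holFnAt_const _ _).mul (HolFnAt.prod fun i _ => hA _ _)

theorem holFnAt_adjugate {ι : Type*} [Fintype ι] [DecidableEq ι] {A : X → Matrix ι ι ℂ} {x : X}
    (hA : ∀ i j, HolFnAt (fun y => A y i j) x) (i j : ι) :
    HolFnAt (fun y => (A y).adjugate i j) x := by
  simp only [Matrix.adjugate_apply]
  refine holFnAt_det fun k l => ?_
  simp only [Matrix.updateRow_apply]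
  split_ifs
  · exact holFnAt_const _ _
  · exact hA k l

/-- A left inverse of the family at x, made constant by the trivialization, has a holomorphic matrix
A on the family with A(x) = 1. Near x the matrix stays invertible, and multiplying by its inverse
(the adjugate over the determinant) makes the functionals exactly dual. -/
theorem exists_dual {ι : Type*} [Fintype ι] [DecidableEq ι] {s : ι → ∀ y, E.Fiber y} {x : X}
    (hs : ∀ i, E.HolAt (s i) x) (hli : LinearIndependent ℂ fun i => s i x) :
    ∃ l : ι → ∀ y, E.Fiber y →ₗ[ℂ] ℂ, (∀ i, E.HolFunctionalAt (l i) x) ∧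
      ∀ᶠ y in 𝓝 x, ∀ i j, l i y (s j y) = if i = j then 1 else 0 := by
  obtain ⟨g, hg⟩ := LinearMap.exists_leftInverse_of_injective
    (Fintype.linearCombination ℂ fun i => s i x)
    (LinearMap.ker_eq_bot.2 (hli.fintypeLinearCombination_injective))
  have hgs : ∀ j, g (s j x) = Pi.single j 1 := fun j => by
    have := LinearMap.congr_fun hg (Pi.single j 1)
    simpa [Fintype.linearCombination_apply_single] using this
  set G : ∀ y, E.Fiber y →ₗ[ℂ] (ι → ℂ) := fun y => g ∘ₗ E.ofCoord x x ∘ₗ E.coord x y with hG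
  have hGh : ∀ i t, E.HolAt t x → HolFnAt (fun y => G y (t y) i) x := by
    intro i t ht
    set L := g ∘ₗ E.ofCoord x x
    have : (fun y => G y (t y) i) = fun y => ∑ k, E.coord x y (t y) k * L (Pi.single k 1) i := by
      funext y
      have h1 : G y (t y) = L (E.coord x y (t y)) := rfl
      rw [h1, LinearMap.pi_apply_eq_sum_univ L, Finset.sum_apply]
      refine Finset.sum_congr rfl fun k _ => ?_
      have h2 : (fun j => if k = j then (1 : ℂ) else 0) = Pi.single k 1 := by
        ext j; simp [Pi.single_apply, eq_comm]
      simp [h2]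
    rw [this]
    exact HolFnAt.sum fun k _ => (holAt_iff.1 ht k).mul (holFnAt_const _ _)
  set A : X → Matrix ι ι ℂ := fun y => Matrix.of fun i j => G y (s j y) i with hA
  have hAh : ∀ i j, HolFnAt (fun y => A y i j) x := fun i j => hGh i _ (hs j)
  have hAx : A x = 1 := by
    ext i j
    simp only [hA, hG, Matrix.of_apply, LinearMap.comp_apply, ofCoord_coord (E.mem_baseSet x), hgs,
      Matrix.one_apply, Pi.single_apply]
  have hdet : (A x).det ≠ 0 := by simp [hAx]
  refine ⟨fun i y => ((A y).det)⁻¹ • ∑ k, (A y).adjugate i k • (LinearMap.proj k ∘ₗ G y), ?_, ?_⟩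
  · intro i t ht
    simp only [LinearMap.smul_apply, LinearMap.sum_apply, LinearMap.comp_apply, smul_eq_mul,
      LinearMap.proj_apply]
    exact ((holFnAt_det hAh).inv hdet).mul
      (HolFnAt.sum fun k _ => (holFnAt_adjugate hAh i k).mul (hGh k t ht))
  · filter_upwards [(holFnAt_det hAh).continuousAt.eventually_ne hdet] with y hy i j
    have h1 := congrFun (congrFun (Matrix.adjugate_mul (A y)) i) j
    rw [Matrix.mul_apply] at h1
    simp only [LinearMap.smul_apply, LinearMap.sum_apply, LinearMap.comp_apply, smul_eq_mul,
      LinearMap.proj_apply]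
    have h2 : ∀ k, G y (s j y) k = A y k j := fun k => rfl
    simp only [h2, h1]
    simp [Matrix.one_apply, hy]

theorem eventually_linearIndependent {ι : Type*} [Fintype ι] {s : ι → ∀ y, E.Fiber y} {x : X}
    (hs : ∀ i, E.HolAt (s i) x) (hli : LinearIndependent ℂ fun i => s i x) :
    ∀ᶠ y in 𝓝 x, LinearIndependent ℂ fun i => s i y := by
  classical
  obtain ⟨l, -, hl⟩ := exists_dual hs hli
  filter_upwards [hl] with y hy
  rw [Fintype.linearIndependent_iff]
  intro c hc i
  have := congrArg (l i y) hc
  simpa [hy] using this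

/-- A section of the span of an independent family is a combination with holomorphic
coefficients. -/
theorem exists_coeff [IsManifold 𝓘(ℂ) ω X] {ι : Type*} [Fintype ι] {s : ι → ∀ y, E.Fiber y} {x : X}
    (hs : ∀ i, E.HolAt (s i) x) (hli : LinearIndependent ℂ fun i => s i x)
    {t : ∀ y, E.Fiber y} (ht : E.HolAt t x)
    (hspan : ∀ᶠ y in 𝓝[≠] x, t y ∈ Submodule.span ℂ (Set.range fun i => s i y)) :
    ∃ c : ι → X → ℂ, (∀ i, HolFnAt (c i) x) ∧ ∀ᶠ y in 𝓝 x, t y = ∑ i, c i y • s i y := by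
  classical
  obtain ⟨l, hlh, hl⟩ := exists_dual hs hli
  refine ⟨fun i y => l i y (t y), fun i => hlh i t ht, ?_⟩
  have hev : ∀ᶠ y in 𝓝[≠] x, t y = ∑ i, l i y (t y) • s i y := by
    filter_upwards [hspan, mem_nhdsWithin_of_mem_nhds hl] with y h1 h2
    obtain ⟨c, hc⟩ := (Submodule.mem_span_range_iff_exists_fun ℂ).1 h1
    rw [← hc]
    simp [h2]
  -- Membership in the span is known only off `x`; at `x` the expansion follows by continuity.
  have hx : t x - ∑ i, l i x (t x) • s i x = 0 :=
    HolAt.eq_zero_of_nhdsNE (s := fun y => t y - ∑ i, l i y (t y) • s i y)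
      (ht.sub (HolAt.sum fun i _ => HolAt.smul (hlh i t ht) (hs i)))
      (hev.mono fun y hy => sub_eq_zero.2 hy)
  rw [eventually_nhdsWithin_iff] at hev
  filter_upwards [hev] with y hy
  by_cases hyx : y = x
  · subst hyx
    exact sub_eq_zero.1 hx
  · exact hy hyx

end HolomorphicVectorBundle

/-! ### Kernels of holomorphic functionals -/

section Kernel

variable {X : Type*} [TopologicalSpace X] [ChartedSpace ℂ X] [IsManifold 𝓘(ℂ) ω X]

/-- N is the smallest order of vanishing at x, and `i₀` an index that attains it. Such a common
factor exists because X has dimension one; saturated kernels are subbundles for this reason. -/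
theorem exists_common_factor {ι : Type*} [Fintype ι] {β : ι → X → ℂ} {x : X}
    (hβ : ∀ i, HolFnAt (β i) x) (h0 : ¬ ∀ᶠ y in 𝓝 x, ∀ i, β i y = 0) :
    ∃ (N : ℕ) (β' : ι → X → ℂ) (i₀ : ι), (∀ i, HolFnAt (β' i) x) ∧ β' i₀ x ≠ 0 ∧
      ∀ᶠ y in 𝓝 x, ∀ i, β i y = (chartAt ℂ x y - chartAt ℂ x x) ^ N * β' i y := by
  set e := chartAt ℂ x
  have hx := mem_chart_source ℂ x
  have ht := mem_chart_target ℂ x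
  have hA : ∀ i, AnalyticAt ℂ (fun w => β i (e.symm w)) (e x) := fun i =>
    HolFnAt.analyticAt ht (by rw [(chartAt ℂ x).left_inv hx]; exact hβ i)
  have hne : Nonempty ι := by
    by_contra h
    rw [not_nonempty_iff] at h
    exact h0 (Eventually.of_forall fun y i => h.elim i)
  obtain ⟨i₀, hi₀⟩ := Finite.exists_min fun i => analyticOrderAt (fun w => β i (e.symm w)) (e x)
  have htop : analyticOrderAt (fun w => β i₀ (e.symm w)) (e x) ≠ ⊤ := by
    intro h
    apply h0
    rw [eventually_all]
    intro i
    have h1 : analyticOrderAt (fun w => β i (e.symm w)) (e x) = ⊤ := top_le_iff.1 (h ▸ hi₀ i)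
    rw [analyticOrderAt_eq_top] at h1
    filter_upwards [(e.continuousAt hx).eventually h1, e.open_source.mem_nhds hx] with y h3 h4
    rwa [e.left_inv h4] at h3
  obtain ⟨N, hN⟩ := ENat.ne_top_iff_exists.1 htop
  have hg : ∀ i, ∃ g : ℂ → ℂ, AnalyticAt ℂ g (e x) ∧
      (∀ᶠ w in 𝓝 (e x), β i (e.symm w) = (w - e x) ^ N • g w) ∧
      (i = i₀ → g (e x) ≠ 0) := by
    intro i
    by_cases hi : i = i₀
    · subst hi
      obtain ⟨g, h1, h2, h3⟩ := ((hA i).analyticOrderAt_eq_natCast).1 hN.symm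
      exact ⟨g, h1, h3, fun _ => h2⟩
    · obtain ⟨g, h1, h2⟩ := (natCast_le_analyticOrderAt (n := N) (hA i)).1 (hN ▸ hi₀ i)
      exact ⟨g, h1, h2, fun h => absurd h hi⟩
  choose g hg1 hg2 hg3 using hg
  refine ⟨N, fun i y => g i (e y), i₀, fun i => ?_, hg3 i₀ rfl, ?_⟩
  · refine holFnAt_of_analyticAt (c := x) hx ((hg1 i).congr ?_)
    filter_upwards [e.open_target.mem_nhds ht] with w hw
    simp only [e, (chartAt ℂ x).right_inv hw]
  · rw [eventually_all]
    intro i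
    filter_upwards [(e.continuousAt hx).eventually (hg2 i), e.open_source.mem_nhds hx] with y h3 h4
    rw [e.left_inv h4] at h3
    simpa using h3

variable {n : ℕ} {E : HolomorphicVectorBundle X n}

/-- The kernel of b on the span may jump at x. Dividing the values b(s i) by their common power of
the coordinate gives β′ with β′ i₀ ≠ 0 at x, and the sections s i − (β′ i / β′ i₀) s i₀ span the
kernel of β′, which off x is the kernel of b. If b vanishes on the span near x, nothing has to be
changed. -/
theorem exists_kernel_frame_single {ι : Type} [Fintype ι] {s : ι → ∀ y, E.Fiber y} {x : X}
    (hs : ∀ i, E.HolAt (s i) x) (hli : LinearIndependent ℂ fun i => s i x)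
    {b : ∀ y, E.Fiber y →ₗ[ℂ] ℂ} (hb : E.HolFunctionalAt b x) :
    ∃ (ι' : Type) (_ : Fintype ι') (t : ι' → ∀ y, E.Fiber y), (∀ a, E.HolAt (t a) x) ∧
      LinearIndependent ℂ (fun a => t a x) ∧
      (∀ᶠ y in 𝓝 x, ∀ a, t a y ∈ Submodule.span ℂ (Set.range fun i => s i y) ∧ b y (t a y) = 0) ∧
      ∀ᶠ y in 𝓝[≠] x, ∀ v ∈ Submodule.span ℂ (Set.range fun i => s i y), b y v = 0 →
        v ∈ Submodule.span ℂ (Set.range fun a => t a y) := by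
  classical
  by_cases h0 : ∀ᶠ y in 𝓝 x, ∀ i, b y (s i y) = 0
  · refine ⟨ι, inferInstance, s, hs, hli, ?_, Eventually.of_forall fun y v hv _ => hv⟩
    filter_upwards [h0] with y hy a
    exact ⟨Submodule.subset_span ⟨a, rfl⟩, hy a⟩
  obtain ⟨N, β', i₀, hβ', hi₀, hfac⟩ := exists_common_factor (fun i => hb _ (hs i)) h0
  set t : {i // i ≠ i₀} → ∀ y, E.Fiber y := fun i y => s i y - (β' i y * (β' i₀ y)⁻¹) • s i₀ y
    with ht
  -- The last term vanishes as soon as β′ i₀ y ≠ 0, and the middle one when β′ kills the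
  -- combination. What remains exhibits the combination in the span of the `t i`.
  have hsum : ∀ (y : X) (c : ι → ℂ), ∑ i : {i // i ≠ i₀}, c i • t i y =
      ∑ i, c i • s i y - ((∑ i, c i * β' i y) * (β' i₀ y)⁻¹) • s i₀ y -
        (c i₀ - c i₀ * β' i₀ y * (β' i₀ y)⁻¹) • s i₀ y := by
    intro y c
    have e1 : ∀ f : ι → E.Fiber y, ∑ i, f i = f i₀ + ∑ i : {i // i ≠ i₀}, f i := fun f =>
      Fintype.sum_eq_add_sum_subtype_ne f i₀
    have e2 : ∀ f : ι → ℂ, ∑ i, f i = f i₀ + ∑ i : {i // i ≠ i₀}, f i := fun f =>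
      Fintype.sum_eq_add_sum_subtype_ne f i₀
    rw [e1, e2]
    simp only [ht, smul_sub, Finset.sum_sub_distrib, add_mul, Finset.sum_mul, add_smul,
      Finset.sum_smul, sub_smul, smul_smul, mul_assoc]
    abel
  refine ⟨{i // i ≠ i₀}, inferInstance, t, fun i => ?_, ?_, ?_, ?_⟩
  · exact (hs i).sub (HolomorphicVectorBundle.HolAt.smul ((hβ' i).mul ((hβ' i₀).inv hi₀)) (hs i₀))
  · rw [Fintype.linearIndependent_iff] at hli ⊢
    intro c hc i
    set c' : ι → ℂ := fun j => if h : j ≠ i₀ then c ⟨j, h⟩ else 0 with hc'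
    have h1 : ∀ i : {i // i ≠ i₀}, c' i = c i := fun i => by simp [hc', i.2]
    have h2 := hsum x c'
    simp only [h1, hc] at h2
    have h3 : c' i₀ = 0 := by simp [hc']
    set a := (∑ i, c' i * β' i x) * (β' i₀ x)⁻¹
    have h4 : ∑ j, (c' j - if j = i₀ then a else 0) • s j x = 0 := by
      simp only [sub_smul, Finset.sum_sub_distrib, ite_smul, zero_smul, Finset.sum_ite_eq',
        Finset.mem_univ, if_true]
      simpa [h3] using h2.symm
    have h5 := hli _ h4 i
    simpa [h1, i.2] using h5
  · filter_upwards [hfac, (hβ' i₀).continuousAt.eventually_ne hi₀] with y h1 h2 i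
    refine ⟨Submodule.sub_mem _ (Submodule.subset_span ⟨i, rfl⟩)
      (Submodule.smul_mem _ _ (Submodule.subset_span ⟨i₀, rfl⟩)), ?_⟩
    simp only [ht, map_sub, map_smul, h1, smul_eq_mul]
    field_simp
    ring
  · have hz : ∀ᶠ y in 𝓝[≠] x, chartAt ℂ x y - chartAt ℂ x x ≠ 0 := by
      filter_upwards [mem_nhdsWithin_of_mem_nhds ((chartAt ℂ x).open_source.mem_nhds
        (mem_chart_source ℂ x)), self_mem_nhdsWithin] with y h1 h2 h3
      exact h2 ((chartAt ℂ x).injOn h1 (mem_chart_source ℂ x) (sub_eq_zero.1 h3))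
    filter_upwards [mem_nhdsWithin_of_mem_nhds hfac, hz, mem_nhdsWithin_of_mem_nhds
      ((hβ' i₀).continuousAt.eventually_ne hi₀)] with y h1 h2 h3 v hv hbv
    obtain ⟨c, rfl⟩ := (Submodule.mem_span_range_iff_exists_fun ℂ).1 hv
    have h4 : (chartAt ℂ x y - chartAt ℂ x x) ^ N * ∑ i, c i * β' i y = 0 := by
      rw [← hbv, map_sum, Finset.mul_sum]
      refine Finset.sum_congr rfl fun i _ => ?_
      rw [map_smul, h1, smul_eq_mul]
      ring
    have h5 := (mul_eq_zero.1 h4).resolve_left (pow_ne_zero _ h2)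
    have h6 := hsum y c
    rw [h5, mul_assoc, mul_inv_cancel₀ h3] at h6
    simp only [zero_mul, zero_smul, sub_zero, mul_one, sub_self] at h6
    rw [← h6]
    exact Submodule.sum_mem _ fun i _ => Submodule.smul_mem _ _ (Submodule.subset_span ⟨i, rfl⟩)

theorem exists_kernel_frame {ι : Type} [Fintype ι] {s : ι → ∀ y, E.Fiber y} {x : X}
    (hs : ∀ i, E.HolAt (s i) x) (hli : LinearIndependent ℂ fun i => s i x) {κ : Type*} [Fintype κ]
    {b : κ → ∀ y, E.Fiber y →ₗ[ℂ] ℂ} (hb : ∀ j, E.HolFunctionalAt (b j) x) :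
    ∃ (ι' : Type) (_ : Fintype ι') (t : ι' → ∀ y, E.Fiber y), (∀ a, E.HolAt (t a) x) ∧
      LinearIndependent ℂ (fun a => t a x) ∧
      (∀ᶠ y in 𝓝 x, ∀ a, t a y ∈ Submodule.span ℂ (Set.range fun i => s i y) ∧
        ∀ j, b j y (t a y) = 0) ∧
      ∀ᶠ y in 𝓝[≠] x, ∀ v ∈ Submodule.span ℂ (Set.range fun i => s i y), (∀ j, b j y v = 0) →
        v ∈ Submodule.span ℂ (Set.range fun a => t a y) := by
  classical
  suffices h : ∀ J : Finset κ, ∃ (ι' : Type) (_ : Fintype ι') (t : ι' → ∀ y, E.Fiber y),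
      (∀ a, E.HolAt (t a) x) ∧ LinearIndependent ℂ (fun a => t a x) ∧
      (∀ᶠ y in 𝓝 x, ∀ a, t a y ∈ Submodule.span ℂ (Set.range fun i => s i y) ∧
        ∀ j ∈ J, b j y (t a y) = 0) ∧
      ∀ᶠ y in 𝓝[≠] x, ∀ v ∈ Submodule.span ℂ (Set.range fun i => s i y),
        (∀ j ∈ J, b j y v = 0) → v ∈ Submodule.span ℂ (Set.range fun a => t a y) by
    simpa using h Finset.univ
  intro J
  induction J using Finset.induction_on with
  | empty =>
    refine ⟨ι, inferInstance, s, hs, hli, Eventually.of_forall fun y a =>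
      ⟨Submodule.subset_span ⟨a, rfl⟩, by simp⟩, Eventually.of_forall fun y v hv _ => hv⟩
  | insert j J _ ih =>
    obtain ⟨ι₁, _, t₁, h1, h2, h3, h4⟩ := ih
    obtain ⟨ι₂, i₂, t₂, g1, g2, g3, g4⟩ := exists_kernel_frame_single h1 h2 (hb j)
    refine ⟨ι₂, i₂, t₂, g1, g2, ?_, ?_⟩
    · filter_upwards [h3, g3] with y h3 g3 a
      have key : ∀ v ∈ Submodule.span ℂ (Set.range fun i => t₁ i y),
          v ∈ Submodule.span ℂ (Set.range fun i => s i y) ∧ ∀ j ∈ J, b j y v = 0 := by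
        intro v hv
        obtain ⟨c, rfl⟩ := (Submodule.mem_span_range_iff_exists_fun ℂ).1 hv
        refine ⟨Submodule.sum_mem _ fun i _ => Submodule.smul_mem _ _ (h3 i).1, fun j hj => ?_⟩
        simp [(h3 _).2 j hj]
      refine ⟨(key _ (g3 a).1).1, fun j' hj' => ?_⟩
      rcases Finset.mem_insert.1 hj' with rfl | hj'
      · exact (g3 a).2
      · exact (key _ (g3 a).1).2 j' hj'
    · filter_upwards [h4, g4] with y h4 g4 v hv hbv
      exact g4 v (h4 v hv fun j' hj' => hbv j' (Finset.mem_insert_of_mem hj'))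
        (hbv j (Finset.mem_insert_self _ _))

end Kernel

/-! ### Frames of subbundles -/

namespace HolomorphicVectorBundle.Subbundle

variable {X : Type*} [TopologicalSpace X] [ChartedSpace ℂ X] [IsManifold 𝓘(ℂ) ω X] {n : ℕ}
  {E : HolomorphicVectorBundle X n}

/-- The sections `s i` form a holomorphic frame of `S` near `x`. -/
def IsFrameAt {ι : Type*} (S : E.Subbundle) (s : ι → ∀ y, E.Fiber y) (x : X) : Prop :=
  (∀ i, E.HolAt (s i) x) ∧ ∀ᶠ y in 𝓝 x, LinearIndependent ℂ (fun i => s i y) ∧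
    Submodule.span ℂ (Set.range fun i => s i y) = S.fiber y

theorem isFrameAt_frame (S : E.Subbundle) (x : X) : S.IsFrameAt (S.frame x) x := by
  have hU := (S.exists_frame x).choose_spec
  have h := hU.2.2.choose_spec
  refine ⟨fun i => (isHolSection_iff hU.1).1 (h.1 i) x hU.2.1, ?_⟩
  filter_upwards [hU.1.mem_nhds hU.2.1] with y hy using h.2 y hy

theorem IsFrameAt.eventually {ι : Type*} [Finite ι] {S : E.Subbundle} {s : ι → ∀ y, E.Fiber y}
    {x : X} (h : S.IsFrameAt s x) : ∀ᶠ y in 𝓝 x, S.IsFrameAt s y := by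
  filter_upwards [eventually_all.2 fun i => (h.1 i).eventually, eventually_eventually_nhds.2 h.2]
    with y h1 h2 using ⟨h1, h2⟩

theorem IsFrameAt.linearIndependent {ι : Type*} {S : E.Subbundle} {s : ι → ∀ y, E.Fiber y}
    {x : X} (h : S.IsFrameAt s x) : LinearIndependent ℂ (fun i => s i x) := h.2.self_of_nhds.1

theorem IsFrameAt.span_eq {ι : Type*} {S : E.Subbundle} {s : ι → ∀ y, E.Fiber y}
    {x : X} (h : S.IsFrameAt s x) :
    Submodule.span ℂ (Set.range fun i => s i x) = S.fiber x := h.2.self_of_nhds.2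

theorem finrank_fiber (S : E.Subbundle) (x : X) : Module.finrank ℂ (S.fiber x) = S.rank := by
  have h := S.isFrameAt_frame x
  rw [← h.span_eq, finrank_span_eq_card h.linearIndependent, Fintype.card_fin]

theorem exists_section (S : E.Subbundle) {x : X} {v : E.Fiber x} (hv : v ∈ S.fiber x) :
    ∃ s, E.HolAt s x ∧ s x = v ∧ ∀ᶠ y in 𝓝 x, s y ∈ S.fiber y := by
  have h := S.isFrameAt_frame x
  rw [← h.span_eq] at hv
  obtain ⟨c, hc⟩ := (Submodule.mem_span_range_iff_exists_fun ℂ).1 hv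
  refine ⟨fun y => ∑ i, c i • S.frame x i y, HolAt.sum fun i _ => (h.1 i).const_smul _, hc, ?_⟩
  filter_upwards [h.2] with y hy
  rw [← hy.2]
  exact Submodule.sum_mem _ fun i _ => Submodule.smul_mem _ _ (Submodule.subset_span ⟨i, rfl⟩)

theorem IsFrameAt.exists_coeff {ι κ : Type*} [Fintype ι] {S : E.Subbundle}
    {s : ι → ∀ y, E.Fiber y} {t : κ → ∀ y, E.Fiber y} {x : X} (hs : S.IsFrameAt s x)
    (ht : ∀ j, E.HolAt (t j) x) (htS : ∀ᶠ y in 𝓝 x, ∀ j, t j y ∈ S.fiber y) [Finite κ] :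
    ∃ P : X → Matrix κ ι ℂ, (∀ i j, HolFnAt (fun y => P y i j) x) ∧
      ∀ᶠ y in 𝓝 x, ∀ j, t j y = ∑ i, P y j i • s i y := by
  have h : ∀ j, ∃ c : ι → X → ℂ, (∀ i, HolFnAt (c i) x) ∧
      ∀ᶠ y in 𝓝 x, t j y = ∑ i, c i y • s i y := by
    intro j
    refine HolomorphicVectorBundle.exists_coeff hs.1 hs.linearIndependent (ht j)
      (mem_nhdsWithin_of_mem_nhds ?_)
    filter_upwards [hs.2, htS] with y h1 h2
    show _ ∈ _
    rw [h1.2]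
    exact h2 j
  choose c hc hce using h
  exact ⟨fun y => Matrix.of fun j i => c j i y, fun j i => hc j i, eventually_all.2 hce⟩

/-- An independent family of `rank S` sections of `S` is a frame. -/
theorem isFrameAt_of_linearIndependent {ι : Type*} [Fintype ι] (S : E.Subbundle)
    {s : ι → ∀ y, E.Fiber y} {x : X} (hs : ∀ i, E.HolAt (s i) x)
    (hli : LinearIndependent ℂ fun i => s i x) (hS : ∀ i, ∀ᶠ y in 𝓝 x, s i y ∈ S.fiber y)
    (hcard : Fintype.card ι = S.rank) : S.IsFrameAt s x := by
  refine ⟨hs, ?_⟩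
  filter_upwards [eventually_linearIndependent hs hli, eventually_all.2 hS] with y h1 h2
  refine ⟨h1, Submodule.eq_of_le_of_finrank_eq ?_ ?_⟩
  · rw [Submodule.span_le]
    rintro _ ⟨i, rfl⟩
    exact h2 i
  · rw [finrank_span_eq_card h1, hcard, S.finrank_fiber]

/-- A family of subspaces with holomorphic local frames is a subbundle if `X` is connected. -/
noncomputable def ofLocalFrames [ConnectedSpace X] (fiber : ∀ x, Submodule ℂ (E.Fiber x))
    (h : ∀ x, ∃ (ι : Type) (_ : Fintype ι) (s : ι → ∀ y, E.Fiber y), (∀ i, E.HolAt (s i) x) ∧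
      LinearIndependent ℂ (fun i => s i x) ∧
      ∀ᶠ y in 𝓝 x, Submodule.span ℂ (Set.range fun i => s i y) = fiber y) : E.Subbundle where
  fiber := fiber
  rank := Module.finrank ℂ (fiber (Classical.arbitrary X))
  exists_frame := by
    -- The local frames may have different lengths a priori; connectedness of X makes the rank
    -- constant.
    have hloc : IsLocallyConstant fun x => Module.finrank ℂ (fiber x) := by
      rw [IsLocallyConstant.iff_eventually_eq]
      intro x
      obtain ⟨ι, _, s, h1, h2, h3⟩ := h x
      filter_upwards [eventually_linearIndependent h1 h2, h3] with y h4 h5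
      rw [← h5, ← h3.self_of_nhds, finrank_span_eq_card h4, finrank_span_eq_card h2]
    intro x
    obtain ⟨ι, _, s, h1, h2, h3⟩ := h x
    have hcard : Fintype.card ι = Module.finrank ℂ (fiber (Classical.arbitrary X)) := by
      rw [hloc.apply_eq_of_preconnectedSpace _ x, ← h3.self_of_nhds, finrank_span_eq_card h2]
    set e := (Fintype.equivFinOfCardEq hcard).symm
    obtain ⟨U, hU, hUo, hxU⟩ := eventually_nhds_iff.1 ((eventually_all.2 fun i =>
      (h1 i).eventually).and ((eventually_linearIndependent h1 h2).and h3))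
    refine ⟨U, hUo, hxU, fun i => s (e i), fun i => (isHolSection_iff hUo).2 fun y hy =>
      (hU y hy).1 _, fun y hy => ⟨(hU y hy).2.1.comp _ e.injective, ?_⟩⟩
    rw [← (hU y hy).2.2]
    exact congrArg _ (e.surjective.range_comp fun i => s i y)

theorem rank_le_of_le {S T : E.Subbundle} {x : X} (h : S.fiber x ≤ T.fiber x) :
    S.rank ≤ T.rank := by
  rw [← S.finrank_fiber x, ← T.finrank_fiber x]
  exact Submodule.finrank_mono h

theorem fiber_eq_of_le_of_rank_eq {S T : E.Subbundle} {x : X} (h : S.fiber x ≤ T.fiber x)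
    (hr : S.rank = T.rank) : S.fiber x = T.fiber x :=
  Submodule.eq_of_le_of_finrank_eq h (by rw [S.finrank_fiber, T.finrank_fiber, hr])

theorem fiber_eq_bot_iff {S : E.Subbundle} {x : X} : S.fiber x = ⊥ ↔ S.rank = 0 := by
  rw [← S.finrank_fiber x, Submodule.finrank_eq_zero]

/-- The whole bundle, as a subbundle. -/
noncomputable def whole (E : HolomorphicVectorBundle X n) [ConnectedSpace X] : E.Subbundle :=
  ofLocalFrames (fun _ => ⊤) fun x => by
    have hli : ∀ y ∈ E.baseSet x,
        LinearIndependent ℂ fun i => E.ofCoord x y (Pi.single i (1 : ℂ)) := fun y hy => by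
      refine LinearIndependent.map' (Pi.linearIndependent_single_one (Fin n) ℂ) _
        (LinearMap.ker_eq_bot.2 ?_)
      exact Function.LeftInverse.injective (coord_ofCoord hy)
    refine ⟨Fin n, inferInstance, fun i y => E.ofCoord x y (Pi.single i 1),
      fun i => holAt_ofCoord (E.mem_baseSet x) _, hli x (E.mem_baseSet x), ?_⟩
    filter_upwards [E.eventually_mem_baseSet x] with y hy
    exact Submodule.eq_top_of_finrank_eq (by
      rw [finrank_span_eq_card (hli y hy), E.finrank_fiber, Fintype.card_fin])

@[simp] theorem fiber_whole [ConnectedSpace X] (x : X) : (whole E).fiber x = ⊤ := rfl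

theorem rank_whole [ConnectedSpace X] : (whole E).rank = n := by
  rw [← (whole E).finrank_fiber (Classical.arbitrary X), fiber_whole, finrank_top, E.finrank_fiber]

/-! ### The kernel of a pairing -/

variable {n' : ℕ} {E' : HolomorphicVectorBundle X n'}

/-- The values at `x` of the holomorphic sections of `S` that are orthogonal to `S'`. -/
def kernelFiber (S : E.Subbundle) (S' : E'.Subbundle)
    (b : ∀ x, E.Fiber x →ₗ[ℂ] E'.Fiber x →ₗ[ℂ] ℂ) (x : X) : Submodule ℂ (E.Fiber x) where
  carrier := {v | ∃ s, E.HolAt s x ∧ s x = v ∧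
    ∀ᶠ y in 𝓝 x, s y ∈ S.fiber y ∧ ∀ w ∈ S'.fiber y, b y (s y) w = 0}
  add_mem' := by
    rintro _ _ ⟨s, hs, rfl, h⟩ ⟨t, ht, rfl, h'⟩
    refine ⟨fun y => s y + t y, hs.add ht, rfl, ?_⟩
    filter_upwards [h, h'] with y h1 h2
    exact ⟨Submodule.add_mem _ h1.1 h2.1, fun w hw => by simp [h1.2 w hw, h2.2 w hw]⟩
  zero_mem' := ⟨fun _ => 0, holAt_zero x, rfl, by simp⟩
  smul_mem' := by
    rintro a _ ⟨s, hs, rfl, h⟩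
    refine ⟨fun y => a • s y, hs.const_smul a, rfl, ?_⟩
    filter_upwards [h] with y h1
    exact ⟨Submodule.smul_mem _ _ h1.1, fun w hw => by simp [h1.2 w hw]⟩

/-- Near x orthogonality to S′ amounts to finitely many functionals, one for each member of a frame,
so `exists_kernel_frame` supplies the sections. At x itself a germ orthogonal to S′ lies in their
span off x, hence also at x by `exists_coeff`. -/
theorem exists_kernelFiber_frame (S : E.Subbundle) (S' : E'.Subbundle)
    {b : ∀ x, E.Fiber x →ₗ[ℂ] E'.Fiber x →ₗ[ℂ] ℂ} (hb : E.IsHolPairing E' b) (x : X) :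
    ∃ (ι : Type) (_ : Fintype ι) (t : ι → ∀ y, E.Fiber y), (∀ i, E.HolAt (t i) x) ∧
      LinearIndependent ℂ (fun i => t i x) ∧
      (∀ᶠ y in 𝓝 x, Submodule.span ℂ (Set.range fun i => t i y) = kernelFiber S S' b y) ∧
      ∀ᶠ y in 𝓝[≠] x, ∀ v ∈ S.fiber y, (∀ w ∈ S'.fiber y, b y v w = 0) →
        v ∈ kernelFiber S S' b y := by
  have hs := S.isFrameAt_frame x
  have hs' := S'.isFrameAt_frame x
  obtain ⟨ι, i, t, h1, h2, h3, h4⟩ := exists_kernel_frame hs.1 hs.linearIndependent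
    (b := fun j y => (b y).flip (S'.frame x j y)) (fun j u hu => hb x u _ hu (hs'.1 j))
  have hann : ∀ᶠ y in 𝓝 x, ∀ v, (∀ j, (b y).flip (S'.frame x j y) v = 0) ↔
      ∀ w ∈ S'.fiber y, b y v w = 0 := by
    filter_upwards [hs'.2] with y hy v
    refine ⟨fun h w hw => ?_, fun h j => h _ (hy.2 ▸ Submodule.subset_span ⟨j, rfl⟩)⟩
    rw [← hy.2] at hw
    obtain ⟨c, rfl⟩ := (Submodule.mem_span_range_iff_exists_fun ℂ).1 hw
    simp only [LinearMap.flip_apply] at h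
    simp [h]
  have hker : ∀ᶠ y in 𝓝 x, ∀ a, t a y ∈ S.fiber y ∧ ∀ w ∈ S'.fiber y, b y (t a y) w = 0 := by
    filter_upwards [h3, hs.2, hann] with y h3 h5 h6 a
    exact ⟨h5.2 ▸ (h3 a).1, (h6 _).1 (h3 a).2⟩
  have hle : ∀ᶠ y in 𝓝 x, Submodule.span ℂ (Set.range fun i => t i y) ≤ kernelFiber S S' b y := by
    filter_upwards [eventually_eventually_nhds.2 hker, eventually_all.2 fun a => (h1 a).eventually]
      with y h5 h6
    rw [Submodule.span_le]
    rintro _ ⟨a, rfl⟩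
    exact ⟨t a, h6 a, rfl, h5.mono fun y' hy' => hy' a⟩
  have hpun : ∀ᶠ y in 𝓝[≠] x, ∀ v ∈ S.fiber y, (∀ w ∈ S'.fiber y, b y v w = 0) →
      v ∈ Submodule.span ℂ (Set.range fun i => t i y) := by
    filter_upwards [h4, mem_nhdsWithin_of_mem_nhds hann, mem_nhdsWithin_of_mem_nhds hs.2]
      with y h5 h6 h7 v hv hvw
    exact h5 v (h7.2.symm ▸ hv) ((h6 v).2 hvw)
  refine ⟨ι, i, t, h1, h2, ?_, ?_⟩
  · have hpun' := eventually_nhdsWithin_iff.1 hpun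
    filter_upwards [hle, hpun'] with y h5 h6
    refine le_antisymm h5 ?_
    rintro v ⟨u, hu, rfl, hue⟩
    by_cases hyx : y = x
    · subst hyx
      obtain ⟨c, -, hc⟩ := HolomorphicVectorBundle.exists_coeff h1 h2 hu (by
        filter_upwards [mem_nhdsWithin_of_mem_nhds hue, hpun] with y' h7 h8
        exact h8 _ h7.1 h7.2)
      rw [hc.self_of_nhds]
      exact Submodule.sum_mem _ fun i _ => Submodule.smul_mem _ _ (Submodule.subset_span ⟨i, rfl⟩)
    · exact h6 hyx _ hue.self_of_nhds.1 hue.self_of_nhds.2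
  · filter_upwards [hpun, mem_nhdsWithin_of_mem_nhds hle] with y h5 h6 v hv hvw
    exact h6 (h5 v hv hvw)

variable [ConnectedSpace X]

/-- The saturated kernel in `S` of the pairing `b` of `S` with `S'`. -/
noncomputable def kernel (S : E.Subbundle) (S' : E'.Subbundle)
    {b : ∀ x, E.Fiber x →ₗ[ℂ] E'.Fiber x →ₗ[ℂ] ℂ} (hb : E.IsHolPairing E' b) : E.Subbundle :=
  ofLocalFrames (kernelFiber S S' b) fun x => by
    obtain ⟨ι, i, t, h1, h2, h3, -⟩ := exists_kernelFiber_frame S S' hb x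
    exact ⟨ι, i, t, h1, h2, h3⟩

variable {S : E.Subbundle} {S' : E'.Subbundle} {b : ∀ x, E.Fiber x →ₗ[ℂ] E'.Fiber x →ₗ[ℂ] ℂ}
  {hb : E.IsHolPairing E' b}

theorem kernel_le (x : X) : (kernel S S' hb).fiber x ≤ S.fiber x := by
  rintro v ⟨s, -, rfl, h⟩
  exact h.self_of_nhds.1

theorem apply_eq_zero_of_mem_kernel {x : X} {v : E.Fiber x} (hv : v ∈ (kernel S S' hb).fiber x)
    {w : E'.Fiber x} (hw : w ∈ S'.fiber x) : b x v w = 0 := by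
  obtain ⟨s, -, rfl, h⟩ := hv
  exact h.self_of_nhds.2 w hw

theorem eventually_mem_kernel (hb : E.IsHolPairing E' b) (x : X) :
    ∀ᶠ y in 𝓝[≠] x, ∀ v ∈ S.fiber y, (∀ w ∈ S'.fiber y, b y v w = 0) →
      v ∈ (kernel S S' hb).fiber y := by
  obtain ⟨ι, i, t, -, -, -, h⟩ := exists_kernelFiber_frame S S' hb x
  exact h

/-- Rank and nullity of the map from S to the dual of S′: its kernel lies in K and its image in the
annihilator of K′. -/
theorem rank_pairing_le {V W : Type*} [AddCommGroup V] [Module ℂ V] [AddCommGroup W] [Module ℂ W]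
    [FiniteDimensional ℂ V] [FiniteDimensional ℂ W] (b : V →ₗ[ℂ] W →ₗ[ℂ] ℂ)
    (S K : Submodule ℂ V) (S' K' : Submodule ℂ W) (hK' : K' ≤ S')
    (hbK : ∀ v ∈ S, (∀ w ∈ S', b v w = 0) → v ∈ K) (hbK' : ∀ v ∈ S, ∀ w ∈ K', b v w = 0) :
    Module.finrank ℂ S + Module.finrank ℂ K' ≤ Module.finrank ℂ S' + Module.finrank ℂ K := by
  set f : S →ₗ[ℂ] Module.Dual ℂ S' := (b.domRestrict₁₂ S S') with hf
  have h1 := f.finrank_range_add_finrank_ker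
  have h2 : Module.finrank ℂ (LinearMap.ker f) ≤ Module.finrank ℂ K := by
    refine LinearMap.finrank_le_finrank_of_injective
      (f := LinearMap.codRestrict K (S.subtype ∘ₗ (LinearMap.ker f).subtype) ?_) ?_
    · rintro ⟨⟨v, hv⟩, hvk⟩
      refine hbK v hv fun w hw => ?_
      have := LinearMap.congr_fun (LinearMap.mem_ker.1 hvk) ⟨w, hw⟩
      exact this
    · intro v w h
      have := congrArg Subtype.val h
      exact Subtype.ext (Subtype.ext (by simpa using this))
  have h3 : LinearMap.range f ≤ (K'.comap S'.subtype).dualAnnihilator := by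
    rintro _ ⟨v, rfl⟩
    rw [Submodule.mem_dualAnnihilator]
    intro w hw
    exact hbK' v v.2 w hw
  have h4 := Submodule.finrank_mono h3
  have h5 := Subspace.finrank_add_finrank_dualAnnihilator_eq (K'.comap S'.subtype)
  have h6 : Module.finrank ℂ (K'.comap S'.subtype) = Module.finrank ℂ K' :=
    (Submodule.comapSubtypeEquivOfLe hK').finrank_eq
  omega

/-- At a generic point both saturated kernels are the pointwise ones, and there the left and right
ranks of the pairing agree. -/
theorem rank_kernel (S : E.Subbundle) (S' : E'.Subbundle) (hb : E.IsHolPairing E' b) :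
    S.rank + (kernel S' S hb.flip).rank = S'.rank + (kernel S S' hb).rank := by
  set x := Classical.arbitrary X
  have : (𝓝[≠] x).NeBot := nhdsNE_neBot_surface x
  obtain ⟨y, h1, h2⟩ := ((eventually_mem_kernel (S := S) (S' := S') hb x).and
    (eventually_mem_kernel (S := S') (S' := S) hb.flip x)).exists
  rw [← S.finrank_fiber y, ← S'.finrank_fiber y, ← (kernel S' S hb.flip).finrank_fiber y,
    ← (kernel S S' hb).finrank_fiber y]
  apply le_antisymm
  · exact rank_pairing_le (b y) _ _ _ _ (kernel_le y) h1
      fun v hv w hw => apply_eq_zero_of_mem_kernel (b := fun x => (b x).flip) hw hv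
  · exact rank_pairing_le (b y).flip _ _ _ _ (kernel_le y) h2
      fun v hv w hw => apply_eq_zero_of_mem_kernel (b := b) hw hv

end HolomorphicVectorBundle.Subbundle

/-! ### Gram determinants -/

section Gram

open scoped ComplexOrder

variable {V : Type*} [AddCommGroup V] [Module ℂ V]

/-- The Gram determinant of a family of vectors. -/
noncomputable def gram {ι : Type*} [Fintype ι] [DecidableEq ι] (B : V →ₗ⋆[ℂ] V →ₗ[ℂ] ℂ)
    (v : ι → V) : ℝ :=
  (Matrix.of fun i j => B (v i) (v j)).det.re

variable {ι κ : Type*} [Fintype ι] [DecidableEq ι] [Fintype κ] [DecidableEq κ]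
  {B : V →ₗ⋆[ℂ] V →ₗ[ℂ] ℂ}

theorem gram_change {v w : ι → V} {P : Matrix ι ι ℂ} (h : ∀ j, w j = ∑ i, P j i • v i) :
    gram B w = ‖P.det‖ ^ 2 * gram B v := by
  have : (Matrix.of fun i j => B (w i) (w j)) =
      P.map (starRingEnd ℂ) * (Matrix.of fun i j => B (v i) (v j)) * P.transpose := by
    ext i j
    simp only [Matrix.of_apply, h, map_sum, LinearMap.sum_apply, Matrix.mul_apply, Matrix.map_apply,
      Matrix.transpose_apply, LinearMap.map_smulₛₗ, LinearMap.smul_apply, smul_eq_mul,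
      Finset.sum_mul, Finset.mul_sum]
    refine Finset.sum_congr rfl fun a _ => Finset.sum_congr rfl fun b _ => ?_
    rw [RingHom.id_apply]
    ring
  have h2 : (P.map (starRingEnd ℂ)).det = conj P.det := (RingHom.map_det (starRingEnd ℂ) P).symm
  rw [gram, gram, this, Matrix.det_mul, Matrix.det_mul, Matrix.det_transpose, h2, mul_right_comm,
    mul_comm (conj P.det), Complex.mul_conj, Complex.re_ofReal_mul, Complex.normSq_eq_norm_sq]

theorem gram_pos (hB : ∀ v w, conj (B v w) = B w v) (hpos : ∀ v, v ≠ 0 → 0 < (B v v).re)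
    {v : ι → V} (hv : LinearIndependent ℂ v) : 0 < gram B v := by
  have hP : (Matrix.of fun i j => B (v i) (v j)).PosDef := by
    refine Matrix.PosDef.of_dotProduct_mulVec_pos ?_ fun c hc => ?_
    · ext i j
      simp [Matrix.conjTranspose_apply, hB]
    · have h1 : star c ⬝ᵥ (Matrix.of fun i j => B (v i) (v j)).mulVec c =
          B (∑ i, c i • v i) (∑ i, c i • v i) := by
        simp only [dotProduct, Matrix.mulVec, map_sum, LinearMap.sum_apply, LinearMap.map_smulₛₗ,
          LinearMap.smul_apply, smul_eq_mul, Matrix.of_apply, Finset.mul_sum, Pi.star_apply,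
          RingHom.id_apply]
        rw [Finset.sum_comm]
        refine Finset.sum_congr rfl fun a _ => Finset.sum_congr rfl fun b _ => ?_
        simp only [starRingEnd_apply]
        ring
      rw [h1, Complex.lt_def]
      refine ⟨hpos _ fun h0 => hc ?_, ?_⟩
      · funext i
        exact Fintype.linearIndependent_iff.1 hv c h0 i
      · have := congrArg Complex.im (hB (∑ i, c i • v i) (∑ i, c i • v i))
        simp only [Complex.conj_im, Complex.zero_im] at this ⊢
        linarith
  have := hP.det_pos
  rw [Complex.lt_def] at this
  exact this.1

theorem exists_complementary_family {K S : Submodule ℂ V} [FiniteDimensional ℂ V] (hKS : K ≤ S)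
    {r : ℕ} (hr : Module.finrank ℂ S = Module.finrank ℂ K + r) {k : ι → V}
    (hk : LinearIndependent ℂ k) (hkK : ∀ i, k i ∈ K) :
    ∃ l : Fin r → V, (∀ i, l i ∈ S) ∧ LinearIndependent ℂ (Sum.elim k l) := by
  obtain ⟨C, hC⟩ := exists_isCompl K
  have h1 : K ⊓ (C ⊓ S) = ⊥ := by
    rw [← inf_assoc, hC.inf_eq_bot, bot_inf_eq]
  have h2 : K ⊔ (C ⊓ S) = S := by
    rw [← sup_inf_assoc_of_le C hKS, hC.sup_eq_top, top_inf_eq]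
  have h3 := Submodule.finrank_sup_add_finrank_inf_eq K (C ⊓ S)
  rw [h1, h2, finrank_bot, hr] at h3
  have h4 : Module.finrank ℂ ↥(C ⊓ S) = r := by omega
  set β := Module.finBasisOfFinrankEq ℂ _ h4
  refine ⟨fun i => β i, fun i => (β i).2.2, ?_⟩
  refine LinearIndependent.sum_type hk (β.linearIndependent.map' (Submodule.subtype _) (by simp)) ?_
  refine Disjoint.mono (Submodule.span_le.2 (by rintro _ ⟨i, rfl⟩; exact hkK i))
    (Submodule.span_le.2 (by rintro _ ⟨i, rfl⟩; exact (β i).2)) (disjoint_iff.2 h1)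

theorem exists_coeff_of_mem {S : Submodule ℂ V} [FiniteDimensional ℂ V] {v : ι → V}
    (hv : LinearIndependent ℂ v) (hvS : ∀ i, v i ∈ S) (hr : Module.finrank ℂ S = Fintype.card ι)
    {w : V} (hw : w ∈ S) : ∃ c : ι → ℂ, w = ∑ i, c i • v i := by
  have : Submodule.span ℂ (Set.range v) = S := Submodule.eq_of_le_of_finrank_eq
    (Submodule.span_le.2 (by rintro _ ⟨i, rfl⟩; exact hvS i)) (by rw [finrank_span_eq_card hv, hr])
  rw [← this] at hw
  obtain ⟨c, hc⟩ := (Submodule.mem_span_range_iff_exists_fun ℂ).1 hw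
  exact ⟨c, hc.symm⟩

end Gram

/-! ### The norm of the determinant of a pairing -/

section PairingNorm

variable {V W : Type*} [AddCommGroup V] [Module ℂ V] [AddCommGroup W] [Module ℂ W]

/-- The pair `(k, l)` is a basis of `S` that extends the basis `k` of `K`. -/
structure IsAdaptedBasis {ι κ : Type*} (K S : Submodule ℂ V) (k : ι → V) (l : κ → V) : Prop where
  mem_left : ∀ i, k i ∈ K
  mem_right : ∀ i, l i ∈ S
  linearIndependent : LinearIndependent ℂ (Sum.elim k l)

variable {ι ι' κ : Type*} [Fintype ι] [DecidableEq ι] [Fintype ι'] [DecidableEq ι'] [Fintype κ]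
  [DecidableEq κ]

/-- The squared norm of the determinant of the pairing induced by `b` on the complements of `k`
and `k'`. -/
noncomputable def pairingNorm (B : V →ₗ⋆[ℂ] V →ₗ[ℂ] ℂ) (B' : W →ₗ⋆[ℂ] W →ₗ[ℂ] ℂ)
    (b : V →ₗ[ℂ] W →ₗ[ℂ] ℂ) (k : ι → V) (l : κ → V) (k' : ι' → W) (l' : κ → W) : ℝ :=
  ‖(Matrix.of fun i j => b (l i) (l' j)).det‖ ^ 2 * (gram B k * gram B' k') /
    (gram B (Sum.elim k l) * gram B' (Sum.elim k' l'))

variable [FiniteDimensional ℂ V] [FiniteDimensional ℂ W] {K S : Submodule ℂ V}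
  {K' S' : Submodule ℂ W} {k k₁ : ι → V} {l l₁ : κ → V} {k' k₁' : ι' → W} {l' l₁' : κ → W}

/-- The change of basis is block triangular because K is preserved. R is the induced change on S/K:
a relation between its rows would put a nontrivial combination of the `l₁` into K. -/
theorem IsAdaptedBasis.exists_change (hKS : K ≤ S) (hK : Module.finrank ℂ K = Fintype.card ι)
    (hS : Module.finrank ℂ S = Fintype.card ι + Fintype.card κ) (h : IsAdaptedBasis K S k l)
    (h₁ : IsAdaptedBasis K S k₁ l₁) : ∃ (P : Matrix ι ι ℂ) (Q : Matrix κ ι ℂ) (R : Matrix κ κ ℂ),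
      (∀ j, k₁ j = ∑ i, P j i • k i) ∧ (∀ j, l₁ j = ∑ i, Q j i • k i + ∑ i, R j i • l i) ∧
      P.det ≠ 0 ∧ R.det ≠ 0 := by
  have hk : LinearIndependent ℂ k := h.linearIndependent.comp Sum.inl Sum.inl_injective
  choose P hP using fun j => exists_coeff_of_mem hk h.mem_left hK (h₁.mem_left j)
  have hmem : ∀ i, Sum.elim k l i ∈ S := by
    rintro (i | i)
    exacts [hKS (h.mem_left i), h.mem_right i]
  choose Q hQ using fun j => exists_coeff_of_mem h.linearIndependent hmem
    (hS.trans (Fintype.card_sum).symm) (h₁.mem_right j)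
  refine ⟨Matrix.of P, Matrix.of fun j i => Q j (Sum.inl i), Matrix.of fun j i => Q j (Sum.inr i),
    hP, fun j => (hQ j).trans (by simp [Fintype.sum_sum_type]), ?_, ?_⟩
  · intro h0
    obtain ⟨c, hc0, hc⟩ := Matrix.exists_vecMul_eq_zero_iff.2 h0
    apply hc0
    have hk₁ : LinearIndependent ℂ k₁ := h₁.linearIndependent.comp Sum.inl Sum.inl_injective
    funext j
    refine Fintype.linearIndependent_iff.1 hk₁ c ?_ j
    have h2 : ∀ i, ∑ j, c j * P j i = 0 := fun i => congrFun hc i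
    simp only [hP, Finset.smul_sum, smul_smul]
    rw [Finset.sum_comm]
    simp only [← Finset.sum_smul, h2, zero_smul, Finset.sum_const_zero]
  · intro h0
    obtain ⟨c, hc0, hc⟩ := Matrix.exists_vecMul_eq_zero_iff.2 h0
    apply hc0
    have h2 : ∀ i, ∑ j, c j * Q j (Sum.inr i) = 0 := fun i => congrFun hc i
    have h3 : ∑ j, c j • l₁ j ∈ K := by
      have : ∑ j, c j • l₁ j = ∑ i, (∑ j, c j * Q j (Sum.inl i)) • k i := by
        simp only [hQ, Finset.smul_sum, smul_smul]
        rw [Finset.sum_comm]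
        simp only [← Finset.sum_smul, Fintype.sum_sum_type, Sum.elim_inl, Sum.elim_inr, h2,
          zero_smul, Finset.sum_const_zero, add_zero]
      rw [this]
      exact Submodule.sum_mem _ fun i _ => Submodule.smul_mem _ _ (h.mem_left i)
    obtain ⟨d, hd⟩ := exists_coeff_of_mem
      (h₁.linearIndependent.comp Sum.inl Sum.inl_injective) h₁.mem_left hK h3
    have h4 := Fintype.linearIndependent_iff.1 h₁.linearIndependent (Sum.elim (-d) c) (by
      simp [Fintype.sum_sum_type, hd])
    funext j
    exact h4 (Sum.inr j)

theorem gram_adapted_change {B : V →ₗ⋆[ℂ] V →ₗ[ℂ] ℂ} {P : Matrix ι ι ℂ} {Q : Matrix κ ι ℂ}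
    {R : Matrix κ κ ℂ} (hP : ∀ j, k₁ j = ∑ i, P j i • k i)
    (hQ : ∀ j, l₁ j = ∑ i, Q j i • k i + ∑ i, R j i • l i) :
    gram B (Sum.elim k₁ l₁) = ‖P.det‖ ^ 2 * ‖R.det‖ ^ 2 * gram B (Sum.elim k l) := by
  rw [gram_change (P := Matrix.fromBlocks P 0 Q R) (v := Sum.elim k l),
    Matrix.det_fromBlocks_zero₁₂, norm_mul, mul_pow]
  rintro (j | j)
  · simp [hP, Fintype.sum_sum_type]
  · simp [hQ, Fintype.sum_sum_type]

variable {B : V →ₗ⋆[ℂ] V →ₗ[ℂ] ℂ} {B' : W →ₗ⋆[ℂ] W →ₗ[ℂ] ℂ} {b : V →ₗ[ℂ] W →ₗ[ℂ] ℂ}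

/-- The pairing factors through S/K and S′/K′, so its determinant changes by det R det R′. The
quotient of Gram determinants changes by the inverse square of the absolute value of this factor. -/
theorem pairingNorm_eq (hKS : K ≤ S) (hK : Module.finrank ℂ K = Fintype.card ι)
    (hS : Module.finrank ℂ S = Fintype.card ι + Fintype.card κ)
    (hKS' : K' ≤ S') (hK' : Module.finrank ℂ K' = Fintype.card ι')
    (hS' : Module.finrank ℂ S' = Fintype.card ι' + Fintype.card κ)
    (hb : ∀ v ∈ K, ∀ w ∈ S', b v w = 0) (hb' : ∀ v ∈ S, ∀ w ∈ K', b v w = 0)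
    (h : IsAdaptedBasis K S k l) (h₁ : IsAdaptedBasis K S k₁ l₁)
    (h' : IsAdaptedBasis K' S' k' l') (h₁' : IsAdaptedBasis K' S' k₁' l₁') :
    pairingNorm B B' b k₁ l₁ k₁' l₁' = pairingNorm B B' b k l k' l' := by
  obtain ⟨P, Q, R, h2, h3, h4, h5⟩ := h.exists_change hKS hK hS h₁
  obtain ⟨P', Q', R', h2', h3', h4', h5'⟩ := h'.exists_change hKS' hK' hS' h₁'
  have hdet : (Matrix.of fun i j => b (l₁ i) (l₁' j)) =
      R * (Matrix.of fun i j => b (l i) (l' j)) * R'.transpose := by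
    ext i j
    have e1 : b (l₁ i) (l₁' j) = ∑ a, R i a * ∑ c, R' j c * b (l a) (l' c) := by
      have : ∀ x ∈ S, b x (l₁' j) = ∑ c, R' j c * b x (l' c) := by
        intro x hx
        simp [h3', hb' x hx _ (h'.mem_left _)]
      rw [this _ (h₁.mem_right i), h3 i]
      simp only [map_add, map_sum, LinearMap.add_apply, LinearMap.sum_apply, map_smul,
        LinearMap.smul_apply, smul_eq_mul, hb _ (h.mem_left _) _ (h'.mem_right _), mul_zero,
        Finset.sum_const_zero, zero_add, Finset.mul_sum]
      rw [Finset.sum_comm]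
      exact Finset.sum_congr rfl fun a _ => Finset.sum_congr rfl fun b _ => by ring
    simp only [Matrix.of_apply, e1, Matrix.mul_apply, Matrix.transpose_apply, Finset.sum_mul,
      Finset.mul_sum]
    rw [Finset.sum_comm]
    exact Finset.sum_congr rfl fun a _ => Finset.sum_congr rfl fun b _ => by ring
  rw [pairingNorm, pairingNorm, hdet, Matrix.det_mul, Matrix.det_mul, Matrix.det_transpose,
    gram_change h2, gram_change h2', gram_adapted_change h2 h3, gram_adapted_change h2' h3',
    norm_mul, norm_mul]
  have e1 := norm_ne_zero_iff.2 h4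
  have e2 := norm_ne_zero_iff.2 h5
  have e3 := norm_ne_zero_iff.2 h4'
  have e4 := norm_ne_zero_iff.2 h5'
  rw [← mul_div_mul_left _ (gram B (Sum.elim k l) * gram B' (Sum.elim k' l'))
    (c := ‖P.det‖ ^ 2 * ‖R.det‖ ^ 2 * (‖P'.det‖ ^ 2 * ‖R'.det‖ ^ 2)) (by positivity)]
  congr 1 <;> ring

/-- A null vector of the matrix is the coordinate vector, modulo K, of an element of S orthogonal to
S′. -/
theorem det_pairing_eq_zero_iff (hKS : K ≤ S)
    (hS : Module.finrank ℂ S = Fintype.card ι + Fintype.card κ)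
    (hKS' : K' ≤ S') (hK : Module.finrank ℂ K = Fintype.card ι)
    (hS' : Module.finrank ℂ S' = Fintype.card ι' + Fintype.card κ)
    (hb : ∀ v ∈ K, ∀ w ∈ S', b v w = 0) (hb' : ∀ v ∈ S, ∀ w ∈ K', b v w = 0)
    (h : IsAdaptedBasis K S k l) (h' : IsAdaptedBasis K' S' k' l') :
    (Matrix.of fun i j => b (l i) (l' j)).det = 0 ↔
      ∃ v ∈ S, v ∉ K ∧ ∀ w ∈ S', b v w = 0 := by
  have hmem : ∀ i, Sum.elim k l i ∈ S := by
    rintro (i | i)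
    exacts [hKS (h.mem_left i), h.mem_right i]
  have hmem' : ∀ i, Sum.elim k' l' i ∈ S' := by
    rintro (i | i)
    exacts [hKS' (h'.mem_left i), h'.mem_right i]
  rw [← Matrix.exists_vecMul_eq_zero_iff]
  constructor
  · rintro ⟨c, hc0, hc⟩
    have h2 : ∀ j, ∑ i, c i * b (l i) (l' j) = 0 := fun j => congrFun hc j
    have hvS : ∑ i, c i • l i ∈ S :=
      Submodule.sum_mem _ fun i _ => Submodule.smul_mem _ _ (h.mem_right i)
    refine ⟨_, hvS, fun hvK => hc0 ?_, fun w hw => ?_⟩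
    · obtain ⟨d, hd⟩ := exists_coeff_of_mem
        (h.linearIndependent.comp Sum.inl Sum.inl_injective) h.mem_left hK hvK
      have h4 := Fintype.linearIndependent_iff.1 h.linearIndependent (Sum.elim (-d) c) (by
        simp [Fintype.sum_sum_type, hd])
      funext j
      exact h4 (Sum.inr j)
    · obtain ⟨d, rfl⟩ := exists_coeff_of_mem h'.linearIndependent hmem'
        (hS'.trans Fintype.card_sum.symm) hw
      have h3 : ∀ j, b (∑ i, c i • l i) (l' j) = 0 := fun j => by
        simpa using h2 j
      clear hw
      generalize ∑ i, c i • l i = z at hvS h3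
      rw [Fintype.sum_sum_type, map_add, map_sum, map_sum]
      simp only [Sum.elim_inl, Sum.elim_inr, map_smul, hb' _ hvS _ (h'.mem_left _), h3, smul_zero,
        Finset.sum_const_zero, add_zero]
  · rintro ⟨v, hvS, hvK, hv⟩
    obtain ⟨d, rfl⟩ := exists_coeff_of_mem h.linearIndependent hmem
      (hS.trans Fintype.card_sum.symm) hvS
    refine ⟨fun i => d (Sum.inr i), fun h0 => hvK ?_, ?_⟩
    · have h1 : ∀ i, d (Sum.inr i) = 0 := congrFun h0
      simp only [Fintype.sum_sum_type, Sum.elim_inl, Sum.elim_inr, h1, zero_smul,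
        Finset.sum_const_zero, add_zero]
      exact Submodule.sum_mem _ fun i _ => Submodule.smul_mem _ _ (h.mem_left i)
    · funext j
      have := hv (l' j) (h'.mem_right j)
      simpa [Fintype.sum_sum_type, hb _ (h.mem_left _) _ (h'.mem_right _), Matrix.vecMul,
        dotProduct] using this

end PairingNorm

/-! ### The degree of a subbundle -/

section Potential

variable {X : Type*} [TopologicalSpace X] [ChartedSpace ℂ X] [IsManifold 𝓘(ℂ) ω X] {n : ℕ}
  {E : HolomorphicVectorBundle X n}

theorem HermitianMetric.gram_pos (H : HermitianMetric E) {ι : Type*} [Fintype ι] [DecidableEq ι]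
    {x : X} {v : ι → E.Fiber x} (hv : LinearIndependent ℂ v) : 0 < gram (H.form x) v :=
  _root_.gram_pos (H.conj_symm x) (H.pos x) hv

theorem HermitianMetric.smoothFnAt_gram (H : HermitianMetric E) {ι : Type*} [Fintype ι]
    [DecidableEq ι] {x : X} {s : ι → ∀ y, E.Fiber y} (hs : ∀ i, E.HolAt (s i) x) :
    SmoothFnAt (fun y => gram (H.form y) fun i => s i y) x := by
  have h1 : ∀ i j, ContMDiffAt 𝓘(ℝ, ℂ) 𝓘(ℝ, ℂ) ∞ (fun y => H.form y (s i y) (s j y)) x := by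
    intro i j
    obtain ⟨U, hU, hxU, hsU⟩ := (hs i).exists_isOpen
    obtain ⟨U', hU', hxU', hsU'⟩ := (hs j).exists_isOpen
    exact (H.smooth (U ∩ U') _ _ (hU.inter hU') (hsU.mono Set.inter_subset_left)
      (hsU'.mono Set.inter_subset_right)).contMDiffAt ((hU.inter hU').mem_nhds ⟨hxU, hxU'⟩)
  have h2 : ContDiff ℝ ∞ fun A : ι → ι → ℂ => (Matrix.of A).det.re := by
    refine Complex.reCLM.contDiff.comp (f := fun A : ι → ι → ℂ => (Matrix.of A).det) ?_
    simp only [Matrix.det_apply', Matrix.of_apply]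
    refine ContDiff.sum fun σ _ => contDiff_const.mul (contDiff_prod fun i _ => ?_)
    fun_prop
  exact h2.contDiffAt.contMDiffAt.comp x (contMDiffAt_pi_space.2 fun i =>
    contMDiffAt_pi_space.2 fun j => h1 i j)

namespace HolomorphicVectorBundle.Subbundle

/-- h is the determinant of the change of frame, made square by a bijection of the index types. It
is nonzero at x because Gram determinants of frames are positive. -/
theorem IsFrameAt.exists_gram_eq {ι κ : Type*} [Fintype ι] [DecidableEq ι] [Fintype κ]
    [DecidableEq κ] {S : E.Subbundle} {s : ι → ∀ y, E.Fiber y} {t : κ → ∀ y, E.Fiber y} {x : X}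
    (hs : S.IsFrameAt s x) (ht : S.IsFrameAt t x) (H : HermitianMetric E) :
    ∃ h : X → ℂ, HolFnAt h x ∧ h x ≠ 0 ∧ ∀ᶠ y in 𝓝 x,
      gram (H.form y) (fun i => t i y) = ‖h y‖ ^ 2 * gram (H.form y) (fun i => s i y) := by
  have hcard : Fintype.card κ = Fintype.card ι := by
    rw [← finrank_span_eq_card hs.linearIndependent, ← finrank_span_eq_card ht.linearIndependent,
      hs.span_eq, ht.span_eq]
  have htS : ∀ᶠ y in 𝓝 x, ∀ j, t j y ∈ S.fiber y := by
    filter_upwards [ht.2] with y hy j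
    exact hy.2 ▸ Submodule.subset_span ⟨j, rfl⟩
  obtain ⟨P, hP, hPe⟩ := hs.exists_coeff ht.1 htS
  let e : κ ≃ ι := Fintype.equivOfCardEq hcard
  have hgram : ∀ᶠ y in 𝓝 x, gram (H.form y) (fun i => t i y) =
      ‖((P y).submatrix id e).det‖ ^ 2 * gram (H.form y) (fun i => s i y) := by
    filter_upwards [hPe] with y hy
    rw [gram_change (P := (P y).submatrix id e) (v := fun j => s (e j) y)]
    · congr 1
      have h1 : (Matrix.of fun i j => H.form y (s (e i) y) (s (e j) y)) =
          (Matrix.of fun i j => H.form y (s i y) (s j y)).submatrix e e := rfl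
      rw [gram, gram, h1, Matrix.det_submatrix_equiv_self]
    · intro j
      rw [hy j, ← e.sum_comp]
      rfl
  refine ⟨fun y => ((P y).submatrix id e).det, holFnAt_det fun i j => hP _ _, fun h0 => ?_, hgram⟩
  have h1 := hgram.self_of_nhds
  have h2 := H.gram_pos ht.linearIndependent
  change ((P x).submatrix id e).det = 0 at h0
  rw [h1, h0] at h2
  simp at h2

/-- The logarithms of the Gram determinants of the frames of `S`. -/
noncomputable def potential (S : E.Subbundle) (H : HermitianMetric E) (x y : X) : ℝ :=
  Real.log (gram (H.form y) fun i => S.frame x i y)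

theorem isPotential_potential (S : E.Subbundle) (H : HermitianMetric E) :
    IsPotential (S.potential H) where
  smooth x := (H.smoothFnAt_gram (S.isFrameAt_frame x).1).log
    (H.gram_pos (S.isFrameAt_frame x).linearIndependent).ne'
  equiv x := by
    filter_upwards [(S.isFrameAt_frame x).eventually] with y hy
    obtain ⟨h, hh, h0, he⟩ := (S.isFrameAt_frame y).exists_gram_eq hy H
    refine ⟨h, hh, h0, ?_⟩
    filter_upwards [he, hh.continuousAt.eventually_ne h0, (S.isFrameAt_frame y).2] with z h1 h2 h3
    rw [potential, potential, h1, Real.log_mul (by simpa using h2) (H.gram_pos h3.1).ne', add_comm]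

theorem exp_potential {S : E.Subbundle} (H : HermitianMetric E) (x : X) :
    ∀ᶠ y in 𝓝 x, Real.exp (S.potential H x y) = gram (H.form y) fun i => S.frame x i y := by
  filter_upwards [(S.isFrameAt_frame x).2] with y hy
  exact Real.exp_log (H.gram_pos hy.1)

variable {n' : ℕ} {E' : HolomorphicVectorBundle X n'}

/-- F is the squared norm of the determinant of the pairing of S/K with S′/K′, a section of the dual
of det (S/K) ⊗ det (S′/K′). By `pairingNorm_eq` it may be defined with an arbitrary adapted basis at
each point and computed near x with holomorphic ones. -/
theorem exists_isSectionNorm {S K : E.Subbundle} {S' K' : E'.Subbundle}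
    {b : ∀ x, E.Fiber x →ₗ[ℂ] E'.Fiber x →ₗ[ℂ] ℂ} (hb : E.IsHolPairing E' b)
    (H : HermitianMetric E) (H' : HermitianMetric E') {r : ℕ}
    (hS : S.rank = K.rank + r) (hS' : S'.rank = K'.rank + r)
    (hKS : ∀ x, K.fiber x ≤ S.fiber x) (hKS' : ∀ x, K'.fiber x ≤ S'.fiber x)
    (h0 : ∀ x, ∀ v ∈ K.fiber x, ∀ w ∈ S'.fiber x, b x v w = 0)
    (h0' : ∀ x, ∀ v ∈ S.fiber x, ∀ w ∈ K'.fiber x, b x v w = 0) :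
    ∃ F, IsSectionNorm (fun x y => (K.potential H x y + K'.potential H' x y) +
        (-S.potential H x y + -S'.potential H' x y)) F ∧
      ∀ x, F x = 0 ↔ ∃ v ∈ S.fiber x, v ∉ K.fiber x ∧ ∀ w ∈ S'.fiber x, b x v w = 0 := by
  have hr : ∀ x, Module.finrank ℂ (S.fiber x) = Module.finrank ℂ (K.fiber x) + r := fun x => by
    rw [S.finrank_fiber, K.finrank_fiber, hS]
  have hr' : ∀ x, Module.finrank ℂ (S'.fiber x) = Module.finrank ℂ (K'.fiber x) + r := fun x => by
    rw [S'.finrank_fiber, K'.finrank_fiber, hS']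
  have hKmem : ∀ (x : X) i, K.frame x i x ∈ K.fiber x := fun x i =>
    (K.isFrameAt_frame x).span_eq ▸ Submodule.subset_span ⟨i, rfl⟩
  have hKmem' : ∀ (x : X) i, K'.frame x i x ∈ K'.fiber x := fun x i =>
    (K'.isFrameAt_frame x).span_eq ▸ Submodule.subset_span ⟨i, rfl⟩
  choose L hLS hLi using fun x => exists_complementary_family (hKS x) (hr x)
    (K.isFrameAt_frame x).linearIndependent (hKmem x)
  choose L' hLS' hLi' using fun x => exists_complementary_family (hKS' x) (hr' x)
    (K'.isFrameAt_frame x).linearIndependent (hKmem' x)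
  have hcK : ∀ x, Module.finrank ℂ (K.fiber x) = Fintype.card (Fin K.rank) := by
    simp [K.finrank_fiber]
  have hcK' : ∀ x, Module.finrank ℂ (K'.fiber x) = Fintype.card (Fin K'.rank) := by
    simp [K'.finrank_fiber]
  have hcS : ∀ x, Module.finrank ℂ (S.fiber x) = Fintype.card (Fin K.rank) + Fintype.card (Fin r) :=
    by simp [S.finrank_fiber, hS]
  have hcS' : ∀ x, Module.finrank ℂ (S'.fiber x) =
      Fintype.card (Fin K'.rank) + Fintype.card (Fin r) := by
    simp [S'.finrank_fiber, hS']
  have had : ∀ x, IsAdaptedBasis (K.fiber x) (S.fiber x) (fun i => K.frame x i x) (L x) :=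
    fun x => ⟨hKmem x, hLS x, hLi x⟩
  have had' : ∀ x, IsAdaptedBasis (K'.fiber x) (S'.fiber x) (fun i => K'.frame x i x) (L' x) :=
    fun x => ⟨hKmem' x, hLS' x, hLi' x⟩
  refine ⟨fun y => pairingNorm (H.form y) (H'.form y) (b y) (fun i => K.frame y i y) (L y)
    (fun i => K'.frame y i y) (L' y), fun x => ?_, fun x => ?_⟩
  -- The complement chosen at `x` is extended to holomorphic sections, which still complete the
  -- frame of `K` near `x`.
  · choose l hl hlx hlS using fun i => S.exists_section (hLS x i)
    choose l' hl' hlx' hlS' using fun i => S'.exists_section (hLS' x i)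
    have hfr : S.IsFrameAt (Sum.elim (K.frame x) l) x := by
      refine S.isFrameAt_of_linearIndependent ?_ ?_ ?_ (by simp [hS])
      · rintro (i | i)
        exacts [(K.isFrameAt_frame x).1 i, hl i]
      · convert hLi x using 2 with i
        rcases i with i | i
        exacts [rfl, hlx i]
      · rintro (i | i)
        · filter_upwards [(K.isFrameAt_frame x).2] with y hy
          exact hKS y (hy.2 ▸ Submodule.subset_span ⟨i, rfl⟩)
        · exact hlS i
    have hfr' : S'.IsFrameAt (Sum.elim (K'.frame x) l') x := by
      refine S'.isFrameAt_of_linearIndependent ?_ ?_ ?_ (by simp [hS'])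
      · rintro (i | i)
        exacts [(K'.isFrameAt_frame x).1 i, hl' i]
      · convert hLi' x using 2 with i
        rcases i with i | i
        exacts [rfl, hlx' i]
      · rintro (i | i)
        · filter_upwards [(K'.isFrameAt_frame x).2] with y hy
          exact hKS' y (hy.2 ▸ Submodule.subset_span ⟨i, rfl⟩)
        · exact hlS' i
    obtain ⟨p, hp, hp0, hpe⟩ := (S.isFrameAt_frame x).exists_gram_eq hfr H
    obtain ⟨p', hp', hp0', hpe'⟩ := (S'.isFrameAt_frame x).exists_gram_eq hfr' H'
    refine ⟨fun y => (Matrix.of fun i j => b y (l i y) (l' j y)).det * ((p y)⁻¹ * (p' y)⁻¹),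
      (holFnAt_det fun i j => hb x _ _ (hl i) (hl' j)).mul ((hp.inv hp0).mul (hp'.inv hp0')), ?_⟩
    have elim_eq : ∀ y, (fun i => Sum.elim (K.frame x) l i y) =
        Sum.elim (fun i => K.frame x i y) (fun i => l i y) := fun y => by
      funext i; rcases i with i | i <;> rfl
    have elim_eq' : ∀ y, (fun i => Sum.elim (K'.frame x) l' i y) =
        Sum.elim (fun i => K'.frame x i y) (fun i => l' i y) := fun y => by
      funext i; rcases i with i | i <;> rfl
    filter_upwards [hpe, hpe', exp_potential (S := K) H x, exp_potential (S := K') H' x,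
      exp_potential (S := S) H x, exp_potential (S := S') H' x, (K.isFrameAt_frame x).2,
      (K'.isFrameAt_frame x).2, eventually_all.2 hlS, eventually_all.2 hlS', hfr.2, hfr'.2]
      with y e1 e2 e3 e4 e5 e6 e7 e8 e9 e10 e11 e12
    have hy : IsAdaptedBasis (K.fiber y) (S.fiber y) (fun i => K.frame x i y) (fun i => l i y) :=
      ⟨fun i => e7.2 ▸ Submodule.subset_span ⟨i, rfl⟩, e9, elim_eq y ▸ e11.1⟩
    have hy' : IsAdaptedBasis (K'.fiber y) (S'.fiber y) (fun i => K'.frame x i y)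
        (fun i => l' i y) :=
      ⟨fun i => e8.2 ▸ Submodule.subset_span ⟨i, rfl⟩, e10, elim_eq' y ▸ e12.1⟩
    rw [pairingNorm_eq (hKS y) (hcK y) (hcS y) (hKS' y) (hcK' y) (hcS' y) (h0 y) (h0' y) hy (had y)
      hy' (had' y), pairingNorm, ← elim_eq, ← elim_eq', e1, e2, ← e3, ← e4, ← e5, ← e6]
    simp only [Real.exp_add, Real.exp_neg, norm_mul, norm_inv, mul_pow, inv_pow]
    ring
  · rw [← det_pairing_eq_zero_iff (hKS x) (hcS x) (hKS' x) (hcK x) (hcS' x) (h0 x) (h0' x) (had x)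
      (had' x)]
    simp only [pairingNorm]
    have e1 := H.gram_pos (K.isFrameAt_frame x).linearIndependent
    have e2 := H'.gram_pos (K'.isFrameAt_frame x).linearIndependent
    have e3 := H.gram_pos (had x).linearIndependent
    have e4 := H'.gram_pos (had' x).linearIndependent
    simp [e1.ne', e2.ne', e3.ne', e4.ne']

section Degree

variable [CompactSpace X] [T2Space X]

theorem degree_eq (S : E.Subbundle) : S.degree = -(1 / (4 * Real.pi)) *
    densityIntegral (exists_partition_subordinate_charts X).choose
      (curvature (S.potential (Classical.choice (HermitianMetric.nonempty E)))) :=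
  (densityIntegral_const_mul _ _)

/-- By `h1` the determinant of the induced pairing is a nonzero section. Its line bundle has degree
≥ 0, equal to 0 precisely when the section has no zero, that is, when no vector of S outside K is
orthogonal to S′. -/
theorem degree_pairing [ConnectedSpace X] {S K : E.Subbundle} {S' K' : E'.Subbundle}
    {b : ∀ x, E.Fiber x →ₗ[ℂ] E'.Fiber x →ₗ[ℂ] ℂ} (hb : E.IsHolPairing E' b) {r : ℕ}
    (hS : S.rank = K.rank + r) (hS' : S'.rank = K'.rank + r)
    (hKS : ∀ x, K.fiber x ≤ S.fiber x) (hKS' : ∀ x, K'.fiber x ≤ S'.fiber x)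
    (h0 : ∀ x, ∀ v ∈ K.fiber x, ∀ w ∈ S'.fiber x, b x v w = 0)
    (h0' : ∀ x, ∀ v ∈ S.fiber x, ∀ w ∈ K'.fiber x, b x v w = 0)
    (h1 : ∃ x, ∀ v ∈ S.fiber x, (∀ w ∈ S'.fiber x, b x v w = 0) → v ∈ K.fiber x) :
    S.degree + S'.degree ≤ K.degree + K'.degree ∧
    ((∀ x, ∀ v ∈ S.fiber x, (∀ w ∈ S'.fiber x, b x v w = 0) → v ∈ K.fiber x) ↔
      S.degree + S'.degree = K.degree + K'.degree) := by
  obtain ⟨F, hF, hF0⟩ := exists_isSectionNorm hb (Classical.choice (HermitianMetric.nonempty E))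
    (Classical.choice (HermitianMetric.nonempty E')) hS hS' hKS hKS' h0 h0'
  have hρ := (exists_partition_subordinate_charts X).choose_spec
  have p1 := isPotential_potential K (Classical.choice (HermitianMetric.nonempty E))
  have p2 := isPotential_potential K' (Classical.choice (HermitianMetric.nonempty E'))
  have p3 := isPotential_potential S (Classical.choice (HermitianMetric.nonempty E))
  have p4 := isPotential_potential S' (Classical.choice (HermitianMetric.nonempty E'))
  have hφ := (p1.add p2).add (p3.neg.add p4.neg)
  have hF1 : ∃ x, F x ≠ 0 := by
    obtain ⟨x, hx⟩ := h1
    refine ⟨x, fun h => ?_⟩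
    obtain ⟨v, hv, hvK, hvS⟩ := (hF0 x).1 h
    exact hvK (hx v hv hvS)
  have hle := hF.integral_nonpos hρ hφ hF1
  have hlt := fun x₀ => hF.integral_neg hρ hφ hF1 (x₀ := x₀)
  have heq := hF.integral_eq_zero hρ hφ
  rw [densityIntegral_curvature_add hρ (p1.add p2) (p3.neg.add p4.neg),
    densityIntegral_curvature_add hρ p1 p2, densityIntegral_curvature_add hρ p3.neg p4.neg,
    densityIntegral_curvature_neg, densityIntegral_curvature_neg] at hle hlt heq
  have hpi : 0 < 1 / (4 * Real.pi) := by positivity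
  simp only [degree_eq]
  refine ⟨by nlinarith, fun h => ?_, fun h x v hv hvS => ?_⟩
  · have := heq fun x hx => by
      obtain ⟨v, hv, hvK, hvS⟩ := (hF0 x).1 hx
      exact hvK (h x v hv hvS)
    linear_combination (1 / (4 * Real.pi)) * this
  · by_contra hvK
    have := hlt x ((hF0 x).2 ⟨v, hv, hvK, hvS⟩)
    nlinarith

variable [ConnectedSpace X] {S : E.Subbundle} {S' : E'.Subbundle}
  {b : ∀ x, E.Fiber x →ₗ[ℂ] E'.Fiber x →ₗ[ℂ] ℂ}

theorem degree_kernel (S : E.Subbundle) (S' : E'.Subbundle) (hb : E.IsHolPairing E' b) :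
    S.degree + S'.degree ≤ (kernel S S' hb).degree + (kernel S' S hb.flip).degree ∧
    ((∀ x, ∀ v ∈ S.fiber x, (∀ w ∈ S'.fiber x, b x v w = 0) → v ∈ (kernel S S' hb).fiber x) ↔
      S.degree + S'.degree = (kernel S S' hb).degree + (kernel S' S hb.flip).degree) := by
  set x := Classical.arbitrary X
  have : (𝓝[≠] x).NeBot := nhdsNE_neBot_surface x
  have h1 := rank_kernel S S' hb
  have h2 : (kernel S S' hb).rank ≤ S.rank := rank_le_of_le (kernel_le x)
  refine degree_pairing hb (r := S.rank - (kernel S S' hb).rank) (by omega) (by omega)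
    kernel_le kernel_le (fun x v hv w hw => apply_eq_zero_of_mem_kernel hv hw)
    (fun x v hv w hw => apply_eq_zero_of_mem_kernel (b := fun x => (b x).flip) hw hv) ?_
  exact (eventually_mem_kernel hb x).exists

/-- The determinant of f is a nowhere vanishing section of Hom(det S, det S′), which therefore has
degree 0. Its squared norm is the quotient of the Gram determinants of a frame and of its image. -/
theorem degree_congr {f : ∀ x, E.Fiber x →ₗ[ℂ] E'.Fiber x} (hf : E.IsHolHom E' f)
    (hS : ∀ x, (S.fiber x).map (f x) = S'.fiber x)
    (hinj : ∀ x, ∀ v ∈ S.fiber x, f x v = 0 → v = 0) : S.degree = S'.degree := by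
  set H := Classical.choice (HermitianMetric.nonempty E) with hH
  set H' := Classical.choice (HermitianMetric.nonempty E') with hH'
  have hfr : ∀ {ι : Type} [Fintype ι] {x} {s : ι → ∀ y, E.Fiber y}, S.IsFrameAt s x →
      S'.IsFrameAt (fun i y => f y (s i y)) x := by
    intro ι _ x s hs
    refine ⟨fun i => hf x _ (hs.1 i), ?_⟩
    filter_upwards [hs.2] with y hy
    constructor
    · refine hy.1.map_injOn (f y) fun v hv w hw hvw => ?_
      rw [SetLike.mem_coe, hy.2] at hv hw
      exact sub_eq_zero.1 (hinj y _ (Submodule.sub_mem _ hv hw) (by rw [map_sub, hvw, sub_self]))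
    · rw [← hS y, ← hy.2, Submodule.map_span, ← Set.range_comp]
      rfl
  have hF : IsSectionNorm (fun x y => S'.potential H' x y + -S.potential H x y)
      (fun y => gram (H'.form y) (fun i => f y (S.frame y i y)) /
        gram (H.form y) (fun i => S.frame y i y)) := by
    intro x
    obtain ⟨p, hp, hp0, hpe⟩ := (S'.isFrameAt_frame x).exists_gram_eq (hfr (S.isFrameAt_frame x)) H'
    refine ⟨p, hp, ?_⟩
    filter_upwards [hpe, exp_potential (S := S) H x, exp_potential (S := S') H' x,
      (S.isFrameAt_frame x).eventually] with y e1 e2 e3 e4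
    have hx := e4.linearIndependent
    obtain ⟨P, -, hP⟩ := e4.exists_coeff (S.isFrameAt_frame y).1 (by
      filter_upwards [(S.isFrameAt_frame y).2] with z hz j
      exact hz.2 ▸ Submodule.subset_span ⟨j, rfl⟩)
    have hPy := hP.self_of_nhds
    have g1 : gram (H.form y) (fun i => S.frame y i y) =
        ‖(P y).det‖ ^ 2 * gram (H.form y) (fun i => S.frame x i y) := gram_change hPy
    have g2 : gram (H'.form y) (fun i => f y (S.frame y i y)) =
        ‖(P y).det‖ ^ 2 * gram (H'.form y) (fun i => f y (S.frame x i y)) :=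
      gram_change fun j => by rw [hPy j]; simp
    have g3 := H.gram_pos (S.isFrameAt_frame y).linearIndependent
    have g4 : ‖(P y).det‖ ^ 2 ≠ 0 := fun h => by
      rw [g1, h] at g3
      simp at g3
    rw [g2, g1, mul_div_mul_left _ _ g4, e1, Real.exp_add, Real.exp_neg, e2, e3]
    ring
  have hρ := (exists_partition_subordinate_charts X).choose_spec
  have p1 := isPotential_potential S H
  have p2 := isPotential_potential S' H'
  have := hF.integral_eq_zero hρ (p2.add p1.neg) fun y =>
    (div_pos (H'.gram_pos (hfr (S.isFrameAt_frame y)).linearIndependent)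
      (H.gram_pos (S.isFrameAt_frame y).linearIndependent)).ne'
  rw [densityIntegral_curvature_add hρ p2 p1.neg, densityIntegral_curvature_neg] at this
  rw [degree_eq, degree_eq]
  linear_combination (1 / (4 * Real.pi)) * this

theorem degree_eq_of_fiber_eq {S T : E.Subbundle} (h : ∀ x, S.fiber x = T.fiber x) :
    S.degree = T.degree :=
  degree_congr (f := fun _ => LinearMap.id) (fun _ _ hs => hs) (by simpa using h) (by simp)

/-- The Gram determinant of the empty family is 1, so the potential is 0. -/
theorem degree_eq_zero_of_rank_eq_zero (h : S.rank = 0) : S.degree = 0 := by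
  have h0 : E.IsHolPairing E fun x => 0 := fun x s t _ _ => holFnAt_const 0 x
  have hbot : ∀ x, S.fiber x = ⊥ := fun x => fiber_eq_bot_iff.2 h
  have hmem : ∀ x, ∀ v ∈ S.fiber x, v = 0 := fun x v hv => by
    rw [hbot] at hv
    simpa using hv
  set H := Classical.choice (HermitianMetric.nonempty E) with hH
  have : IsEmpty (Fin S.rank) := by rw [h]; infer_instance
  rw [degree_eq]
  have hc : curvature (S.potential H) = fun _ _ => 0 := by
    funext c z
    have : (fun w => S.potential H ((chartAt ℂ c).symm z) ((chartAt ℂ c).symm w)) = fun _ => 0 := by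
      funext w
      simp [potential, gram]
    rw [curvature, this]
    exact congrFun (InnerProductSpace.laplacian_const) z
  rw [hc]
  simp [densityIntegral]

end Degree

end HolomorphicVectorBundle.Subbundle

end Potential

/-! ### Higgs bundles as graded bundles with an odd endomorphism -/

section VectorField

variable {X : Type*} [TopologicalSpace X] [ChartedSpace ℂ X] [IsManifold 𝓘(ℂ) ω X]

/-- The extension is constant in a trivialization. It is needed because the holomorphy of a Higgs
field is tested on holomorphic vector fields only. -/
theorem exists_isHolVectorField (x : X) (ξ : TangentSpace 𝓘(ℂ) x) :
    ∃ (U : Set X) (η : ∀ y : X, TangentSpace 𝓘(ℂ) y), IsOpen U ∧ x ∈ U ∧ IsHolVectorField U η ∧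
      η x = ξ := by
  set e := trivializationAt ℂ (TangentSpace (M := X) 𝓘(ℂ)) x with he
  have hx : x ∈ e.baseSet := FiberBundle.mem_baseSet_trivializationAt' x
  refine ⟨e.baseSet, fun y => e.symm y (e ⟨x, ξ⟩).2, e.open_baseSet, hx, ?_,
    e.symm_apply_apply_mk hx ξ⟩
  refine (e.contMDiffOn_section_baseSet_iff (n := ω) (IB := 𝓘(ℂ))).2 ?_
  refine (contMDiffOn_const (c := (e ⟨x, ξ⟩).2)).congr fun y hy => ?_
  rw [e.apply_mk_symm hy]

end VectorField

namespace SymplecticVectorBundle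

variable {X : Type*} [TopologicalSpace X] [ChartedSpace ℂ X] [IsManifold 𝓘(ℂ) ω X] {p : ℕ}

theorem isHolPairing_form (V : SymplecticVectorBundle X p) :
    V.IsHolPairing V.toHolomorphicVectorBundle V.form :=
  HolomorphicVectorBundle.isHolPairing_of_isHolSection V.form_holomorphic

theorem form_swap (V : SymplecticVectorBundle X p) (x : X) (v w : V.Fiber x) :
    V.form x v w = -V.form x w v :=
  ((V.form_alt x).neg w v).symm

theorem eq_zero_of_form_left (V : SymplecticVectorBundle X p) {x : X} {v : V.Fiber x}
    (h : ∀ w, V.form x v w = 0) : v = 0 :=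
  (V.form_nondegenerate x).1 v h

theorem eq_zero_of_form_right (V : SymplecticVectorBundle X p) {x : X} {v : V.Fiber x}
    (h : ∀ w, V.form x w v = 0) : v = 0 :=
  (V.form_nondegenerate x).2 v h

end SymplecticVectorBundle

theorem TwistedHom.holAt {X : Type*} [TopologicalSpace X] [ChartedSpace ℂ X]
    [IsManifold 𝓘(ℂ) ω X] {m n : ℕ} {E : HolomorphicVectorBundle X m}
    {F : HolomorphicVectorBundle X n} (φ : TwistedHom E F) {x : X} {U : Set X} (hU : IsOpen U)
    (hx : x ∈ U) {η : ∀ y : X, TangentSpace 𝓘(ℂ) y} (hη : IsHolVectorField U η)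
    {s : ∀ y, E.Fiber y} (hs : E.HolAt s x) : F.HolAt (fun y => φ.toFun y (η y) (s y)) x := by
  obtain ⟨U', hU', hx', hs'⟩ := hs.exists_isOpen
  exact (HolomorphicVectorBundle.isHolSection_iff (hU.inter hU')).1
    (φ.holomorphic (U ∩ U') η s (hU.inter hU') (hη.mono Set.inter_subset_left)
      (hs'.mono Set.inter_subset_right)) x ⟨hx, hx'⟩

namespace SpHiggsBundle

variable {X : Type*} [TopologicalSpace X] [ChartedSpace ℂ X] [IsManifold 𝓘(ℂ) ω X]

/-- The component of even (`V`) or odd (`W`) degree. -/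
def comp {p q : ℕ} (M : SpHiggsBundle X p q) : ∀ b : Bool, SymplecticVectorBundle X (bif b then q else p)
  | false => M.V
  | true => M.W

/-- The bundle underlying the component of degree `b`. -/
abbrev bdl {p q : ℕ} (M : SpHiggsBundle X p q) (b : Bool) :
    HolomorphicVectorBundle X (2 * bif b then q else p) :=
  (M.comp b).toHolomorphicVectorBundle

/-- The Higgs field, as an odd endomorphism. -/
noncomputable def higgs {p q : ℕ} (M : SpHiggsBundle X p q) : ∀ (b c : Bool) (x : X),
    TangentSpace 𝓘(ℂ) x →ₗ[ℂ] (M.bdl b).Fiber x →ₗ[ℂ] (M.bdl c).Fiber x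
  | false, true => M.γ.toFun
  | true, false => M.β.toFun
  | false, false => fun _ => 0
  | true, true => fun _ => 0

variable {p q p' q' p'' q'' : ℕ} {M : SpHiggsBundle X p q} {N : SpHiggsBundle X p' q'}
  {L : SpHiggsBundle X p'' q''}

theorem higgs_skew (b c : Bool) (x : X) (ξ : TangentSpace 𝓘(ℂ) x) (v : (M.bdl b).Fiber x)
    (w : (M.bdl c).Fiber x) :
    (M.comp c).form x (M.higgs b c x ξ v) w = -(M.comp b).form x v (M.higgs c b x ξ w) := by
  cases b <;> cases c
  · simp [higgs]
  · rw [(M.comp true).form_swap, (M.comp false).form_swap, neg_neg]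
    exact (M.skew x ξ w v).symm
  · exact M.skew x ξ v w
  · simp [higgs]

theorem holAt_higgs (b c : Bool) {x : X} (ξ : TangentSpace 𝓘(ℂ) x) {s : ∀ y, (M.bdl b).Fiber y}
    (hs : (M.bdl b).HolAt s x) : ∃ η : ∀ y : X, TangentSpace 𝓘(ℂ) y, η x = ξ ∧
      (M.bdl c).HolAt (fun y => M.higgs b c y (η y) (s y)) x := by
  obtain ⟨U, η, hU, hx, hη, hηx⟩ := exists_isHolVectorField x ξ
  refine ⟨η, hηx, ?_⟩
  cases b <;> cases c
  · simpa [higgs] using HolomorphicVectorBundle.holAt_zero x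
  · exact M.γ.holAt hU hx hη hs
  · exact M.β.holAt hU hx hη hs
  · simpa [higgs] using HolomorphicVectorBundle.holAt_zero x

/-- A graded subbundle that is invariant under the Higgs field. -/
structure HiggsSubbundle (M : SpHiggsBundle X p q) where
  comp : ∀ b, (M.bdl b).Subbundle
  higgs_mem : ∀ (b c : Bool) (x : X) (ξ : TangentSpace 𝓘(ℂ) x), ∀ v ∈ (comp b).fiber x,
    M.higgs b c x ξ v ∈ (comp c).fiber x

/-- A holomorphic pairing of Higgs bundles for which the Higgs fields are skew-adjoint. -/
structure IsHiggsPairing (M : SpHiggsBundle X p q) (N : SpHiggsBundle X p' q')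
    (B : ∀ b x, (M.bdl b).Fiber x →ₗ[ℂ] (N.bdl b).Fiber x →ₗ[ℂ] ℂ) : Prop where
  hol : ∀ b, (M.bdl b).IsHolPairing (N.bdl b) (B b)
  skew : ∀ (b c : Bool) (x : X) (ξ : TangentSpace 𝓘(ℂ) x) (v : (M.bdl b).Fiber x)
    (w : (N.bdl c).Fiber x), B c x (M.higgs b c x ξ v) w = -B b x v (N.higgs c b x ξ w)

/-- A homomorphism of Higgs bundles (without regard to the symplectic forms). -/
structure IsHiggsHom (M : SpHiggsBundle X p q) (N : SpHiggsBundle X p' q')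
    (a : ∀ b x, (M.bdl b).Fiber x →ₗ[ℂ] (N.bdl b).Fiber x) : Prop where
  hol : ∀ b, (M.bdl b).IsHolHom (N.bdl b) (a b)
  comm : ∀ (b c : Bool) (x : X) (ξ : TangentSpace 𝓘(ℂ) x) (v : (M.bdl b).Fiber x),
    a c x (M.higgs b c x ξ v) = N.higgs b c x ξ (a b x v)

theorem isHiggsPairing_form (M : SpHiggsBundle X p q) :
    M.IsHiggsPairing M fun b => (M.comp b).form :=
  ⟨fun b => (M.comp b).isHolPairing_form, higgs_skew⟩

theorem IsHiggsPairing.flip {B : ∀ b x, (M.bdl b).Fiber x →ₗ[ℂ] (N.bdl b).Fiber x →ₗ[ℂ] ℂ}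
    (hB : M.IsHiggsPairing N B) : N.IsHiggsPairing M fun b x => (B b x).flip :=
  ⟨fun b => (hB.hol b).flip, fun b c x ξ v w => by simp [hB.skew c b x ξ w v]⟩

theorem IsHiggsPairing.sub {B B' : ∀ b x, (M.bdl b).Fiber x →ₗ[ℂ] (N.bdl b).Fiber x →ₗ[ℂ] ℂ}
    (hB : M.IsHiggsPairing N B) (hB' : M.IsHiggsPairing N B') :
    M.IsHiggsPairing N fun b x => B b x - B' b x :=
  ⟨fun b x s t hs ht => (hB.hol b x s t hs ht).sub (hB'.hol b x s t hs ht), fun b c x ξ v w => by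
    simp only [LinearMap.sub_apply, hB.skew, hB'.skew]; ring⟩

theorem IsHiggsPairing.smul {B : ∀ b x, (M.bdl b).Fiber x →ₗ[ℂ] (N.bdl b).Fiber x →ₗ[ℂ] ℂ}
    (k : ℂ) (hB : M.IsHiggsPairing N B) : M.IsHiggsPairing N fun b x => k • B b x :=
  ⟨fun b x s t hs ht => (holFnAt_const k x).mul (hB.hol b x s t hs ht), fun b c x ξ v w => by
    simp [hB.skew]⟩

namespace IsHiggsHom

variable {a a' : ∀ b x, (M.bdl b).Fiber x →ₗ[ℂ] (N.bdl b).Fiber x}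
  {a'' : ∀ b x, (N.bdl b).Fiber x →ₗ[ℂ] (L.bdl b).Fiber x}

theorem id (M : SpHiggsBundle X p q) : M.IsHiggsHom M fun _ _ => LinearMap.id :=
  ⟨fun _ _ _ hs => hs, fun _ _ _ _ _ => rfl⟩

theorem add (ha : M.IsHiggsHom N a) (ha' : M.IsHiggsHom N a') :
    M.IsHiggsHom N fun b x => a b x + a' b x :=
  ⟨fun b x s hs => ((ha.hol b) x s hs).add ((ha'.hol b) x s hs),
    fun b c x ξ v => by simp [ha.comm, ha'.comm]⟩

theorem smul (k : ℂ) (ha : M.IsHiggsHom N a) : M.IsHiggsHom N fun b x => k • a b x :=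
  ⟨fun b x s hs => ((ha.hol b) x s hs).const_smul k, fun b c x ξ v => by simp [ha.comm]⟩

theorem sub (ha : M.IsHiggsHom N a) (ha' : M.IsHiggsHom N a') :
    M.IsHiggsHom N fun b x => a b x - a' b x :=
  ⟨fun b x s hs => ((ha.hol b) x s hs).sub ((ha'.hol b) x s hs),
    fun b c x ξ v => by simp [ha.comm, ha'.comm]⟩

theorem comp (ha'' : N.IsHiggsHom L a'') (ha : M.IsHiggsHom N a) :
    M.IsHiggsHom L fun b x => a'' b x ∘ₗ a b x :=
  ⟨fun b x s hs => (ha''.hol b) x _ ((ha.hol b) x s hs), fun b c x ξ v => by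
    simp [ha.comm, ha''.comm]⟩

theorem sum {ι : Type*} {S : Finset ι}
    {a : ι → ∀ b x, (M.bdl b).Fiber x →ₗ[ℂ] (N.bdl b).Fiber x}
    (ha : ∀ i ∈ S, M.IsHiggsHom N (a i)) : M.IsHiggsHom N fun b x => ∑ i ∈ S, a i b x :=
  ⟨fun b x s hs => by
    simp only [LinearMap.sum_apply]
    exact HolomorphicVectorBundle.HolAt.sum fun i hi => (ha i hi).hol b x s hs,
    fun b c x ξ v => by
      simp only [LinearMap.sum_apply, map_sum]
      exact Finset.sum_congr rfl fun i hi => (ha i hi).comm b c x ξ v⟩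

theorem comap_pairing {B : ∀ b x, (N.bdl b).Fiber x →ₗ[ℂ] (N.bdl b).Fiber x →ₗ[ℂ] ℂ}
    (ha : M.IsHiggsHom N a) (hB : N.IsHiggsPairing N B) :
    M.IsHiggsPairing M fun b x => (B b x).compl₁₂ (a b x) (a b x) :=
  ⟨fun b x s t hs ht => hB.hol b x _ _ (ha.hol b x s hs) (ha.hol b x t ht),
    fun b c x ξ v w => by simp [ha.comm, hB.skew]⟩

/-- The form of N is nondegenerate, so the kernel of this pairing is the kernel of a. Homomorphisms
thereby come under the degree inequality for pairings. -/
theorem pairing (ha : M.IsHiggsHom N a) :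
    M.IsHiggsPairing N fun b x => (N.comp b).form x ∘ₗ a b x :=
  ⟨fun b x s t hs ht => (N.comp b).isHolPairing_form x _ t (ha.hol b x s hs) ht,
    fun b c x ξ v w => by simp [ha.comm, N.higgs_skew]⟩

end IsHiggsHom

namespace HiggsSubbundle

open HolomorphicVectorBundle

/-- The subspaces of the fibres. -/
def fiber (S : HiggsSubbundle M) (b : Bool) (x : X) : Submodule ℂ ((M.bdl b).Fiber x) :=
  (S.comp b).fiber x

/-- The sum of the ranks of the two components. -/
def rank (S : HiggsSubbundle M) : ℕ := (S.comp false).rank + (S.comp true).rank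

theorem fiber_eq_bot (S : HiggsSubbundle M) (h : S.rank = 0) (b : Bool) (x : X) :
    S.fiber b x = ⊥ := by
  refine Subbundle.fiber_eq_bot_iff.2 ?_
  unfold rank at h
  cases b <;> omega

theorem rank_eq_zero_of_fiber (S : HiggsSubbundle M) {x : X} (h : ∀ b, S.fiber b x = ⊥) :
    S.rank = 0 := by
  have h1 := Subbundle.fiber_eq_bot_iff.1 (h false)
  have h2 := Subbundle.fiber_eq_bot_iff.1 (h true)
  unfold rank
  omega

theorem rank_le_of_le {S T : HiggsSubbundle M} {x : X} (h : ∀ b, S.fiber b x ≤ T.fiber b x) :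
    S.rank ≤ T.rank :=
  add_le_add (Subbundle.rank_le_of_le (h false)) (Subbundle.rank_le_of_le (h true))

theorem fiber_eq_of_le_of_rank_eq {S T : HiggsSubbundle M}
    (h : ∀ b x, S.fiber b x ≤ T.fiber b x) (hr : S.rank = T.rank) (b : Bool) (x : X) :
    S.fiber b x = T.fiber b x := by
  have h1 := Subbundle.rank_le_of_le (h false x)
  have h2 := Subbundle.rank_le_of_le (h true x)
  unfold rank at hr
  refine Subbundle.fiber_eq_of_le_of_rank_eq (h b x) ?_
  cases b <;> omega

/-- The form vanishes on the subbundle. -/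
def IsIsotropic (S : HiggsSubbundle M) : Prop :=
  ∀ b x, ∀ v ∈ S.fiber b x, ∀ w ∈ S.fiber b x, (M.comp b).form x v w = 0

/-- The form is nondegenerate on the subbundle. -/
def IsNondegenerate (S : HiggsSubbundle M) : Prop :=
  ∀ b x, ∀ v ∈ S.fiber b x, (∀ w ∈ S.fiber b x, (M.comp b).form x v w = 0) → v = 0

/-! ### Degrees of invariant subbundles -/

section Connected

variable [ConnectedSpace X]

/-- The whole Higgs bundle. -/
noncomputable def whole (M : SpHiggsBundle X p q) : HiggsSubbundle M where
  comp _ := Subbundle.whole _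
  higgs_mem _ _ _ _ _ _ := trivial

/-- The saturated kernel in `S` of a pairing of `S` with `S'`. -/
noncomputable def kernel (S : HiggsSubbundle M) (S' : HiggsSubbundle N)
    {B : ∀ b x, (M.bdl b).Fiber x →ₗ[ℂ] (N.bdl b).Fiber x →ₗ[ℂ] ℂ}
    (hB : M.IsHiggsPairing N B) : HiggsSubbundle M where
  comp b := Subbundle.kernel (S.comp b) (S'.comp b) (hB.hol b)
  higgs_mem b c x ξ v hv := by
    obtain ⟨s, hs, rfl, he⟩ := hv
    -- Membership in the saturated kernel is a condition on germs, so the tangent vector is extended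
    -- too. Skew-adjointness moves the Higgs field to the invariant `S'`.
    obtain ⟨η, rfl, hη⟩ := holAt_higgs b c ξ hs
    refine ⟨_, hη, rfl, ?_⟩
    filter_upwards [he] with y hy
    refine ⟨S.higgs_mem b c y _ _ hy.1, fun w hw => ?_⟩
    rw [hB.skew, hy.2 _ (S'.higgs_mem c b y _ w hw), neg_zero]

variable {S : HiggsSubbundle M} {S' : HiggsSubbundle N}
  {B : ∀ b x, (M.bdl b).Fiber x →ₗ[ℂ] (N.bdl b).Fiber x →ₗ[ℂ] ℂ} {hB : M.IsHiggsPairing N B}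

theorem kernel_le (b : Bool) (x : X) : (kernel S S' hB).fiber b x ≤ S.fiber b x :=
  Subbundle.kernel_le (hb := hB.hol b) x

theorem apply_eq_zero_of_mem_kernel {b : Bool} {x : X} {v : (M.bdl b).Fiber x}
    (hv : v ∈ (kernel S S' hB).fiber b x) {w : (N.bdl b).Fiber x} (hw : w ∈ S'.fiber b x) :
    B b x v w = 0 :=
  Subbundle.apply_eq_zero_of_mem_kernel (hb := hB.hol b) hv hw

variable [CompactSpace X] [T2Space X]

/-- The sum of the degrees of the two components. -/
noncomputable def degree (S : HiggsSubbundle M) : ℝ :=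
  (S.comp false).degree + (S.comp true).degree

theorem degree_eq_of_fiber_eq {S T : HiggsSubbundle M} (h : ∀ b x, S.fiber b x = T.fiber b x) :
    S.degree = T.degree := by
  unfold degree
  rw [Subbundle.degree_eq_of_fiber_eq (h false), Subbundle.degree_eq_of_fiber_eq (h true)]

theorem degree_eq_zero_of_rank_eq_zero (h : S.rank = 0) : S.degree = 0 := by
  unfold rank at h
  unfold degree
  rw [Subbundle.degree_eq_zero_of_rank_eq_zero (by omega),
    Subbundle.degree_eq_zero_of_rank_eq_zero (by omega), add_zero]

/-- The inequality holds in each degree of the grading, so equality of the sums forces equality in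
both. -/
theorem degree_kernel (S : HiggsSubbundle M) (S' : HiggsSubbundle N) (hB : M.IsHiggsPairing N B) :
    S.degree + S'.degree ≤ (kernel S S' hB).degree + (kernel S' S hB.flip).degree ∧
    ((∀ b x, ∀ v ∈ S.fiber b x, (∀ w ∈ S'.fiber b x, B b x v w = 0) →
        v ∈ (kernel S S' hB).fiber b x) ↔
      S.degree + S'.degree = (kernel S S' hB).degree + (kernel S' S hB.flip).degree) := by
  have h := fun b => Subbundle.degree_kernel (S.comp b) (S'.comp b) (hB.hol b)
  have hf := h false
  have ht := h true
  rw [Bool.forall_bool]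
  change S.degree + S'.degree ≤ _ ∧ ((∀ x, ∀ v ∈ (S.comp false).fiber x,
    (∀ w ∈ (S'.comp false).fiber x, B false x v w = 0) → _) ∧
    (∀ x, ∀ v ∈ (S.comp true).fiber x, (∀ w ∈ (S'.comp true).fiber x, B true x v w = 0) → _) ↔ _)
  erw [hf.2, ht.2]
  have h1 := hf.1
  have h2 := ht.1
  simp only [degree, kernel]
  refine ⟨by linarith, fun h => by linarith, fun h => ⟨by linarith, by linarith⟩⟩

theorem mem_kernel_iff_of_degree_eq
    (h : (kernel S S' hB).degree + (kernel S' S hB.flip).degree ≤ S.degree + S'.degree) {b : Bool}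
    {x : X} {v : (M.bdl b).Fiber x} : v ∈ (kernel S S' hB).fiber b x ↔
      v ∈ S.fiber b x ∧ ∀ w ∈ S'.fiber b x, B b x v w = 0 :=
  ⟨fun hv => ⟨kernel_le b x hv, fun _ hw => apply_eq_zero_of_mem_kernel hv hw⟩, fun hv =>
    (degree_kernel S S' hB).2.2 (le_antisymm (degree_kernel S S' hB).1 h) b x v hv.1 hv.2⟩

/-- The form has no kernel at any point, so the case of equality says that twice the degree is 0. -/
theorem degree_whole (M : SpHiggsBundle X p q) : (whole M).degree = 0 := by
  set hB := M.isHiggsPairing_form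
  have h1 : (kernel (whole M) (whole M) hB).rank = 0 :=
    rank_eq_zero_of_fiber _ (x := Classical.arbitrary X) fun b => by
      rw [eq_bot_iff]
      intro v hv
      exact (M.comp b).eq_zero_of_form_left fun _ => apply_eq_zero_of_mem_kernel hv trivial
  have h2 : (kernel (whole M) (whole M) hB.flip).rank = 0 :=
    rank_eq_zero_of_fiber _ (x := Classical.arbitrary X) fun b => by
      rw [eq_bot_iff]
      intro v hv
      exact (M.comp b).eq_zero_of_form_right fun _ =>
        apply_eq_zero_of_mem_kernel (hB := hB.flip) hv trivial
  have h3 := (degree_kernel (whole M) (whole M) hB).2.1 fun b x v _ hv => by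
    rw [(M.comp b).eq_zero_of_form_left fun w => hv w trivial]
    exact Submodule.zero_mem _
  rw [degree_eq_zero_of_rank_eq_zero h1, degree_eq_zero_of_rank_eq_zero h2] at h3
  linarith

theorem degree_neg (hM : M.IsStable) (hS : S.IsIsotropic) (hr : S.rank ≠ 0) : S.degree < 0 := by
  refine hM (S.comp false) (S.comp true) (hS false) (hS true) ?_ (S.higgs_mem true false)
    (S.higgs_mem false true)
  unfold rank at hr
  omega

/-- The degree of an invariant subbundle of a stable Higgs bundle is at most `0`, and the form is
nondegenerate on those of degree `0`. -/
theorem degree_nonpos (hM : M.IsStable) (S : HiggsSubbundle M) :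
    S.degree ≤ 0 ∧ (S.degree = 0 → S.IsNondegenerate) := by
  set R := kernel S S M.isHiggsPairing_form with hR
  set R' := kernel S S M.isHiggsPairing_form.flip with hR'
  -- By antisymmetry the left and right kernels both equal the radical, so deg S ≤ deg R. The
  -- radical is isotropic and invariant, so stability applies to it unless it is zero.
  have hRR' : ∀ b x, R'.fiber b x = R.fiber b x := by
    intro b x
    ext v
    constructor
    · rintro ⟨s, hs, rfl, h⟩
      refine ⟨s, hs, rfl, h.mono fun y hy => ⟨hy.1, fun w hw => ?_⟩⟩
      rw [(M.comp b).form_swap]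
      exact neg_eq_zero.2 (hy.2 w hw)
    · rintro ⟨s, hs, rfl, h⟩
      refine ⟨s, hs, rfl, h.mono fun y hy => ⟨hy.1, fun w hw => ?_⟩⟩
      exact ((M.comp b).form_swap y w (s y)).trans (neg_eq_zero.2 (hy.2 w hw))
  have hdeg := degree_kernel S S M.isHiggsPairing_form
  rw [degree_eq_of_fiber_eq hRR'] at hdeg
  have hiso : R.IsIsotropic := fun b x v hv w hw =>
    apply_eq_zero_of_mem_kernel hv (kernel_le b x hw)
  by_cases hr : R.rank = 0
  · have h0 := degree_eq_zero_of_rank_eq_zero hr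
    rw [h0] at hdeg
    refine ⟨by linarith, fun h b x v hv hvw => ?_⟩
    have := hdeg.2.2 (by linarith) b x v hv hvw
    change v ∈ R.fiber b x at this
    rw [R.fiber_eq_bot hr] at this
    simpa using this
  · have := degree_neg hM hiso hr
    exact ⟨by linarith, fun h => absurd h (by linarith)⟩

/-- The kernels of a pairing of stable Higgs bundles form a subbundle of degree `0`. -/
theorem exists_ker_pairing (hM : M.IsStable) (hN : N.IsStable)
    {B : ∀ b x, (M.bdl b).Fiber x →ₗ[ℂ] (N.bdl b).Fiber x →ₗ[ℂ] ℂ} (hB : M.IsHiggsPairing N B) :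
    ∃ K : HiggsSubbundle M, (∀ b x, K.fiber b x = LinearMap.ker (B b x)) ∧ K.degree = 0 := by
  set K := kernel (whole M) (whole N) hB with hK
  set K' := kernel (whole N) (whole M) hB.flip with hK'
  -- Both kernels have degree ≤ 0 by stability, and their sum is ≥ 0 because M and N have degree 0.
  -- So equality holds, and the saturated kernel is the pointwise one.
  have h1 := degree_kernel (whole M) (whole N) hB
  have h2 := (degree_nonpos hM K).1
  have h3 := (degree_nonpos hN K').1
  rw [degree_whole, degree_whole] at h1
  refine ⟨K, fun b x => ?_, by linarith [h1.1]⟩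
  ext v
  rw [hK, mem_kernel_iff_of_degree_eq (by rw [degree_whole, degree_whole]; linarith)]
  exact ⟨fun h => LinearMap.ext fun w => h.2 w trivial, fun h =>
    ⟨trivial, fun w _ => LinearMap.congr_fun h w⟩⟩

/-- The kernels of a homomorphism of stable Higgs bundles form a subbundle of degree `0`. -/
theorem exists_ker (hM : M.IsStable) (hN : N.IsStable)
    {a : ∀ b x, (M.bdl b).Fiber x →ₗ[ℂ] (N.bdl b).Fiber x} (ha : M.IsHiggsHom N a) :
    ∃ K : HiggsSubbundle M, (∀ b x, K.fiber b x = LinearMap.ker (a b x)) ∧ K.degree = 0 := by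
  obtain ⟨K, hK, hd⟩ := exists_ker_pairing hM hN ha.pairing
  refine ⟨K, fun b x => ?_, hd⟩
  ext v
  rw [hK, LinearMap.mem_ker, LinearMap.mem_ker]
  exact ⟨fun h => (N.comp b).eq_zero_of_form_left (LinearMap.congr_fun h), fun h => by simp [h]⟩

end Connected

end HiggsSubbundle

end SpHiggsBundle

/-! ### Holomorphic homomorphisms and frames -/

namespace HolomorphicVectorBundle

variable {X : Type*} [TopologicalSpace X] [ChartedSpace ℂ X] [IsManifold 𝓘(ℂ) ω X] {n n' : ℕ}
  {E : HolomorphicVectorBundle X n} {E' : HolomorphicVectorBundle X n'}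

theorem isHolHom_of_frame {g : ∀ x, E.Fiber x →ₗ[ℂ] E'.Fiber x}
    (h : ∀ x, ∃ (ι : Type) (_ : Fintype ι) (s : ι → ∀ y, E.Fiber y), (∀ i, E.HolAt (s i) x) ∧
      LinearIndependent ℂ (fun i => s i x) ∧ Fintype.card ι = n ∧
      ∀ i, E'.HolAt (fun y => g y (s i y)) x) : E.IsHolHom E' g := by
  intro x t ht
  obtain ⟨ι, _, s, hs, hli, hcard, hg⟩ := h x
  obtain ⟨c, hc, hce⟩ := exists_coeff hs hli ht (mem_nhdsWithin_of_mem_nhds (by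
    filter_upwards [eventually_linearIndependent hs hli] with y hy
    show _ ∈ _
    rw [Submodule.eq_top_of_finrank_eq (S := Submodule.span ℂ (Set.range fun i => s i y))
      (by rw [finrank_span_eq_card hy, E.finrank_fiber, hcard])]
    trivial))
  refine HolAt.congr (HolAt.sum fun i (_ : i ∈ Finset.univ) => HolAt.smul (hc i) (hg i)) ?_
  filter_upwards [hce] with y hy
  rw [hy]
  simp

/-- The inverse of a homomorphism that maps a subbundle isomorphically is holomorphic. -/
theorem IsHolHom.of_rightInverse {f : ∀ x, E.Fiber x →ₗ[ℂ] E'.Fiber x} (hf : E.IsHolHom E' f)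
    {S : E.Subbundle} (hrank : S.rank = n') (hinj : ∀ x, ∀ v ∈ S.fiber x, f x v = 0 → v = 0)
    {g : ∀ x, E'.Fiber x →ₗ[ℂ] E.Fiber x} (hg : ∀ x, ∀ v ∈ S.fiber x, g x (f x v) = v) :
    E'.IsHolHom E g := by
  refine isHolHom_of_frame fun x => ?_
  have hs := S.isFrameAt_frame x
  refine ⟨Fin S.rank, inferInstance, fun i y => f y (S.frame x i y), fun i => hf x _ (hs.1 i), ?_,
    by simp [hrank], fun i => (hs.1 i).congr ?_⟩
  · refine hs.linearIndependent.map_injOn (f x) fun v hv w hw hvw => ?_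
    rw [SetLike.mem_coe, hs.span_eq] at hv hw
    exact sub_eq_zero.1 (hinj x _ (Submodule.sub_mem _ hv hw) (by rw [map_sub, hvw, sub_self]))
  · filter_upwards [hs.2] with y hy
    exact hg y _ (hy.2 ▸ Submodule.subset_span ⟨i, rfl⟩)

theorem isHolHom_projection {S T : E.Subbundle} (hST : ∀ x, IsCompl (S.fiber x) (T.fiber x)) :
    E.IsHolHom E fun x => (S.fiber x).projection (T.fiber x) (hST x) := by
  refine isHolHom_of_frame fun x => ?_
  have hs := S.isFrameAt_frame x
  have ht := T.isFrameAt_frame x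
  refine ⟨Fin S.rank ⊕ Fin T.rank, inferInstance, Sum.elim (S.frame x) (T.frame x), ?_, ?_, ?_, ?_⟩
  · rintro (i | i)
    exacts [hs.1 i, ht.1 i]
  · have : (fun i => Sum.elim (S.frame x) (T.frame x) i x) =
        Sum.elim (fun i => S.frame x i x) (fun i => T.frame x i x) := by
      funext i; rcases i with i | i <;> rfl
    rw [this]
    refine hs.linearIndependent.sum_type ht.linearIndependent ?_
    rw [hs.span_eq, ht.span_eq]
    exact (hST x).disjoint
  · rw [Fintype.card_sum, Fintype.card_fin, Fintype.card_fin, ← S.finrank_fiber x,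
      ← T.finrank_fiber x, Submodule.finrank_add_eq_of_isCompl (hST x), E.finrank_fiber]
  · rintro (i | i)
    · refine (hs.1 i).congr ?_
      filter_upwards [hs.2] with y hy
      exact Submodule.projection_apply_of_mem_left (hST y) (hy.2 ▸ Submodule.subset_span ⟨i, rfl⟩)
    · refine (holAt_zero x).congr ?_
      filter_upwards [ht.2] with y hy
      exact (Submodule.projection_apply_eq_zero_iff (hST y)).2
        (hy.2 ▸ Submodule.subset_span ⟨i, rfl⟩)

end HolomorphicVectorBundle

/-- A nonzero a has an eigenvector in its range. A nonzero eigenvalue is excluded by `h1`, and the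
eigenvalue 0 by `h2`, which says that range and kernel meet trivially. -/
theorem LinearMap.eq_zero_of_forall_eigenvalue {V : Type*} [AddCommGroup V] [Module ℂ V]
    [FiniteDimensional ℂ V] {a : V →ₗ[ℂ] V} (h1 : ∀ μ : ℂ, μ ≠ 0 → ∀ v, a v = μ • v → v = 0)
    (h2 : ∀ v, a (a v) = 0 → a v = 0) : a = 0 := by
  by_contra ha
  have : Nontrivial (LinearMap.range a) := by
    rw [Submodule.nontrivial_iff_ne_bot]
    rwa [Ne, LinearMap.range_eq_bot]
  have hr : ∀ v ∈ LinearMap.range a, a v ∈ LinearMap.range a := fun v _ => ⟨v, rfl⟩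
  obtain ⟨μ, hμ⟩ := Module.End.exists_eigenvalue (a.restrict hr)
  obtain ⟨⟨v, u, hu⟩, hv⟩ := hμ.exists_hasEigenvector
  have hv1 : a v = μ • v := congrArg Subtype.val hv.apply_eq_smul
  have hv0 : v ≠ 0 := fun h => hv.2 (Subtype.ext h)
  by_cases hμ0 : μ = 0
  · rw [hμ0, zero_smul, ← hu] at hv1
    exact hv0 (hu ▸ h2 u hv1)
  · exact hv0 (h1 μ hμ0 v hv1)

/-! ### Isomorphisms and endomorphisms of Higgs bundles -/

namespace SpHiggsBundle

open HolomorphicVectorBundle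

variable {X : Type*} [TopologicalSpace X] [ChartedSpace ℂ X] [IsManifold 𝓘(ℂ) ω X]
  {p q p' q' : ℕ} {M : SpHiggsBundle X p q} {N : SpHiggsBundle X p' q'}

theorem exists_nontrivial (M : SpHiggsBundle X p q) (hpq : p ≠ 0 ∨ q ≠ 0) (x : X) :
    ∃ b, Nontrivial ((M.bdl b).Fiber x) := by
  have key : ∀ b : Bool, (bif b then q else p) ≠ 0 → Nontrivial ((M.bdl b).Fiber x) := by
    intro b hb
    refine Module.nontrivial_of_finrank_pos (R := ℂ) ?_
    rw [(M.bdl b).finrank_fiber]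
    omega
  rcases hpq with h | h
  exacts [⟨false, key false h⟩, ⟨true, key true h⟩]

/-- An isomorphism of Higgs bundles that preserves the symplectic forms. -/
structure IsHiggsIso (M : SpHiggsBundle X p q) (N : SpHiggsBundle X p' q')
    (φ : ∀ b x, (M.bdl b).Fiber x ≃ₗ[ℂ] (N.bdl b).Fiber x) : Prop where
  isHiggsHom : M.IsHiggsHom N fun b x => (φ b x).toLinearMap
  hol_symm : ∀ b, (N.bdl b).IsHolHom (M.bdl b) fun x => (φ b x).symm.toLinearMap
  form : ∀ b x v w, (N.comp b).form x (φ b x v) (φ b x w) = (M.comp b).form x v w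

theorem IsHiggsIso.isHiggsHom_symm {φ : ∀ b x, (M.bdl b).Fiber x ≃ₗ[ℂ] (N.bdl b).Fiber x}
    (hφ : M.IsHiggsIso N φ) : N.IsHiggsHom M fun b x => (φ b x).symm.toLinearMap :=
  ⟨hφ.hol_symm, fun b c x ξ v => (LinearEquiv.symm_apply_eq _).2 (by
    have := hφ.isHiggsHom.comm b c x ξ ((φ b x).symm v)
    simpa using this.symm)⟩

/-- The family of isomorphisms with the given components. -/
def ofPair (f : ∀ x, M.V.Fiber x ≃ₗ[ℂ] N.V.Fiber x) (g : ∀ x, M.W.Fiber x ≃ₗ[ℂ] N.W.Fiber x) :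
    ∀ b x, (M.bdl b).Fiber x ≃ₗ[ℂ] (N.bdl b).Fiber x
  | false => f
  | true => g

theorem exists_ofPair (φ : ∀ b x, (M.bdl b).Fiber x ≃ₗ[ℂ] (N.bdl b).Fiber x) :
    ofPair (φ false) (φ true) = φ := by
  funext b
  cases b <;> rfl

/-- γ is minus the adjoint of β, so compatibility with γ follows from that with β by testing against
vectors of the odd part, all of which are in the image of a. -/
theorem IsHiggsHom.of_even {a : ∀ b x, (M.bdl b).Fiber x →ₗ[ℂ] (N.bdl b).Fiber x}
    (hol : ∀ b, (M.bdl b).IsHolHom (N.bdl b) (a b))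
    (hsurj : ∀ x, Function.Surjective (a true x))
    (form : ∀ b x v w, (N.comp b).form x (a b x v) (a b x w) = (M.comp b).form x v w)
    (hβ : ∀ x ξ w, a false x (M.β.toFun x ξ w) = N.β.toFun x ξ (a true x w)) :
    M.IsHiggsHom N a := by
  have hβ' : ∀ x ξ w, a false x (M.higgs true false x ξ w) =
    N.higgs true false x ξ (a true x w) := hβ
  refine ⟨hol, fun b c x ξ v => ?_⟩
  cases b <;> cases c
  · simp [higgs]
  · refine sub_eq_zero.1 ((N.comp true).eq_zero_of_form_left fun w => ?_)
    obtain ⟨w, rfl⟩ := hsurj x w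
    rw [map_sub, LinearMap.sub_apply, form, N.higgs_skew, M.higgs_skew, ← hβ', form, sub_self]
  · exact hβ x ξ v
  · simp [higgs]

theorem isHiggsIso_ofPair_iff {f : ∀ x, M.V.Fiber x ≃ₗ[ℂ] N.V.Fiber x}
    {g : ∀ x, M.W.Fiber x ≃ₗ[ℂ] N.W.Fiber x} :
    M.IsHiggsIso N (ofPair f g) ↔ IsSymplecticIso f ∧ IsSymplecticIso g ∧
      ∀ x ξ w, N.β.toFun x ξ (g x w) = f x (M.β.toFun x ξ w) := by
  constructor
  · rintro ⟨h1, h2, h3⟩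
    have key : ∀ b, IsSymplecticIso (V := M.comp b) (V' := N.comp b) (ofPair f g b) := fun b =>
      ⟨fun U s hU => ⟨fun h => by simpa using (h2 b).isHolSection hU h,
        fun h => (h1.hol b).isHolSection hU h⟩, h3 b⟩
    exact ⟨key false, key true, fun x ξ w => (h1.comm true false x ξ w).symm⟩
  · rintro ⟨h1, h2, h3⟩
    have key : ∀ b, IsSymplecticIso (V := M.comp b) (V' := N.comp b) (ofPair f g b) := fun b => by
      cases b
      exacts [h1, h2]
    refine ⟨?_, fun b => isHolHom_of_isHolSection fun U s hU hs => ?_, fun b => (key b).2⟩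
    · refine IsHiggsHom.of_even (fun b => isHolHom_of_isHolSection fun U s hU hs => ?_)
        (fun x => (ofPair f g true x).surjective) (fun b => (key b).2) fun x ξ w => (h3 x ξ w).symm
      exact ((key b).1 U s hU).2 hs
    · exact ((key b).1 U _ hU).1 (by simpa using hs)

theorem isomorphic_iff : M.Isomorphic N ↔ ∃ φ, M.IsHiggsIso N φ := by
  constructor
  · rintro ⟨f, g, h⟩
    exact ⟨ofPair f g, isHiggsIso_ofPair_iff.2 h⟩
  · rintro ⟨φ, h⟩
    rw [← exists_ofPair φ] at h
    exact ⟨φ false, φ true, isHiggsIso_ofPair_iff.1 h⟩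

theorem mem_Aut_iff {a : (∀ x, M.V.Fiber x ≃ₗ[ℂ] M.V.Fiber x) ×
    (∀ x, M.W.Fiber x ≃ₗ[ℂ] M.W.Fiber x)} : a ∈ M.Aut ↔ M.IsHiggsIso M (ofPair a.1 a.2) := by
  rw [isHiggsIso_ofPair_iff]
  exact and_congr Iff.rfl (and_congr Iff.rfl (forall₃_congr fun x ξ w => eq_comm))

theorem ofPair_mem_Aut {φ : ∀ b x, (M.bdl b).Fiber x ≃ₗ[ℂ] (M.bdl b).Fiber x}
    (h : M.IsHiggsIso M φ) : ((φ false, φ true) : (∀ x, M.V.Fiber x ≃ₗ[ℂ] M.V.Fiber x) ×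
      (∀ x, M.W.Fiber x ≃ₗ[ℂ] M.W.Fiber x)) ∈ M.Aut := by
  rw [mem_Aut_iff]
  exact (exists_ofPair φ).symm ▸ h

/-- A holomorphic self-adjoint idempotent that commutes with the Higgs field. -/
structure IsOrthProj (M : SpHiggsBundle X p q)
    (e : ∀ b x, (M.bdl b).Fiber x →ₗ[ℂ] (M.bdl b).Fiber x) : Prop where
  isHiggsHom : M.IsHiggsHom M e
  idem : ∀ b x v, e b x (e b x v) = e b x v
  form : ∀ b x v w, (M.comp b).form x (e b x v) w = (M.comp b).form x v (e b x w)

/-- The reflection `1 - 2e`. -/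
noncomputable def IsOrthProj.reflection {e : ∀ b x, (M.bdl b).Fiber x →ₗ[ℂ] (M.bdl b).Fiber x}
    (he : M.IsOrthProj e) (b : Bool) (x : X) : (M.bdl b).Fiber x ≃ₗ[ℂ] (M.bdl b).Fiber x :=
  LinearEquiv.ofInvolutive (LinearMap.id - (2 : ℂ) • e b x) fun v => by
    simp only [LinearMap.sub_apply, LinearMap.id_apply, LinearMap.smul_apply, map_sub, map_smul,
      he.idem]
    module

theorem IsOrthProj.reflection_apply {e : ∀ b x, (M.bdl b).Fiber x →ₗ[ℂ] (M.bdl b).Fiber x}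
    (he : M.IsOrthProj e) (b : Bool) (x : X) (v : (M.bdl b).Fiber x) :
    he.reflection b x v = v - (2 : ℂ) • e b x v := rfl

theorem IsOrthProj.isHiggsIso_reflection
    {e : ∀ b x, (M.bdl b).Fiber x →ₗ[ℂ] (M.bdl b).Fiber x} (he : M.IsOrthProj e) :
    M.IsHiggsIso M he.reflection := by
  have h := (IsHiggsHom.id M).sub (he.isHiggsHom.smul 2)
  refine ⟨h, h.hol, fun b x v w => ?_⟩
  simp only [he.reflection_apply, map_sub, map_smul, LinearMap.sub_apply, LinearMap.smul_apply,
    smul_eq_mul, he.form, he.idem]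
  ring

/-! ### Orthogonal projections and endomorphisms of stable Higgs bundles -/

section Connected

variable [ConnectedSpace X]

namespace HiggsSubbundle

/-- T meets its orthogonal complement trivially. Nothing nonzero in T is orthogonal to all of M, so
`rank_kernel` shows that the two ranks add up to the rank of M. -/
theorem isCompl_of_isNondegenerate {T : HiggsSubbundle M} (hT : T.IsNondegenerate) (b : Bool)
    (x : X) : IsCompl (T.fiber b x) ((kernel (whole M) T M.isHiggsPairing_form).fiber b x) := by
  have hrank := Subbundle.rank_kernel (Subbundle.whole (M.bdl b)) (T.comp b)
    (M.isHiggsPairing_form.hol b)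
  have h0 : (Subbundle.kernel (T.comp b) (Subbundle.whole (M.bdl b))
      (M.isHiggsPairing_form.hol b).flip).rank = 0 := by
    refine Subbundle.fiber_eq_bot_iff (x := x).1 (eq_bot_iff.2 fun v hv => ?_)
    exact (M.comp b).eq_zero_of_form_right fun w =>
      Subbundle.apply_eq_zero_of_mem_kernel (hb := (M.isHiggsPairing_form.hol b).flip) hv
        (w := w) trivial
  rw [h0, Subbundle.rank_whole] at hrank
  refine (Submodule.isCompl_iff_disjoint _ _ ?_).2 (disjoint_iff.2 (eq_bot_iff.2 ?_))
  · rw [(M.bdl b).finrank_fiber, fiber, fiber, Subbundle.finrank_fiber, Subbundle.finrank_fiber]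
    exact hrank.le
  · rintro v ⟨hv, hv'⟩
    exact hT b x v hv fun w hw => apply_eq_zero_of_mem_kernel hv' hw

theorem exists_isOrthProj {T : HiggsSubbundle M} (hT : T.IsNondegenerate) :
    ∃ e, M.IsOrthProj e ∧ ∀ b x, LinearMap.range (e b x) = T.fiber b x := by
  set T' := kernel (whole M) T M.isHiggsPairing_form with hT'
  have hc := isCompl_of_isNondegenerate hT
  set e := fun b x => (T.fiber b x).projection (T'.fiber b x) (hc b x) with he
  have heq : ∀ b x v, ∃ t ∈ T.fiber b x, ∃ t' ∈ T'.fiber b x, v = t + t' ∧ e b x v = t := by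
    intro b x v
    refine ⟨e b x v, Submodule.projection_apply_mem _ _, v - e b x v,
      Submodule.sub_projection_mem _ _, by abel, rfl⟩
  have hl : ∀ b x, ∀ t ∈ T.fiber b x, e b x t = t := fun b x t ht =>
    Submodule.projection_apply_of_mem_left (hc b x) ht
  have hr : ∀ b x, ∀ t ∈ T'.fiber b x, e b x t = 0 := fun b x t ht =>
    (Submodule.projection_apply_eq_zero_iff (hc b x)).2 ht
  have horth : ∀ b x, ∀ t ∈ T.fiber b x, ∀ t' ∈ T'.fiber b x, (M.comp b).form x t t' = 0 :=
    fun b x t ht t' ht' => by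
      rw [(M.comp b).form_swap, apply_eq_zero_of_mem_kernel ht' ht, neg_zero]
  refine ⟨e, ⟨⟨fun b => isHolHom_projection (hc b), fun b c x ξ v => ?_⟩, fun b x v => ?_,
    fun b x v w => ?_⟩, fun b x => Submodule.range_projection _⟩
  · obtain ⟨t, ht, t', ht', rfl, h⟩ := heq b x v
    rw [h, map_add, map_add, hl c x _ (T.higgs_mem b c x ξ t ht),
      hr c x _ (T'.higgs_mem b c x ξ t' ht'), add_zero]
  · exact hl b x _ (Submodule.projection_apply_mem _ _)
  · obtain ⟨t, ht, t', ht', rfl, h⟩ := heq b x v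
    obtain ⟨u, hu, u', hu', rfl, h'⟩ := heq b x w
    rw [h, h', map_add, map_add, LinearMap.add_apply, horth b x t ht u' hu',
      apply_eq_zero_of_mem_kernel ht' hu]

end HiggsSubbundle

variable [CompactSpace X] [T2Space X]

open HiggsSubbundle in
/-- A skew-adjoint endomorphism of a stable Higgs bundle is zero. -/
theorem IsStable.eq_zero_of_skew (hM : M.IsStable)
    {a : ∀ b x, (M.bdl b).Fiber x →ₗ[ℂ] (M.bdl b).Fiber x} (ha : M.IsHiggsHom M a)
    (hskew : ∀ b x v w, (M.comp b).form x (a b x v) w = -(M.comp b).form x v (a b x w))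
    (b : Bool) (x : X) : a b x = 0 := by
  refine LinearMap.eq_zero_of_forall_eigenvalue (fun μ hμ v hv => ?_) fun v hv => ?_
  -- On the eigenbundle for μ ≠ 0 skewness reads μΩ(v, w) = −μΩ(v, w), so it is isotropic. Having
  -- degree 0, it also carries a nondegenerate form, hence it is zero.
  · obtain ⟨K, hK, hdeg⟩ := exists_ker hM hM (ha.sub ((IsHiggsHom.id M).smul μ))
    have hmem : ∀ w, w ∈ K.fiber b x ↔ a b x w = μ • w := fun w => by
      rw [hK, LinearMap.mem_ker, LinearMap.sub_apply, LinearMap.smul_apply, LinearMap.id_apply,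
        sub_eq_zero]
    refine (degree_nonpos hM K).2 hdeg b x v ((hmem v).2 hv) fun w hw => ?_
    have h1 := hskew b x v w
    rw [hv, (hmem w).1 hw, map_smul, map_smul, LinearMap.smul_apply, smul_eq_mul, ← mul_neg,
      mul_right_inj' hμ] at h1
    exact self_eq_neg.1 h1
  · obtain ⟨K, hK, hdeg⟩ := exists_ker hM hM ha
    -- The image of `a` is orthogonal to its kernel, on which the form is nondegenerate, so the two
    -- meet trivially.
    refine (degree_nonpos hM K).2 hdeg b x (a b x v) (by rwa [hK, LinearMap.mem_ker]) fun w hw => ?_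
    rw [hK, LinearMap.mem_ker] at hw
    rw [hskew, hw, map_zero, neg_zero]

/-- The adjoint of φ is φ⁻¹, so φ − φ⁻¹ is skew-adjoint and hence zero. -/
theorem IsStable.apply_apply_of_isHiggsIso (hM : M.IsStable)
    {φ : ∀ b x, (M.bdl b).Fiber x ≃ₗ[ℂ] (M.bdl b).Fiber x} (hφ : M.IsHiggsIso M φ) (b : Bool)
    (x : X) (v : (M.bdl b).Fiber x) : φ b x (φ b x v) = v := by
  have hsymm := hφ.isHiggsHom_symm
  have hadj : ∀ b x v w, (M.comp b).form x (φ b x v) w =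
      (M.comp b).form x v ((φ b x).symm w) := fun b x v w => by
    rw [← hφ.form b x v, LinearEquiv.apply_symm_apply]
  have hadj' : ∀ b x v w, (M.comp b).form x ((φ b x).symm v) w =
      (M.comp b).form x v (φ b x w) := fun b x v w => by
    rw [← hφ.form b x _ w, LinearEquiv.apply_symm_apply]
  have h := hM.eq_zero_of_skew (hφ.isHiggsHom.sub hsymm) (fun b x v w => by
    simp only [LinearMap.sub_apply, LinearEquiv.coe_coe, map_sub, hadj, hadj']
    ring) b x
  have h1 := LinearMap.congr_fun h (φ b x v)
  simp only [LinearMap.sub_apply, LinearEquiv.coe_coe, LinearEquiv.symm_apply_apply,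
    LinearMap.zero_apply] at h1
  exact sub_eq_zero.1 h1

theorem IsSimple.eq_or_eq (hM : M.IsSimple)
    {φ : ∀ b x, (M.bdl b).Fiber x ≃ₗ[ℂ] (M.bdl b).Fiber x} (hφ : M.IsHiggsIso M φ) :
    (∀ b x v, φ b x v = v) ∨ ∀ b x v, φ b x v = -v := by
  rcases (hM _).1 (ofPair_mem_Aut hφ) with h | h
  · left
    intro b x v
    cases b
    · exact LinearEquiv.congr_fun (congrFun (congrArg Prod.fst h) x) v
    · exact LinearEquiv.congr_fun (congrFun (congrArg Prod.snd h) x) v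
  · right
    intro b x v
    cases b
    · exact LinearEquiv.congr_fun (congrFun (congrArg Prod.fst h) x) v
    · exact LinearEquiv.congr_fun (congrFun (congrArg Prod.snd h) x) v

/-- The reflection 1 − 2e is an automorphism, so it is 1 or −1. -/
theorem IsSimple.isOrthProj (hM : M.IsSimple)
    {e : ∀ b x, (M.bdl b).Fiber x →ₗ[ℂ] (M.bdl b).Fiber x} (he : M.IsOrthProj e) :
    (∀ b x v, e b x v = 0) ∨ ∀ b x v, e b x v = v := by
  rcases hM.eq_or_eq he.isHiggsIso_reflection with h | h
  · left
    intro b x v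
    have := h b x v
    rw [he.reflection_apply, sub_eq_self] at this
    exact (smul_eq_zero.1 this).resolve_left two_ne_zero
  · right
    intro b x v
    have := h b x v
    rw [he.reflection_apply] at this
    refine smul_right_injective _ (two_ne_zero (α := ℂ)) ?_
    change (2 : ℂ) • e b x v = (2 : ℂ) • v
    rw [← sub_sub_cancel v ((2 : ℂ) • e b x v), this]
    module

/-- An invariant subbundle of degree `0` of a stable and simple Higgs bundle is trivial. -/
theorem IsSimple.rank_eq_zero_or (hM : M.IsStable) (hM' : M.IsSimple) {T : HiggsSubbundle M}
    (hT : T.degree = 0) : T.rank = 0 ∨ ∀ b x, T.fiber b x = ⊤ := by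
  obtain ⟨e, he, her⟩ := HiggsSubbundle.exists_isOrthProj
    ((HiggsSubbundle.degree_nonpos hM T).2 hT)
  rcases hM'.isOrthProj he with h | h
  · left
    refine T.rank_eq_zero_of_fiber (x := Classical.arbitrary X) fun b => ?_
    rw [← her, LinearMap.range_eq_bot]
    exact LinearMap.ext (h b _)
  · right
    intro b x
    rw [← her, LinearMap.range_eq_top]
    exact fun v => ⟨v, h b x v⟩

/-- A pairing of a stable and simple Higgs bundle with itself is a multiple of the symplectic
form. -/
theorem IsSimple.exists_eq_smul (hM : M.IsStable) (hM' : M.IsSimple) (hpq : p ≠ 0 ∨ q ≠ 0)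
    {B : ∀ b x, (M.bdl b).Fiber x →ₗ[ℂ] (M.bdl b).Fiber x →ₗ[ℂ] ℂ} (hB : M.IsHiggsPairing M B) :
    ∃ c : ℂ, ∀ b x v w, B b x v w = c * (M.comp b).form x v w := by
  have hx₀ : ∃ b, Nontrivial ((M.bdl b).Fiber (Classical.arbitrary X)) := M.exists_nontrivial hpq _
  obtain ⟨b₀, hb₀⟩ := hx₀
  set x₀ : X := Classical.arbitrary X
  -- At one point the form turns B into an endomorphism, which has an eigenvalue c. The kernel of B
  -- − cΩ is then a nonzero invariant subbundle of degree 0, hence everything.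
  set F : (M.bdl b₀).Fiber x₀ ≃ₗ[ℂ] Module.Dual ℂ ((M.bdl b₀).Fiber x₀) :=
    LinearMap.linearEquivOfInjective ((M.comp b₀).form x₀)
      ((injective_iff_map_eq_zero _).2 fun v hv =>
        (M.comp b₀).eq_zero_of_form_left (LinearMap.congr_fun hv))
      Subspace.dual_finrank_eq.symm with hF
  obtain ⟨c, hc⟩ := Module.End.exists_eigenvalue (F.symm.toLinearMap ∘ₗ B b₀ x₀)
  obtain ⟨v, hv⟩ := hc.exists_hasEigenvector
  obtain ⟨K, hK, hdeg⟩ :=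
    HiggsSubbundle.exists_ker_pairing hM hM (hB.sub (M.isHiggsPairing_form.smul c))
  have hv' : v ∈ K.fiber b₀ x₀ := by
    have h1 : F.symm (B b₀ x₀ v) = c • v := hv.apply_eq_smul
    rw [LinearEquiv.symm_apply_eq, map_smul] at h1
    rw [hK, LinearMap.mem_ker, LinearMap.sub_apply, h1]
    exact sub_self _
  refine ⟨c, fun b x w w' => ?_⟩
  rcases IsSimple.rank_eq_zero_or hM hM' hdeg with h | h
  · rw [K.fiber_eq_bot h] at hv'
    exact absurd hv' hv.2
  · have h1 : w ∈ K.fiber b x := h b x ▸ trivial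
    rw [hK, LinearMap.mem_ker] at h1
    exact sub_eq_zero.1 (LinearMap.congr_fun h1 w')

end Connected

end SpHiggsBundle

/-! ### Direct sums of Higgs bundles -/

theorem LinearMap.exists_inverse_on {V W : Type*} [AddCommGroup V] [Module ℂ V] [AddCommGroup W]
    [Module ℂ W] [FiniteDimensional ℂ V] [FiniteDimensional ℂ W] (f : V →ₗ[ℂ] W)
    (S : Submodule ℂ V) (hinj : ∀ v ∈ S, f v = 0 → v = 0)
    (hrank : Module.finrank ℂ S = Module.finrank ℂ W) :
    ∃ g : W →ₗ[ℂ] V, (∀ w, g w ∈ S) ∧ (∀ v ∈ S, g (f v) = v) ∧ ∀ w, f (g w) = w := by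
  set e := LinearMap.linearEquivOfInjective (f.domRestrict S)
    ((injective_iff_map_eq_zero _).2 fun v hv => Subtype.ext (hinj v v.2 hv)) hrank
  refine ⟨S.subtype ∘ₗ e.symm.toLinearMap, fun w => (e.symm w).2, fun v hv => ?_, fun w => ?_⟩
  · exact congrArg Subtype.val (e.symm_apply_apply ⟨v, hv⟩)
  · exact e.apply_symm_apply w

namespace SpHiggsBundle

open HolomorphicVectorBundle

variable {X : Type*} [TopologicalSpace X] [ChartedSpace ℂ X] [IsManifold 𝓘(ℂ) ω X]
  {p q : ℕ} {M : SpHiggsBundle X p q} {r : ℕ} {P Q : Fin r → ℕ}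
  {N : ∀ i, SpHiggsBundle X (P i) (Q i)}

/-- Inclusions and projections that exhibit `M` as the orthogonal direct sum of the `N i`. -/
structure IsHiggsSum (M : SpHiggsBundle X p q) (N : ∀ i, SpHiggsBundle X (P i) (Q i))
    (ι : ∀ i b x, ((N i).bdl b).Fiber x →ₗ[ℂ] (M.bdl b).Fiber x)
    (ϖ : ∀ i b x, (M.bdl b).Fiber x →ₗ[ℂ] ((N i).bdl b).Fiber x) : Prop where
  isHiggsHom_incl : ∀ i, (N i).IsHiggsHom M (ι i)
  isHiggsHom_proj : ∀ i, M.IsHiggsHom (N i) (ϖ i)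
  proj_incl : ∀ i b x v, ϖ i b x (ι i b x v) = v
  proj_incl_of_ne : ∀ i j, i ≠ j → ∀ b x v, ϖ i b x (ι j b x v) = 0
  sum_incl_proj : ∀ b x v, ∑ i, ι i b x (ϖ i b x v) = v
  form_incl : ∀ i b x v w, (M.comp b).form x (ι i b x v) w = ((N i).comp b).form x v (ϖ i b x w)

theorem IsDirectSum.exists_isHiggsSum (h : M.IsDirectSum N) : ∃ ι ϖ, M.IsHiggsSum N ι ϖ := by
  obtain ⟨f, g, hf, hg, hf', hg', hβ⟩ := h
  let φ : ∀ b x, (∀ i, ((N i).bdl b).Fiber x) ≃ₗ[ℂ] (M.bdl b).Fiber x := fun b => match b with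
    | false => f
    | true => g
  have hol : ∀ b (U : Set X) (s : ∀ x i, ((N i).bdl b).Fiber x), IsOpen U →
      ((M.bdl b).IsHolSection U (fun x => φ b x (s x)) ↔
        ∀ i, ((N i).bdl b).IsHolSection U (fun x => s x i)) := fun b => by
    cases b
    exacts [hf, hg]
  have form : ∀ b x v v', (M.comp b).form x (φ b x v) (φ b x v') =
      ∑ i, ((N i).comp b).form x (v i) (v' i) := fun b => by
    cases b
    exacts [hf', hg']
  have comm1 : ∀ x ξ v, M.higgs true false x ξ (φ true x v) =
      φ false x fun i => (N i).higgs true false x ξ (v i) := hβ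
  -- The direct sum prescribes only β; the statement for γ follows by skew-adjointness and
  -- nondegeneracy.
  have comm2 : ∀ x ξ v, M.higgs false true x ξ (φ false x v) =
      φ true x fun i => (N i).higgs false true x ξ (v i) := by
    intro x ξ v
    refine sub_eq_zero.1 ((M.comp true).eq_zero_of_form_left fun w => ?_)
    obtain ⟨w, rfl⟩ := (φ true x).surjective w
    rw [map_sub, LinearMap.sub_apply, M.higgs_skew, comm1, form, form, sub_eq_zero,
      ← Finset.sum_neg_distrib]
    exact Finset.sum_congr rfl fun i _ => ((N i).higgs_skew _ _ _ _ _ _).symm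
  have comm : ∀ b c x ξ v, M.higgs b c x ξ (φ b x v) =
      φ c x fun i => (N i).higgs b c x ξ (v i) := by
    intro b c x ξ v
    cases b <;> cases c
    · exact ((φ false x).map_zero).symm
    · exact comm2 x ξ v
    · exact comm1 x ξ v
    · exact ((φ true x).map_zero).symm
  refine ⟨fun i b x => (φ b x).toLinearMap ∘ₗ LinearMap.single ℂ (fun i => ((N i).bdl b).Fiber x) i,
    fun i b x => LinearMap.proj i ∘ₗ (φ b x).symm.toLinearMap, ⟨fun i => ⟨fun b => ?_, ?_⟩,
      fun i => ⟨fun b => ?_, ?_⟩, ?_, ?_, ?_, ?_⟩⟩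
  · refine isHolHom_of_isHolSection fun U s hU hs => (hol b U _ hU).2 fun j => ?_
    by_cases hij : j = i
    · subst hij
      simpa using hs
    · refine (isHolSection_iff hU).2 fun x _ => ?_
      simpa [Pi.single_eq_of_ne hij] using holAt_zero x
  · intro b c x ξ v
    simp only [LinearMap.comp_apply, LinearEquiv.coe_coe, comm, LinearMap.coe_single]
    congr 1
    funext j
    by_cases hij : j = i
    · subst hij
      simp
    · simp [Pi.single_eq_of_ne hij]
  · refine isHolHom_of_isHolSection fun U s hU hs => ?_
    exact (hol b U (fun x => (φ b x).symm (s x)) hU).1 (by simpa using hs) i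
  · intro b c x ξ v
    obtain ⟨v, rfl⟩ := (φ b x).surjective v
    simp [comm]
  · intro i b x v
    simp
  · intro i j hij b x v
    simp [Pi.single_eq_of_ne hij]
  · intro b x v
    simp only [LinearMap.comp_apply, LinearEquiv.coe_coe, LinearMap.coe_single, LinearMap.proj_apply]
    rw [← map_sum, Finset.univ_sum_single, LinearEquiv.apply_symm_apply]
  · intro i b x v w
    obtain ⟨w, rfl⟩ := (φ b x).surjective w
    simp only [LinearMap.comp_apply, LinearEquiv.coe_coe, LinearMap.coe_single, LinearMap.proj_apply,
      form, LinearEquiv.symm_apply_apply]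
    rw [Finset.sum_eq_single i]
    · simp
    · intro j _ hij
      simp [Pi.single_eq_of_ne hij]
    · simp

namespace IsHiggsSum

variable {ι : ∀ i b x, ((N i).bdl b).Fiber x →ₗ[ℂ] (M.bdl b).Fiber x}
  {ϖ : ∀ i b x, (M.bdl b).Fiber x →ₗ[ℂ] ((N i).bdl b).Fiber x}

theorem proj_sum_incl (h : M.IsHiggsSum N ι ϖ) (b : Bool) (x : X)
    (v : ∀ i, ((N i).bdl b).Fiber x) (i : Fin r) : ϖ i b x (∑ j, ι j b x (v j)) = v i := by
  rw [map_sum, Finset.sum_eq_single i, h.proj_incl]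
  · exact fun j _ hij => h.proj_incl_of_ne i j hij.symm b x _
  · simp

theorem form_eq_sum (h : M.IsHiggsSum N ι ϖ) (b : Bool) (x : X) (v w : (M.bdl b).Fiber x) :
    (M.comp b).form x v w = ∑ i, ((N i).comp b).form x (ϖ i b x v) (ϖ i b x w) := by
  conv_lhs => rw [← h.sum_incl_proj b x v]
  simp [h.form_incl]

theorem isDirectSum (h : M.IsHiggsSum N ι ϖ) : M.IsDirectSum N := by
  let φ : ∀ b x, (∀ i, ((N i).bdl b).Fiber x) ≃ₗ[ℂ] (M.bdl b).Fiber x := fun b x =>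
    LinearEquiv.ofLinearMap (∑ i, ι i b x ∘ₗ LinearMap.proj i) (LinearMap.pi fun i => ϖ i b x)
      (LinearMap.ext fun v => by simpa using h.sum_incl_proj b x v)
      (LinearMap.ext fun v => funext fun i => by simpa using h.proj_sum_incl b x v i)
  have hφ : ∀ b x v, φ b x v = ∑ i, ι i b x (v i) := fun b x v => by simp [φ]
  have hol : ∀ b (U : Set X) (s : ∀ x i, ((N i).bdl b).Fiber x), IsOpen U →
      ((M.bdl b).IsHolSection U (fun x => φ b x (s x)) ↔
        ∀ i, ((N i).bdl b).IsHolSection U (fun x => s x i)) := by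
    intro b U s hU
    simp only [hφ]
    refine ⟨fun hs i => ?_, fun hs => (isHolSection_iff hU).2 fun x hx =>
      HolAt.sum fun i _ => (h.isHiggsHom_incl i).hol b x _ ((isHolSection_iff hU).1 (hs i) x hx)⟩
    simpa [h.proj_sum_incl] using ((h.isHiggsHom_proj i).hol b).isHolSection hU hs
  have form : ∀ b x v v', (M.comp b).form x (φ b x v) (φ b x v') =
      ∑ i, ((N i).comp b).form x (v i) (v' i) := fun b x v v' => by
    simp only [hφ, h.form_eq_sum, h.proj_sum_incl]
  have comm : ∀ x ξ w, M.higgs true false x ξ (φ true x w) =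
      φ false x fun i => (N i).higgs true false x ξ (w i) := by
    intro x ξ w
    rw [hφ, hφ, map_sum]
    exact Finset.sum_congr rfl fun i _ => ((h.isHiggsHom_incl i).comm true false x ξ (w i)).symm
  exact ⟨φ false, φ true, hol false, hol true, form false, form true, comm⟩

/-- The orthogonal projection onto a summand. -/
theorem isOrthProj (h : M.IsHiggsSum N ι ϖ) (i : Fin r) :
    M.IsOrthProj fun b x => ι i b x ∘ₗ ϖ i b x :=
  ⟨(h.isHiggsHom_incl i).comp (h.isHiggsHom_proj i), fun b x v => by simp [h.proj_incl],
    fun b x v w => by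
      simp only [LinearMap.comp_apply]
      rw [h.form_incl, (M.comp b).form_swap x v, h.form_incl, ((N i).comp b).form_swap]⟩

variable [ConnectedSpace X] [CompactSpace X] [T2Space X]

open HiggsSubbundle

/-- The projection to one summand is not 0, since that summand is nonzero, and not 1, since there is
another nonzero summand. -/
theorem not_isSimple (h : M.IsHiggsSum N ι ϖ) (hr : 1 < r) (hPQ : ∀ i, P i ≠ 0 ∨ Q i ≠ 0) :
    ¬ M.IsSimple := by
  intro hM
  let i : Fin r := ⟨0, by omega⟩
  let j : Fin r := ⟨1, hr⟩
  have hij : i ≠ j := by simp [i, j]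
  let x : X := Classical.arbitrary X
  rcases hM.isOrthProj (h.isOrthProj i) with h0 | h1
  · obtain ⟨b, hb⟩ := (N i).exists_nontrivial (hPQ i) x
    obtain ⟨v, hv⟩ := exists_ne (0 : ((N i).bdl b).Fiber x)
    have := congrArg (ϖ i b x) (h0 b x (ι i b x v))
    simp only [LinearMap.comp_apply, h.proj_incl, map_zero] at this
    exact hv this
  · obtain ⟨b, hb⟩ := (N j).exists_nontrivial (hPQ j) x
    obtain ⟨v, hv⟩ := exists_ne (0 : ((N j).bdl b).Fiber x)
    have := congrArg (ϖ j b x) (h1 b x (ι j b x v))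
    simp only [LinearMap.comp_apply, h.proj_incl, h.proj_incl_of_ne i j hij, map_zero] at this
    exact hv this.symm

end IsHiggsSum

/-! ### Homomorphisms to stable and simple Higgs bundles -/

section Connected

variable [ConnectedSpace X] [CompactSpace X] [T2Space X] {p' q' : ℕ} {N : SpHiggsBundle X p' q'}

open HiggsSubbundle

/-- A homomorphism to a stable and simple Higgs bundle that is invertible on an invariant
subbundle has an inverse there. -/
theorem IsHiggsHom.exists_inverse_on {a : ∀ b x, (M.bdl b).Fiber x →ₗ[ℂ] (N.bdl b).Fiber x}
    (ha : M.IsHiggsHom N a) (S : HiggsSubbundle M)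
    (hinj : ∀ b x, ∀ v ∈ S.fiber b x, a b x v = 0 → v = 0)
    (hrank : ∀ b, (S.comp b).rank = 2 * bif b then q' else p') :
    ∃ g, N.IsHiggsHom M g ∧ (∀ b x w, g b x w ∈ S.fiber b x) ∧
      (∀ b x, ∀ v ∈ S.fiber b x, g b x (a b x v) = v) ∧ ∀ b x w, a b x (g b x w) = w := by
  choose g hgS hga hag using fun b x => LinearMap.exists_inverse_on (a b x) (S.fiber b x)
    (hinj b x) (by rw [(N.bdl b).finrank_fiber, ← hrank b]; exact (S.comp b).finrank_fiber x)
  refine ⟨g, ⟨fun b => (ha.hol b).of_rightInverse (hrank b) (hinj b) (hga b), fun b c x ξ w => ?_⟩,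
    hgS, hga, hag⟩
  have h1 := S.higgs_mem b c x ξ _ (hgS b x w)
  rw [← hga c x _ h1, ha.comm, hag]

/-- An isotropic subbundle of nonnegative degree whose proper isotropic subbundles have negative
degree maps to a stable and simple Higgs bundle either trivially or isomorphically. -/
theorem IsHiggsHom.eq_zero_or_injective {a : ∀ b x, (M.bdl b).Fiber x →ₗ[ℂ] (N.bdl b).Fiber x}
    (ha : M.IsHiggsHom N a) (hN : N.IsStable) (hN' : N.IsSimple) (S : HiggsSubbundle M)
    (hdeg : 0 ≤ S.degree)
    (hmin : ∀ K : HiggsSubbundle M, (∀ b x, K.fiber b x ≤ S.fiber b x) → K.rank < S.rank →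
      K.rank ≠ 0 → K.degree < 0) :
    (∀ b x, ∀ v ∈ S.fiber b x, a b x v = 0) ∨
      ((∀ b x, ∀ v ∈ S.fiber b x, a b x v = 0 → v = 0) ∧
        ∀ b, (S.comp b).rank = 2 * bif b then q' else p') := by
  have hB := ha.pairing
  set K := kernel S (whole N) hB with hK
  set K' := kernel (whole N) S hB.flip with hK'
  -- This reads deg S ≤ deg K + deg K′ with deg K′ ≤ 0 ≤ deg S. A proper nonzero K has negative
  -- degree by hypothesis, which is impossible. Either K = S and `a` vanishes on S, or K = 0 and deg
  -- K′ = 0; then K′ is 0 or all of N by simplicity.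
  have h1 := degree_kernel S (whole N) hB
  have h2 := (degree_nonpos hN K').1
  rw [degree_whole] at h1
  have hKS : K.rank ≤ S.rank := rank_le_of_le (x := Classical.arbitrary X) fun b => kernel_le b _
  have hKa : ∀ b x, ∀ v ∈ K.fiber b x, a b x v = 0 := fun b x v hv =>
    (N.comp b).eq_zero_of_form_left fun w => apply_eq_zero_of_mem_kernel hv trivial
  rcases hKS.eq_or_lt with hlt | hlt
  · left
    intro b x v hv
    rw [← fiber_eq_of_le_of_rank_eq (S := K) (fun b x => kernel_le b x) hlt] at hv
    exact hKa b x v hv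
  · have hK0 : K.rank = 0 := by
      by_contra h0
      have := hmin K (fun b x => kernel_le b x) hlt h0
      linarith [h1.1]
    rw [degree_eq_zero_of_rank_eq_zero hK0] at h1
    have hK'0 : K'.degree = 0 := by linarith [h1.1]
    have hinj : ∀ b x, ∀ v ∈ S.fiber b x, a b x v = 0 → v = 0 := by
      intro b x v hv hav
      have h3 := h1.2.2 (by linarith [h1.1]) b x v hv fun w _ => by simp [hav]
      change v ∈ K.fiber b x at h3
      rw [K.fiber_eq_bot hK0] at h3
      exact h3
    rcases hN'.rank_eq_zero_or hN hK'0 with h4 | h4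
    · right
      refine ⟨hinj, fun b => ?_⟩
      have h5 := Subbundle.rank_kernel (S.comp b) (Subbundle.whole (N.bdl b)) (hB.hol b)
      rw [Subbundle.rank_whole] at h5
      have h6 : (Subbundle.kernel (S.comp b) (Subbundle.whole (N.bdl b)) (hB.hol b)).rank = 0 :=
        Subbundle.fiber_eq_bot_iff (x := Classical.arbitrary X).1 (K.fiber_eq_bot hK0 b _)
      have h7 : (Subbundle.kernel (Subbundle.whole (N.bdl b)) (S.comp b) (hB.hol b).flip).rank = 0 :=
        Subbundle.fiber_eq_bot_iff (x := Classical.arbitrary X).1 (K'.fiber_eq_bot h4 b _)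
      omega
    · left
      intro b x v hv
      refine (N.comp b).eq_zero_of_form_left fun w => ?_
      have : w ∈ K'.fiber b x := h4 b x ▸ trivial
      exact apply_eq_zero_of_mem_kernel (hB := hB.flip) this hv

/-- The form pulled back by a is a multiple c of that of M, because M is simple, and c ≠ 0 because a
is invertible. Dividing a by a square root of c makes it symplectic. -/
theorem IsHiggsHom.isomorphic {a : ∀ b x, (M.bdl b).Fiber x →ₗ[ℂ] (N.bdl b).Fiber x}
    {a' : ∀ b x, (N.bdl b).Fiber x →ₗ[ℂ] (M.bdl b).Fiber x}
    (ha : M.IsHiggsHom N a) (ha' : N.IsHiggsHom M a') (h : ∀ b x v, a' b x (a b x v) = v)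
    (h' : ∀ b x v, a b x (a' b x v) = v) (hM : M.IsStable) (hM' : M.IsSimple)
    (hpq : p ≠ 0 ∨ q ≠ 0) : M.Isomorphic N := by
  obtain ⟨c, hc⟩ := hM'.exists_eq_smul hM hpq (ha.comap_pairing N.isHiggsPairing_form)
  replace hc : ∀ b x v w, (N.comp b).form x (a b x v) (a b x w) = c * (M.comp b).form x v w := hc
  have hc0 : c ≠ 0 := by
    rintro rfl
    obtain ⟨b, hb⟩ := M.exists_nontrivial hpq (Classical.arbitrary X)
    obtain ⟨v, hv⟩ := exists_ne (0 : (M.bdl b).Fiber (Classical.arbitrary X))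
    apply hv
    rw [← h b _ v, (N.comp b).eq_zero_of_form_left (v := a b _ v) fun w => by
      rw [← h' b _ w, hc, zero_mul], map_zero]
  obtain ⟨k, hk⟩ := IsAlgClosed.exists_pow_nat_eq c (n := 2) two_pos
  have hk0 : k ≠ 0 := by
    rintro rfl
    simp at hk
    exact hc0 hk.symm
  refine isomorphic_iff.2 ⟨fun b x => LinearEquiv.ofLinearMap (k⁻¹ • a b x) (k • a' b x) ?_ ?_,
    ha.smul k⁻¹, (ha'.smul k).hol, fun b x v w => ?_⟩
  · exact LinearMap.ext fun v => by simp [h', smul_smul, hk0]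
  · exact LinearMap.ext fun v => by simp [h, smul_smul, hk0]
  · change (N.comp b).form x (k⁻¹ • a b x v) (k⁻¹ • a b x w) = _
    simp only [LinearMap.smul_apply, map_smul, hc, smul_eq_mul, ← hk]
    field_simp

end Connected

/-! ### Stability of sums of pairwise non-isomorphic summands -/

namespace IsHiggsSum

open HiggsSubbundle

variable {ι : ∀ i b x, ((N i).bdl b).Fiber x →ₗ[ℂ] (M.bdl b).Fiber x}
  {ϖ : ∀ i b x, (M.bdl b).Fiber x →ₗ[ℂ] ((N i).bdl b).Fiber x}
  [ConnectedSpace X] [CompactSpace X] [T2Space X]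

/-- Induction on the rank allows `eq_zero_or_injective` to be applied to a counterexample S: every
projection S → N i is zero or an isomorphism. Not all are zero, and two isomorphisms would make N i
and N j isomorphic through S. With a single one the form of M on S is that of N i, which is not
isotropic. -/
theorem degree_neg (h : M.IsHiggsSum N ι ϖ) (hPQ : ∀ i, P i ≠ 0 ∨ Q i ≠ 0)
    (hN : ∀ i, (N i).IsStable ∧ (N i).IsSimple) (hne : ∀ i j, i ≠ j → ¬ (N i).Isomorphic (N j)) :
    ∀ (k : ℕ) (S : HiggsSubbundle M), S.rank = k → S.IsIsotropic → S.rank ≠ 0 → S.degree < 0 := by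
  intro k
  induction k using Nat.strong_induction_on with
  | _ k ih =>
    rintro S rfl hiso hS
    by_contra! hdeg
    have hdich := fun i => (h.isHiggsHom_proj i).eq_zero_or_injective (hN i).1 (hN i).2 S hdeg
      fun K hKS hlt h0 => ih K.rank hlt K rfl
        (fun b x v hv w hw => hiso b x v (hKS b x hv) w (hKS b x hw)) h0
    have hex : ∃ i, ¬ ∀ b x, ∀ v ∈ S.fiber b x, ϖ i b x v = 0 := by
      by_contra! h0
      refine hS (S.rank_eq_zero_of_fiber (x := Classical.arbitrary X) fun b => eq_bot_iff.2 ?_)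
      intro v hv
      rw [Submodule.mem_bot, ← h.sum_incl_proj b _ v]
      exact Finset.sum_eq_zero fun i _ => by rw [h0 i b _ v hv, map_zero]
    obtain ⟨i, hi⟩ := hex
    have hi' := (hdich i).resolve_left hi
    obtain ⟨g, hg, hgS, hgϖ, hϖg⟩ := (h.isHiggsHom_proj i).exists_inverse_on S hi'.1 hi'.2
    have hother : ∀ j, j ≠ i → ∀ b x, ∀ v ∈ S.fiber b x, ϖ j b x v = 0 := by
      intro j hji
      by_contra hj
      have hj' := (hdich j).resolve_left hj
      obtain ⟨g', hg', hgS', hgϖ', hϖg'⟩ := (h.isHiggsHom_proj j).exists_inverse_on S hj'.1 hj'.2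
      refine hne i j hji.symm (((h.isHiggsHom_proj j).comp hg).isomorphic
        ((h.isHiggsHom_proj i).comp hg') (fun b x v => ?_) (fun b x v => ?_) (hN i).1 (hN i).2
        (hPQ i))
      · simp [hgϖ' b x _ (hgS b x v), hϖg]
      · simp [hgϖ b x _ (hgS' b x v), hϖg']
    obtain ⟨b, hb⟩ := (N i).exists_nontrivial (hPQ i) (Classical.arbitrary X)
    obtain ⟨v, hv⟩ := exists_ne (0 : ((N i).bdl b).Fiber (Classical.arbitrary X))
    refine hv (((N i).comp b).eq_zero_of_form_left fun w => ?_)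
    have h1 := hiso b _ _ (hgS b _ v) _ (hgS b _ w)
    rw [h.form_eq_sum, Finset.sum_eq_single i, hϖg, hϖg] at h1
    · exact h1
    · intro j _ hji
      rw [hother j hji b _ _ (hgS b _ v), map_zero, LinearMap.zero_apply]
    · simp

theorem isStable (h : M.IsHiggsSum N ι ϖ) (hPQ : ∀ i, P i ≠ 0 ∨ Q i ≠ 0)
    (hN : ∀ i, (N i).IsStable ∧ (N i).IsSimple) (hne : ∀ i j, i ≠ j → ¬ (N i).Isomorphic (N j)) :
    M.IsStable := by
  intro V' W' hV hW hrank hβ hγ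
  let S : HiggsSubbundle M :=
    { comp := fun b => match b with
        | false => V'
        | true => W'
      higgs_mem := by
        intro b c x ξ v hv
        cases b <;> cases c
        · exact Submodule.zero_mem _
        · exact hγ x ξ v hv
        · exact hβ x ξ v hv
        · exact Submodule.zero_mem _ }
  refine h.degree_neg hPQ hN hne _ S rfl (fun b => ?_) ?_
  · cases b
    exacts [hV, hW]
  · change V'.rank + W'.rank ≠ 0
    omega

end IsHiggsSum

end SpHiggsBundle

/-! ### Automorphisms of direct sums -/

namespace SpHiggsBundle

open HolomorphicVectorBundle

variable {X : Type*} [TopologicalSpace X] [ChartedSpace ℂ X] [IsManifold 𝓘(ℂ) ω X]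
  {p q : ℕ} {M : SpHiggsBundle X p q}

theorem IsHiggsIso.trans {φ ψ : ∀ b x, (M.bdl b).Fiber x ≃ₗ[ℂ] (M.bdl b).Fiber x}
    (hφ : M.IsHiggsIso M φ) (hψ : M.IsHiggsIso M ψ) :
    M.IsHiggsIso M fun b x => (φ b x).trans (ψ b x) :=
  ⟨hψ.isHiggsHom.comp hφ.isHiggsHom, fun b x s hs => hφ.hol_symm b x _ (hψ.hol_symm b x s hs),
    fun b x v w => by simp [hψ.form, hφ.form]⟩

/-- An involutive endomorphism that preserves the forms is an automorphism. -/
theorem IsHiggsHom.isHiggsIso_ofInvolutive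
    {a : ∀ b x, (M.bdl b).Fiber x →ₗ[ℂ] (M.bdl b).Fiber x} (ha : M.IsHiggsHom M a)
    (h : ∀ b x, Function.Involutive (a b x))
    (hform : ∀ b x v w, (M.comp b).form x (a b x v) (a b x w) = (M.comp b).form x v w) :
    M.IsHiggsIso M fun b x => LinearEquiv.ofInvolutive (a b x) (h b x) :=
  ⟨ha, ha.hol, hform⟩

namespace IsHiggsSum

variable {r : ℕ} {P Q : Fin r → ℕ} {N : ∀ i, SpHiggsBundle X (P i) (Q i)}
  {ι : ∀ i b x, ((N i).bdl b).Fiber x →ₗ[ℂ] (M.bdl b).Fiber x}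
  {ϖ : ∀ i b x, (M.bdl b).Fiber x →ₗ[ℂ] ((N i).bdl b).Fiber x}

theorem ext_proj (h : M.IsHiggsSum N ι ϖ) {b : Bool} {x : X} {v w : (M.bdl b).Fiber x}
    (hvw : ∀ i, ϖ i b x v = ϖ i b x w) : v = w := by
  rw [← h.sum_incl_proj b x v, ← h.sum_incl_proj b x w]
  exact Finset.sum_congr rfl fun i _ => by rw [hvw]

/-- The endomorphism that is multiplication by `ε i` on the `i`th summand. -/
noncomputable def signEnd (_ : M.IsHiggsSum N ι ϖ) (ε : Fin r → ℤˣ) (b : Bool) (x : X) :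
    (M.bdl b).Fiber x →ₗ[ℂ] (M.bdl b).Fiber x :=
  ∑ i, ((ε i : ℤ) : ℂ) • (ι i b x ∘ₗ ϖ i b x)

theorem proj_signEnd (h : M.IsHiggsSum N ι ϖ) (ε : Fin r → ℤˣ) (b : Bool) (x : X)
    (v : (M.bdl b).Fiber x) (i : Fin r) :
    ϖ i b x (h.signEnd ε b x v) = ((ε i : ℤ) : ℂ) • ϖ i b x v := by
  have := h.proj_sum_incl b x (fun j => ((ε j : ℤ) : ℂ) • ϖ j b x v) i
  rw [← this]
  simp [signEnd]

theorem signEnd_mul (h : M.IsHiggsSum N ι ϖ) (ε δ : Fin r → ℤˣ) (b : Bool) (x : X)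
    (v : (M.bdl b).Fiber x) :
    h.signEnd (ε * δ) b x v = h.signEnd ε b x (h.signEnd δ b x v) :=
  h.ext_proj fun i => by simp [h.proj_signEnd, smul_smul]

theorem signEnd_one (h : M.IsHiggsSum N ι ϖ) (b : Bool) (x : X) (v : (M.bdl b).Fiber x) :
    h.signEnd 1 b x v = v :=
  h.ext_proj fun i => by simp [h.proj_signEnd]

theorem signEnd_involutive (h : M.IsHiggsSum N ι ϖ) (ε : Fin r → ℤˣ) (b : Bool) (x : X) :
    Function.Involutive (h.signEnd ε b x) := fun v => by
  have h1 : ε * ε = 1 := funext fun i => Int.units_mul_self _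
  rw [← signEnd_mul, h1, h.signEnd_one]

theorem isHiggsIso_signEnd (h : M.IsHiggsSum N ι ϖ) (ε : Fin r → ℤˣ) :
    M.IsHiggsIso M fun b x => LinearEquiv.ofInvolutive _ (h.signEnd_involutive ε b x) := by
  refine IsHiggsHom.isHiggsIso_ofInvolutive ?_ _ fun b x v w => ?_
  · exact IsHiggsHom.sum fun i _ =>
      ((h.isHiggsHom_incl i).comp (h.isHiggsHom_proj i)).smul ((ε i : ℤ) : ℂ)
  · rw [h.form_eq_sum, h.form_eq_sum]
    refine Finset.sum_congr rfl fun i _ => ?_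
    rw [h.proj_signEnd, h.proj_signEnd]
    rcases Int.units_eq_one_or (ε i) with h1 | h1 <;> simp [h1]

/-- The automorphisms that are `±1` on every summand. -/
noncomputable def signHom (h : M.IsHiggsSum N ι ϖ) : (Fin r → ℤˣ) →* M.Aut :=
  MonoidHom.mk' (fun ε => ⟨_, ofPair_mem_Aut (h.isHiggsIso_signEnd ε)⟩) fun ε δ =>
    Subtype.ext (Prod.ext (funext fun x => LinearEquiv.ext fun v => h.signEnd_mul ε δ false x v)
      (funext fun x => LinearEquiv.ext fun v => h.signEnd_mul ε δ true x v))

theorem signHom_eq_iff (h : M.IsHiggsSum N ι ϖ) (ε : Fin r → ℤˣ) (a : M.Aut) :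
    h.signHom ε = a ↔ ∀ b x v, h.signEnd ε b x v = ofPair a.1.1 a.1.2 b x v := by
  constructor
  · rintro rfl b x v
    cases b <;> rfl
  · intro H
    exact Subtype.ext (Prod.ext (funext fun x => LinearEquiv.ext fun v => H false x v)
      (funext fun x => LinearEquiv.ext fun v => H true x v))

variable [ConnectedSpace X]

theorem signHom_injective (h : M.IsHiggsSum N ι ϖ) (hPQ : ∀ i, P i ≠ 0 ∨ Q i ≠ 0) :
    Function.Injective h.signHom := by
  intro ε δ hεδ
  have h1 := (h.signHom_eq_iff ε _).1 hεδ
  have h2 := (h.signHom_eq_iff δ _).1 rfl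
  funext i
  obtain ⟨b, hb⟩ := (N i).exists_nontrivial (hPQ i) (Classical.arbitrary X)
  obtain ⟨v, hv⟩ := exists_ne (0 : ((N i).bdl b).Fiber (Classical.arbitrary X))
  have h3 := congrArg (ϖ i b _) ((h1 b _ (ι i b _ v)).trans (h2 b _ (ι i b _ v)).symm)
  rw [h.proj_signEnd, h.proj_signEnd, h.proj_incl] at h3
  exact Units.ext (Int.cast_injective (smul_left_injective ℂ hv h3))

variable [CompactSpace X] [T2Space X]

/-- All automorphisms are involutions, so φ commutes with the reflection in the summand, and hence
with the projection e. -/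
theorem incl_proj_comm (h : M.IsHiggsSum N ι ϖ) (hM : M.IsStable)
    {φ : ∀ b x, (M.bdl b).Fiber x ≃ₗ[ℂ] (M.bdl b).Fiber x} (hφ : M.IsHiggsIso M φ) (i : Fin r)
    (b : Bool) (x : X) (v : (M.bdl b).Fiber x) :
    ι i b x (ϖ i b x (φ b x v)) = φ b x (ι i b x (ϖ i b x v)) := by
  have he := h.isOrthProj i
  have h1 := hM.apply_apply_of_isHiggsIso hφ b x
  have key : ∀ v, (2 : ℂ) • (φ b x (ι i b x (ϖ i b x v)) + ι i b x (ϖ i b x (φ b x v))) =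
      (2 : ℂ) • (2 : ℂ) • ι i b x (ϖ i b x (φ b x (ι i b x (ϖ i b x v)))) := by
    intro v
    have h2 := hM.apply_apply_of_isHiggsIso (he.isHiggsIso_reflection.trans hφ) b x v
    simp only [LinearEquiv.trans_apply] at h2
    have h3 := congrArg (φ b x) h2
    rw [h1, he.reflection_apply, he.reflection_apply] at h3
    simp only [LinearMap.comp_apply, map_sub, map_smul] at h3
    rw [smul_add]
    refine sub_eq_zero.1 ?_
    rw [← sub_eq_zero.2 h3.symm]
    module
  replace key := fun v => smul_right_injective _ (two_ne_zero (α := ℂ)) (key v)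
  -- `key` now says φe + eφ = 2eφe. On the image of e it gives φe = eφe, and substituting this back
  -- gives eφ = φe.
  have h2 := key (ι i b x (ϖ i b x v))
  rw [h.proj_incl, two_smul] at h2
  have h3 := key v
  rw [← add_right_cancel h2, two_smul] at h3
  exact add_left_cancel h3

/-- An automorphism commutes with the projections, so it is block diagonal, and each block is an
automorphism of a simple summand, hence a sign. -/
theorem signHom_surjective (h : M.IsHiggsSum N ι ϖ) (hM : M.IsStable)
    (hN : ∀ i, (N i).IsSimple) : Function.Surjective h.signHom := by
  rintro ⟨a, ha⟩
  have hφ := mem_Aut_iff.1 ha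
  set φ := ofPair a.1 a.2 with hφdef
  have hcomm := h.incl_proj_comm hM hφ
  have hsq := hM.apply_apply_of_isHiggsIso hφ
  have hinv : ∀ i b x, Function.Involutive (ϖ i b x ∘ₗ (φ b x).toLinearMap ∘ₗ ι i b x) := by
    intro i b x v
    simp [hcomm, h.proj_incl, hsq]
  have hiso : ∀ i, (N i).IsHiggsIso (N i) fun b x => LinearEquiv.ofInvolutive _ (hinv i b x) := by
    intro i
    refine IsHiggsHom.isHiggsIso_ofInvolutive ((h.isHiggsHom_proj i).comp
      (hφ.isHiggsHom.comp (h.isHiggsHom_incl i))) _ fun b x v w => ?_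
    simp only [LinearMap.comp_apply, LinearEquiv.coe_coe]
    rw [← h.form_incl, hcomm, h.proj_incl, hφ.form, h.form_incl, h.proj_incl]
  have hsign : ∀ i, ∃ s : ℤˣ, ∀ b x v, ϖ i b x (φ b x (ι i b x v)) = ((s : ℤ) : ℂ) • v := by
    intro i
    rcases (hN i).eq_or_eq (hiso i) with h1 | h1
    · exact ⟨1, fun b x v => (h1 b x v).trans (by simp)⟩
    · exact ⟨-1, fun b x v => (h1 b x v).trans (by simp)⟩
  choose ε hε using hsign
  refine ⟨ε, (h.signHom_eq_iff ε _).2 fun b x v => h.ext_proj fun i => ?_⟩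
  rw [h.proj_signEnd, ← hε, ← hcomm, h.proj_incl]

theorem nonempty_mulEquiv (h : M.IsHiggsSum N ι ϖ) (hPQ : ∀ i, P i ≠ 0 ∨ Q i ≠ 0)
    (hM : M.IsStable) (hN : ∀ i, (N i).IsSimple) :
    Nonempty (M.Aut ≃* (Fin r → Multiplicative (ZMod 2))) := by
  have e : ℤˣ ≃* Multiplicative (ZMod 2) := by
    have : Fact (Nat.Prime 2) := ⟨Nat.prime_two⟩
    exact mulEquivOfPrimeCardEq (p := 2) (by simp [Nat.card_eq_fintype_card]) (by simp)
  exact ⟨(MulEquiv.ofBijective h.signHom ⟨h.signHom_injective hPQ,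
    h.signHom_surjective hM hN⟩).symm.trans (MulEquiv.piCongrRight fun _ => e)⟩

end IsHiggsSum

end SpHiggsBundle

/-! ### The vector bundle underlying a subbundle -/

namespace HolomorphicVectorBundle.Subbundle

variable {X : Type*} [TopologicalSpace X] [ChartedSpace ℂ X] [IsManifold 𝓘(ℂ) ω X] {n : ℕ}
  {E : HolomorphicVectorBundle X n} (S : E.Subbundle)

/-- The domain of the frame of `S` around `i`. -/
noncomputable def frameSet (i : X) : Set X := (S.exists_frame i).choose

theorem isOpen_frameSet (i : X) : IsOpen (S.frameSet i) := (S.exists_frame i).choose_spec.1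

theorem mem_frameSet (i : X) : i ∈ S.frameSet i := (S.exists_frame i).choose_spec.2.1

theorem isFrameAt_frame_of_mem {i x : X} (hx : x ∈ S.frameSet i) : S.IsFrameAt (S.frame i) x := by
  have h := (S.exists_frame i).choose_spec.2.2.choose_spec
  refine ⟨fun j => (isHolSection_iff (S.isOpen_frameSet i)).1 (h.1 j) x hx, ?_⟩
  filter_upwards [(S.isOpen_frameSet i).mem_nhds hx] with y hy using h.2 y hy

/-- The linear combination of the members of the frame around `i`. -/
noncomputable def ofFrame (i x : X) : (Fin S.rank → ℂ) →ₗ[ℂ] E.Fiber x :=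
  Fintype.linearCombination ℂ fun j => S.frame i j x

open Classical in
/-- The coefficients with respect to the frame around `i`. -/
noncomputable def toFrame (i x : X) : E.Fiber x →ₗ[ℂ] (Fin S.rank → ℂ) :=
  -- On the domain of the frame the condition holds; 0 is a default for other points.
  if h : LinearMap.ker (S.ofFrame i x) = ⊥ then
    ((S.ofFrame i x).exists_leftInverse_of_injective h).choose else 0

variable {S}

theorem ofFrame_apply (i x : X) (c : Fin S.rank → ℂ) :
    S.ofFrame i x c = ∑ j, c j • S.frame i j x := rfl

theorem ker_ofFrame {i x : X} (hx : x ∈ S.frameSet i) : LinearMap.ker (S.ofFrame i x) = ⊥ :=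
  LinearMap.ker_eq_bot.2 (S.isFrameAt_frame_of_mem hx).linearIndependent.fintypeLinearCombination_injective

theorem range_ofFrame {i x : X} (hx : x ∈ S.frameSet i) :
    LinearMap.range (S.ofFrame i x) = S.fiber x := by
  rw [ofFrame, Fintype.range_linearCombination, (S.isFrameAt_frame_of_mem hx).span_eq]

theorem toFrame_ofFrame {i x : X} (hx : x ∈ S.frameSet i) (c : Fin S.rank → ℂ) :
    S.toFrame i x (S.ofFrame i x c) = c := by
  have h := ker_ofFrame hx
  rw [toFrame, dif_pos h]
  exact LinearMap.congr_fun ((S.ofFrame i x).exists_leftInverse_of_injective h).choose_spec c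

theorem ofFrame_toFrame {i x : X} (hx : x ∈ S.frameSet i) {v : E.Fiber x} (hv : v ∈ S.fiber x) :
    S.ofFrame i x (S.toFrame i x v) = v := by
  rw [← range_ofFrame hx] at hv
  obtain ⟨c, rfl⟩ := hv
  rw [toFrame_ofFrame hx]

theorem ofFrame_mem {i x : X} (hx : x ∈ S.frameSet i) (c : Fin S.rank → ℂ) :
    S.ofFrame i x c ∈ S.fiber x :=
  range_ofFrame hx ▸ ⟨c, rfl⟩

theorem holFnAt_toFrame {i x : X} (hx : x ∈ S.frameSet i) {s : ∀ y, E.Fiber y} (hs : E.HolAt s x)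
    (hsS : ∀ᶠ y in 𝓝 x, s y ∈ S.fiber y) (j : Fin S.rank) :
    HolFnAt (fun y => S.toFrame i y (s y) j) x := by
  obtain ⟨P, hP, hPe⟩ := (S.isFrameAt_frame_of_mem hx).exists_coeff (t := fun _ : Unit => s)
    (fun _ => hs) (hsS.mono fun y hy _ => hy)
  refine (hP () j).congr ?_
  filter_upwards [hPe, (S.isOpen_frameSet i).mem_nhds hx] with y h1 h2
  rw [h1 (), ← ofFrame_apply, toFrame_ofFrame h2]

variable (S)

theorem contMDiffOn_coordChange (i j : X) : ContMDiffOn 𝓘(ℂ)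
    𝓘(ℂ, (Fin S.rank → ℂ) →L[ℂ] (Fin S.rank → ℂ)) ω
    (fun x => LinearMap.toContinuousLinearMap (S.toFrame j x ∘ₗ S.ofFrame i x))
    (S.frameSet i ∩ S.frameSet j) := by
  intro x hx
  apply ContMDiffAt.contMDiffWithinAt
  -- `L` assembles an operator from its matrix entries, so that only the entries, which are scalar
  -- functions, have to be holomorphic.
  let L : (Fin S.rank → Fin S.rank → ℂ) →ₗ[ℂ] ((Fin S.rank → ℂ) →L[ℂ] (Fin S.rank → ℂ)) :=
    LinearMap.toContinuousLinearMap.toLinearMap ∘ₗ Matrix.toLin'.toLinearMap ∘ₗ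
      (Matrix.ofLinearEquiv ℂ).toLinearMap
  have hL : ∀ y, LinearMap.toContinuousLinearMap (S.toFrame j y ∘ₗ S.ofFrame i y) =
      L.toContinuousLinearMap fun l m => S.toFrame j y (S.frame i m y) l := by
    intro y
    have : S.toFrame j y ∘ₗ S.ofFrame i y =
        Matrix.toLin' (Matrix.of fun l m => S.toFrame j y (S.frame i m y) l) := by
      refine LinearMap.pi_ext' fun m => LinearMap.ext_ring ?_
      funext l
      simp [ofFrame, Fintype.linearCombination_apply_single]
    rw [this]
    rfl
  simp only [hL]
  refine (L.toContinuousLinearMap.contMDiff (n := ω)).contMDiffAt.comp x ?_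
  refine contMDiffAt_pi_space.2 fun l => contMDiffAt_pi_space.2 fun m => ?_
  refine holFnAt_toFrame hx.2 ((S.isFrameAt_frame_of_mem hx.1).1 m) ?_ l
  filter_upwards [(S.isFrameAt_frame_of_mem hx.1).2] with y hy
  exact hy.2 ▸ Submodule.subset_span ⟨m, rfl⟩

/-- The transition functions between the frames of `S`. -/
noncomputable def core : VectorBundleCore ℂ X (Fin S.rank → ℂ) X where
  baseSet := S.frameSet
  isOpen_baseSet := S.isOpen_frameSet
  indexAt := id
  mem_baseSet_at := S.mem_frameSet
  coordChange i j x := LinearMap.toContinuousLinearMap (S.toFrame j x ∘ₗ S.ofFrame i x)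
  coordChange_self i x hx v := toFrame_ofFrame hx v
  continuousOn_coordChange i j := (S.contMDiffOn_coordChange i j).continuousOn
  coordChange_comp i j k x hx v := by
    simp only [LinearMap.coe_toContinuousLinearMap', LinearMap.comp_apply]
    rw [ofFrame_toFrame hx.1.2 (ofFrame_mem hx.1.1 v)]

instance : S.core.IsContMDiff 𝓘(ℂ) ω := ⟨S.contMDiffOn_coordChange⟩

/-- The vector bundle underlying a subbundle. -/
noncomputable def toBundle : HolomorphicVectorBundle X S.rank where
  Fiber := S.core.Fiber

/-- The inclusion of the vector bundle underlying a subbundle. -/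
noncomputable def incl (x : X) : S.toBundle.Fiber x →ₗ[ℂ] E.Fiber x := S.ofFrame x x

theorem range_incl (x : X) : LinearMap.range (S.incl x) = S.fiber x :=
  range_ofFrame (S.mem_frameSet x)

theorem incl_injective (x : X) : Function.Injective (S.incl x) :=
  LinearMap.ker_eq_bot.1 (ker_ofFrame (S.mem_frameSet x))

theorem coord_toBundle {x y : X} (hy : y ∈ S.frameSet x) (v : S.toBundle.Fiber y) :
    S.toBundle.coord x y v = S.toFrame x y (S.incl y v) := by
  have hy' : y ∈ (trivializationAt (Fin S.rank → ℂ) S.toBundle.Fiber x).baseSet := hy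
  rw [coord, Bundle.Trivialization.linearMapAt_apply, if_pos hy']
  rfl

theorem holAt_incl_iff {s : ∀ y, S.toBundle.Fiber y} {x : X} :
    E.HolAt (fun y => S.incl y (s y)) x ↔ S.toBundle.HolAt s x := by
  have hx := S.mem_frameSet x
  have hev : ∀ᶠ y in 𝓝 x, y ∈ S.frameSet x := (S.isOpen_frameSet x).mem_nhds hx
  have hmem : ∀ y v, S.incl y v ∈ S.fiber y := fun y v => S.range_incl y ▸ ⟨v, rfl⟩
  rw [holAt_iff (E := S.toBundle)]
  constructor
  · intro h k
    refine (holFnAt_toFrame hx h (Eventually.of_forall fun y => hmem y _) k).congr ?_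
    filter_upwards [hev] with y hy
    rw [coord_toBundle S hy]
  · intro h
    refine HolAt.congr (HolAt.sum fun k (_ : k ∈ Finset.univ) => HolAt.smul (h k)
      ((S.isFrameAt_frame x).1 k)) ?_
    filter_upwards [hev] with y hy
    rw [← ofFrame_apply, coord_toBundle S hy, ofFrame_toFrame hy (hmem y _)]

/-- A subbundle is the image of a vector bundle. -/
theorem exists_bundle {k : ℕ} (hk : S.rank = k) :
    ∃ (Z : HolomorphicVectorBundle X k) (j : ∀ x, Z.Fiber x →ₗ[ℂ] E.Fiber x),
      (∀ x, Function.Injective (j x)) ∧ (∀ x, LinearMap.range (j x) = S.fiber x) ∧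
      ∀ x (s : ∀ y, Z.Fiber y), E.HolAt (fun y => j y (s y)) x ↔ Z.HolAt s x := by
  subst hk
  exact ⟨S.toBundle, S.incl, S.incl_injective, S.range_incl, fun x s => S.holAt_incl_iff⟩

end HolomorphicVectorBundle.Subbundle

/-! ### Summands of Higgs bundles -/

/-- A space with a nondegenerate alternating form has even dimension. -/
theorem LinearMap.IsAlt.even_finrank {V : Type*} [AddCommGroup V] [Module ℂ V]
    [FiniteDimensional ℂ V] {B : V →ₗ[ℂ] V →ₗ[ℂ] ℂ} (hB : B.IsAlt)
    (h : ∀ v, (∀ w, B v w = 0) → v = 0) : Even (Module.finrank ℂ V) := by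
  set b := Module.finBasis ℂ V
  have hdet := (LinearMap.separatingLeft_iff_det_ne_zero b (B := B)).1 h
  set A := LinearMap.toMatrix₂ b b B with hA
  have htr : A.transpose = -A := by
    ext i j
    simp [hA, LinearMap.toMatrix₂_apply, hB.neg]
  have h1 : A.det = (-1) ^ Module.finrank ℂ V * A.det := by
    conv_lhs => rw [← Matrix.det_transpose, htr, Matrix.det_neg, Fintype.card_fin]
  by_contra hodd
  rw [(Nat.not_even_iff_odd.1 hodd).neg_one_pow, neg_one_mul, self_eq_neg] at h1
  exact hdet h1

namespace SymplecticVectorBundle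

open HolomorphicVectorBundle

variable {X : Type*} [TopologicalSpace X] [ChartedSpace ℂ X] [IsManifold 𝓘(ℂ) ω X] [Nonempty X]

/-- A subbundle on which the form is nondegenerate is the image of a symplectic vector bundle. -/
theorem exists_restrict {p : ℕ} (V : SymplecticVectorBundle X p)
    (S : V.toHolomorphicVectorBundle.Subbundle)
    (hS : ∀ x, ∀ v ∈ S.fiber x, (∀ w ∈ S.fiber x, V.form x v w = 0) → v = 0) :
    ∃ (p' : ℕ) (Z : SymplecticVectorBundle X p') (j : ∀ x, Z.Fiber x →ₗ[ℂ] V.Fiber x),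
      (∀ x, Function.Injective (j x)) ∧ (∀ x, LinearMap.range (j x) = S.fiber x) ∧
      (∀ x (s : ∀ y, Z.Fiber y), V.HolAt (fun y => j y (s y)) x ↔ Z.HolAt s x) ∧
      ∀ x v w, V.form x (j x v) (j x w) = Z.form x v w := by
  have heven : Even S.rank := by
    let x : X := Classical.arbitrary X
    have h := LinearMap.IsAlt.even_finrank
      (B := (V.form x).domRestrict₁₂ (S.fiber x) (S.fiber x)) (fun v => V.form_alt x v)
      fun v hv => Subtype.ext (hS x v v.2 fun w hw => hv ⟨w, hw⟩)
    rwa [S.finrank_fiber] at h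
  obtain ⟨p', hp'⟩ := heven
  obtain ⟨Z, j, hinj, hrange, hhol⟩ := S.exists_bundle (k := 2 * p') (by omega)
  have hmem : ∀ x v, j x v ∈ S.fiber x := fun x v => hrange x ▸ ⟨v, rfl⟩
  refine ⟨p', { Z with
    form := fun x => (V.form x).compl₁₂ (j x) (j x)
    form_alt := fun x v => V.form_alt x (j x v)
    form_nondegenerate := fun x => ⟨fun v hv => hinj x ?_, fun v hv => hinj x ?_⟩
    form_holomorphic := fun U s t hU hs ht => ?_ }, j, hinj, hrange, hhol, fun x v w => rfl⟩
  · rw [map_zero]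
    refine hS x _ (hmem x v) fun w hw => ?_
    rw [← hrange] at hw
    obtain ⟨w, rfl⟩ := hw
    exact hv w
  · rw [map_zero]
    refine hS x _ (hmem x v) fun w hw => ?_
    rw [← hrange] at hw
    obtain ⟨w, rfl⟩ := hw
    rw [V.form_swap]
    exact neg_eq_zero.2 (hv w)
  · have key : ∀ s : ∀ x, Z.Fiber x, Z.IsHolSection U s → V.IsHolSection U fun y => j y (s y) :=
      fun s hs => (isHolSection_iff hU).2 fun x hx =>
        (hhol x s).2 ((isHolSection_iff hU).1 hs x hx)
    exact V.form_holomorphic U _ _ hU (key s hs) (key t ht)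

end SymplecticVectorBundle

namespace HolomorphicVectorBundle.Subbundle

variable {X : Type*} [TopologicalSpace X] [ChartedSpace ℂ X] [IsManifold 𝓘(ℂ) ω X] {n n' : ℕ}
  {E : HolomorphicVectorBundle X n} {E' : HolomorphicVectorBundle X n'}

/-- The image of a subbundle under an injective homomorphism. -/
def map (S : E.Subbundle) {f : ∀ x, E.Fiber x →ₗ[ℂ] E'.Fiber x} (hf : E.IsHolHom E' f)
    (hinj : ∀ x, Function.Injective (f x)) : E'.Subbundle where
  fiber x := (S.fiber x).map (f x)
  rank := S.rank
  exists_frame x₀ := by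
    obtain ⟨U, hU, hx₀, s, hs, h⟩ := S.exists_frame x₀
    refine ⟨U, hU, hx₀, fun i x => f x (s i x), fun i => hf.isHolSection hU (hs i), fun x hx => ?_⟩
    refine ⟨(h x hx).1.map' (f x) (LinearMap.ker_eq_bot.2 (hinj x)), ?_⟩
    rw [← (h x hx).2, Submodule.map_span, ← Set.range_comp]
    rfl

end HolomorphicVectorBundle.Subbundle

namespace SpHiggsBundle

open HolomorphicVectorBundle

variable {X : Type*} [TopologicalSpace X] [ChartedSpace ℂ X] [IsManifold 𝓘(ℂ) ω X]
  {p q p' q' : ℕ} {M : SpHiggsBundle X p q} {N : SpHiggsBundle X p' q'}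

/-- `N` is the orthogonal summand of `M` onto which `e` projects. -/
structure IsSummand (M : SpHiggsBundle X p q) (N : SpHiggsBundle X p' q')
    (e : ∀ b x, Module.End ℂ ((M.bdl b).Fiber x))
    (ι : ∀ b x, (N.bdl b).Fiber x →ₗ[ℂ] (M.bdl b).Fiber x)
    (ϖ : ∀ b x, (M.bdl b).Fiber x →ₗ[ℂ] (N.bdl b).Fiber x) : Prop where
  isHiggsHom_incl : N.IsHiggsHom M ι
  isHiggsHom_proj : M.IsHiggsHom N ϖ
  proj_incl : ∀ b x v, ϖ b x (ι b x v) = v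
  incl_proj : ∀ b x v, ι b x (ϖ b x v) = e b x v
  form_incl : ∀ b x v w, (M.comp b).form x (ι b x v) w = (N.comp b).form x v (ϖ b x w)

/-- N is the image of e with the restricted forms and with the Higgs field compressed by the
inclusion and the projection. The compression is a restriction because the Higgs field commutes with
e. -/
theorem IsOrthProj.exists_isSummand [Nonempty X] {e : ∀ b x, Module.End ℂ ((M.bdl b).Fiber x)}
    (he : M.IsOrthProj e) (S : HiggsSubbundle M) (hS : ∀ b x, S.fiber b x = LinearMap.range (e b x)) :
    ∃ (p' q' : ℕ) (N : SpHiggsBundle X p' q') (ι : _) (ϖ : _), M.IsSummand N e ι ϖ := by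
  have hnd : ∀ b x, ∀ v ∈ S.fiber b x, (∀ w ∈ S.fiber b x, (M.comp b).form x v w = 0) → v = 0 := by
    intro b x v hv hvw
    rw [hS] at hv
    obtain ⟨v, rfl⟩ := hv
    refine (M.comp b).eq_zero_of_form_left fun w => ?_
    -- Self-adjointness moves `e` to the other argument, so orthogonality to the image of `e`
    -- implies orthogonality to everything.
    rw [← he.idem, he.form]
    exact hvw _ (hS b x ▸ ⟨w, rfl⟩)
  choose P Z j hinj hrange hhol hform using fun b => (M.comp b).exists_restrict (S.comp b) (hnd b)
  have hproj : ∀ b x, ∃ ϖ : (M.bdl b).Fiber x →ₗ[ℂ] (Z b).Fiber x,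
      (∀ v, j b x (ϖ v) = e b x v) ∧ ∀ v, ϖ (j b x v) = v := by
    intro b x
    obtain ⟨g, hg⟩ := (j b x).exists_leftInverse_of_injective (LinearMap.ker_eq_bot.2 (hinj b x))
    have h1 : ∀ v, j b x (g (e b x v)) = e b x v := by
      intro v
      have h2 : e b x v ∈ LinearMap.range (j b x) := by
        rw [hrange]
        exact (hS b x).ge ⟨v, rfl⟩
      obtain ⟨u, hu⟩ := h2
      rw [← hu]
      exact congrArg _ (LinearMap.congr_fun hg u)
    refine ⟨g ∘ₗ e b x, h1, fun v => hinj b x ?_⟩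
    have h2 : j b x v ∈ S.fiber b x := (hrange b x).le ⟨v, rfl⟩
    rw [hS] at h2
    obtain ⟨u, hu⟩ := h2
    rw [LinearMap.comp_apply, h1, ← hu, he.idem]
  choose ϖ hjϖ hϖj using hproj
  have hej : ∀ b x v, e b x (j b x v) = j b x v := fun b x v => by rw [← hjϖ, hϖj]
  have hforml : ∀ b x v w, (M.comp b).form x (j b x v) w = (Z b).form x v (ϖ b x w) := by
    intro b x v w
    rw [← hform, hjϖ, ← he.form, hej]
  have hformr : ∀ b x v w, (M.comp b).form x v (j b x w) = (Z b).form x (ϖ b x v) w := by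
    intro b x v w
    rw [← hform, hjϖ, he.form, hej]
  have holϖ : ∀ b, (M.bdl b).IsHolHom (Z b).toHolomorphicVectorBundle (ϖ b) := fun b x s hs => by
    rw [← hhol]
    simp only [hjϖ]
    exact he.isHiggsHom.hol b x s hs
  have holj : ∀ b, (Z b).IsHolHom (M.bdl b) (j b) := fun b x s hs => (hhol b x s).2 hs
  let N : SpHiggsBundle X (P false) (P true) :=
    { V := Z false
      W := Z true
      β := ⟨fun x => ((M.β.toFun x).compl₁₂ LinearMap.id (j true x)).compr₂ (ϖ false x),
        fun U ξ s hU hξ hs => (holϖ false).isHolSection hU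
          (M.β.holomorphic U ξ _ hU hξ ((holj true).isHolSection hU hs))⟩
      γ := ⟨fun x => ((M.γ.toFun x).compl₁₂ LinearMap.id (j false x)).compr₂ (ϖ true x),
        fun U ξ s hU hξ hs => (holϖ true).isHolSection hU
          (M.γ.holomorphic U ξ _ hU hξ ((holj false).isHolSection hU hs))⟩
      skew := fun x ξ w v =>
        (hformr false x _ v).symm.trans ((M.skew x ξ _ _).trans (congrArg _ (hforml true x w _))) }
  have hϖe : ∀ b x v, ϖ b x (e b x v) = ϖ b x v := fun b x v => by rw [← hjϖ, hϖj]
  have hjc : ∀ b c x ξ v, j c x (ϖ c x (M.higgs b c x ξ (j b x v))) =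
      M.higgs b c x ξ (j b x v) := fun b c x ξ v => by
    rw [hjϖ, he.isHiggsHom.comm, hej]
  have hϖc : ∀ b c x ξ v, ϖ c x (M.higgs b c x ξ v) =
      ϖ c x (M.higgs b c x ξ (j b x (ϖ b x v))) := fun b c x ξ v => by
    rw [hjϖ, ← he.isHiggsHom.comm, hϖe]
  -- The components of `N` are identified with the `Z b` only after a case distinction on the
  -- degree, so the maps are given by cases.
  refine ⟨P false, P true, N, fun b => match b with
    | false => j false
    | true => j true, fun b => match b with
    | false => ϖ false
    | true => ϖ true, ⟨fun b => ?_, fun b c x ξ v => ?_⟩, ⟨fun b => ?_, fun b c x ξ v => ?_⟩,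
    fun b => ?_, fun b => ?_, fun b => ?_⟩
  · cases b
    exacts [holj false, holj true]
  · cases b <;> cases c
    · exact map_zero _
    · exact hjc false true x ξ v
    · exact hjc true false x ξ v
    · exact map_zero _
  · cases b
    exacts [holϖ false, holϖ true]
  · cases b <;> cases c
    · exact map_zero _
    · exact hϖc false true x ξ v
    · exact hϖc true false x ξ v
    · exact map_zero _
  · cases b
    exacts [hϖj false, hϖj true]
  · cases b
    exacts [hjϖ false, hjϖ true]
  · cases b
    exacts [hforml false, hforml true]

variable [ConnectedSpace X] [CompactSpace X] [T2Space X]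

open HiggsSubbundle

/-- The image of e is the kernel of 1 − e, to which `exists_ker` applies. -/
theorem IsOrthProj.exists_subbundle (hM : M.IsStable)
    {e : ∀ b x, Module.End ℂ ((M.bdl b).Fiber x)} (he : M.IsOrthProj e) :
    ∃ S : HiggsSubbundle M, ∀ b x, S.fiber b x = LinearMap.range (e b x) := by
  obtain ⟨K, hK, -⟩ := exists_ker hM hM ((IsHiggsHom.id M).sub he.isHiggsHom)
  refine ⟨K, fun b x => ?_⟩
  ext v
  rw [hK, LinearMap.mem_ker, LinearMap.sub_apply, LinearMap.id_apply, sub_eq_zero]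
  exact ⟨fun h => ⟨v, h.symm⟩, by rintro ⟨w, rfl⟩; exact (he.idem b x w).symm⟩

/-- A nonzero orthogonal projection is nonzero at every point. -/
theorem IsOrthProj.exists_ne_zero (hM : M.IsStable)
    {e : ∀ b x, Module.End ℂ ((M.bdl b).Fiber x)} (he : M.IsOrthProj e) (h0 : e ≠ 0) (x : X) :
    ∃ b v, e b x v ≠ 0 := by
  obtain ⟨S, hS⟩ := he.exists_subbundle hM
  by_contra! h
  have hr : S.rank = 0 := S.rank_eq_zero_of_fiber (x := x) fun b => by
    rw [hS, LinearMap.range_eq_bot]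
    exact LinearMap.ext (h b)
  refine h0 (funext fun b => funext fun y => ?_)
  have h1 := S.fiber_eq_bot hr b y
  rwa [hS, LinearMap.range_eq_bot] at h1

namespace IsSummand

variable {e : ∀ b x, Module.End ℂ ((M.bdl b).Fiber x)}
  {ι : ∀ b x, (N.bdl b).Fiber x →ₗ[ℂ] (M.bdl b).Fiber x}
  {ϖ : ∀ b x, (M.bdl b).Fiber x →ₗ[ℂ] (N.bdl b).Fiber x}

/-- The inclusion carries isotropic invariant subbundles of N to such subbundles of M and preserves
their degrees. -/
theorem isStable (h : M.IsSummand N e ι ϖ) (hM : M.IsStable) : N.IsStable := by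
  have hinj : ∀ b x, Function.Injective (ι b x) := fun b x =>
    Function.LeftInverse.injective (h.proj_incl b x)
  intro V' W' hV hW hrank hβ hγ
  have hol := h.isHiggsHom_incl.hol
  let S : ∀ b, (N.bdl b).Subbundle := fun b => match b with
    | false => V'
    | true => W'
  have hSmem : ∀ (b c : Bool) (x : X) (ξ : TangentSpace 𝓘(ℂ) x), ∀ v ∈ (S b).fiber x,
      N.higgs b c x ξ v ∈ (S c).fiber x := by
    intro b c x ξ v hv
    cases b <;> cases c
    · exact Submodule.zero_mem _
    · exact hγ x ξ v hv
    · exact hβ x ξ v hv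
    · exact Submodule.zero_mem _
  have hSiso : ∀ b x, ∀ v ∈ (S b).fiber x, ∀ w ∈ (S b).fiber x, (N.comp b).form x v w = 0 := by
    intro b
    cases b
    exacts [hV, hW]
  let T : HiggsSubbundle M :=
    { comp := fun b => (S b).map (hol b) (hinj b)
      higgs_mem := by
        rintro b c x ξ _ ⟨v, hv, rfl⟩
        rw [← h.isHiggsHom_incl.comm]
        exact ⟨_, hSmem b c x ξ v hv, rfl⟩ }
  have hdeg : ∀ b, (S b).degree = (T.comp b).degree := fun b =>
    Subbundle.degree_congr (hol b) (fun x => rfl) fun x v _ hv => hinj b x (by rw [hv, map_zero])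
  have key := degree_neg (S := T) hM ?_ ?_
  · unfold degree at key
    rw [← hdeg, ← hdeg] at key
    exact key
  · rintro b x _ ⟨v, hv, rfl⟩ _ ⟨w, hw, rfl⟩
    rw [h.form_incl, h.proj_incl]
    exact hSiso b x v hv w hw
  · change V'.rank + W'.rank ≠ 0
    omega

end IsSummand

end SpHiggsBundle

/-! ### Decomposition into simple summands -/

namespace SpHiggsBundle

open HolomorphicVectorBundle

variable {X : Type*} [TopologicalSpace X] [ChartedSpace ℂ X] [IsManifold 𝓘(ℂ) ω X]
  {p q p' q' : ℕ} {M : SpHiggsBundle X p q} {N : SpHiggsBundle X p' q'}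

theorem isOrthProj_one (M : SpHiggsBundle X p q) :
    M.IsOrthProj (1 : ∀ b x, Module.End ℂ ((M.bdl b).Fiber x)) :=
  ⟨IsHiggsHom.id M, fun _ _ _ => rfl, fun _ _ _ _ => rfl⟩

theorem neg_one_mem_Aut (M : SpHiggsBundle X p q) :
    ((fun _ => LinearEquiv.neg ℂ, fun _ => LinearEquiv.neg ℂ) :
      (∀ x, M.V.Fiber x ≃ₗ[ℂ] M.V.Fiber x) × (∀ x, M.W.Fiber x ≃ₗ[ℂ] M.W.Fiber x)) ∈ M.Aut := by
  have h := ofPair_mem_Aut (isOrthProj_one M).isHiggsIso_reflection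
  have key : ∀ b x (v : (M.bdl b).Fiber x), -v = v - (2 : ℂ) • v := fun b x v => by module
  convert h using 1
  exact Prod.ext (funext fun x => LinearEquiv.ext (key false x))
    (funext fun x => LinearEquiv.ext (key true x))

/-- A self-adjoint idempotent of a summand gives one of the whole. -/
theorem IsSummand.isOrthProj {e : ∀ b x, Module.End ℂ ((M.bdl b).Fiber x)}
    {ι : ∀ b x, (N.bdl b).Fiber x →ₗ[ℂ] (M.bdl b).Fiber x}
    {ϖ : ∀ b x, (M.bdl b).Fiber x →ₗ[ℂ] (N.bdl b).Fiber x} (h : M.IsSummand N e ι ϖ)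
    {f : ∀ b x, Module.End ℂ ((N.bdl b).Fiber x)} (hf : N.IsOrthProj f) :
    M.IsOrthProj fun b x => ι b x ∘ₗ f b x ∘ₗ ϖ b x :=
  ⟨h.isHiggsHom_incl.comp (hf.isHiggsHom.comp h.isHiggsHom_proj),
    fun b x v => by simp [h.proj_incl, hf.idem], fun b x v w => by
      simp only [LinearMap.comp_apply]
      rw [h.form_incl, hf.form, (M.comp b).form_swap x v, h.form_incl, (N.comp b).form_swap,
        neg_inj, (N.comp b).form_swap, ← hf.form, (N.comp b).form_swap, neg_neg]⟩

/-- Nonzero orthogonal projections that add up to the identity. -/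
structure IsOrthDecomp (M : SpHiggsBundle X p q) {r : ℕ}
    (e : Fin r → ∀ b x, Module.End ℂ ((M.bdl b).Fiber x)) : Prop where
  complete : CompleteOrthogonalIdempotents e
  isOrthProj : ∀ i, M.IsOrthProj (e i)
  ne_zero : ∀ i, e i ≠ 0

theorem IsOrthProj.mul_self {e : ∀ b x, Module.End ℂ ((M.bdl b).Fiber x)} (he : M.IsOrthProj e) :
    e * e = e :=
  funext fun b => funext fun x => LinearMap.ext (he.idem b x)

/-- One of the projections is replaced by a smaller one and the difference. -/
theorem IsOrthDecomp.exists_succ {r : ℕ} {e : Fin r → ∀ b x, Module.End ℂ ((M.bdl b).Fiber x)}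
    (he : M.IsOrthDecomp e) (i : Fin r) {f : ∀ b x, Module.End ℂ ((M.bdl b).Fiber x)}
    (hf : M.IsOrthProj f) (hef : e i * f = f) (hfe : f * e i = f) (h0 : f ≠ 0) (h1 : f ≠ e i) :
    ∃ e' : Fin (r + 1) → ∀ b x, Module.End ℂ ((M.bdl b).Fiber x), M.IsOrthDecomp e' := by
  have hff := hf.mul_self
  have hg : M.IsOrthProj (e i - f) := by
    refine ⟨(he.isOrthProj i).isHiggsHom.sub hf.isHiggsHom, fun b x v => ?_, fun b x v w => ?_⟩
    · have : (e i - f) * (e i - f) = e i - f := by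
        rw [mul_sub, sub_mul, sub_mul, (he.isOrthProj i).mul_self, hfe, hef, hff, sub_self,
          sub_zero]
      exact LinearMap.congr_fun (congrFun (congrFun this b) x) v
    · simp only [Pi.sub_apply, LinearMap.sub_apply, map_sub, hf.form, (he.isOrthProj i).form]
  have hort := he.complete.ortho
  have hek : ∀ k, k ≠ i → e k * f = 0 := fun k hk => by
    rw [← hef, ← mul_assoc, hort hk, zero_mul]
  have hke : ∀ k, k ≠ i → f * e k = 0 := fun k hk => by
    rw [← hfe, mul_assoc, hort hk.symm, mul_zero]
  have hproj : ∀ k, M.IsOrthProj (Fin.cons (α := fun _ => ∀ b x, Module.End ℂ ((M.bdl b).Fiber x))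
      f (Function.update e i (e i - f)) k) := by
    intro k
    refine Fin.cases hf (fun k => ?_) k
    rw [Fin.cons_succ]
    by_cases hk : k = i
    · subst hk
      rwa [Function.update_self]
    · rw [Function.update_of_ne hk]
      exact he.isOrthProj k
  refine ⟨Fin.cons f (Function.update e i (e i - f)), ⟨⟨fun k => (hproj k).mul_self, ?_⟩, ?_⟩,
    hproj, fun k => ?_⟩
  · have hl : ∀ k, Function.update e i (e i - f) k * f = 0 := fun k => by
      by_cases hk : k = i
      · subst hk
        rw [Function.update_self, sub_mul, hef, hff, sub_self]
      · rw [Function.update_of_ne hk, hek k hk]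
    have hr : ∀ k, f * Function.update e i (e i - f) k = 0 := fun k => by
      by_cases hk : k = i
      · subst hk
        rw [Function.update_self, mul_sub, hfe, hff, sub_self]
      · rw [Function.update_of_ne hk, hke k hk]
    intro k l hkl
    induction k using Fin.cases with
    | zero =>
      induction l using Fin.cases with
      | zero => exact absurd rfl hkl
      | succ l => exact hr l
    | succ k =>
      induction l using Fin.cases with
      | zero => exact hl k
      | succ l =>
        have hkl' : k ≠ l := fun h => hkl (congrArg _ h)
        change Function.update e i (e i - f) k * Function.update e i (e i - f) l = 0
        by_cases hk : k = i
        · subst hk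
          rw [Function.update_self, Function.update_of_ne hkl'.symm, sub_mul, hort hkl',
            hke l hkl'.symm, sub_zero]
        · rw [Function.update_of_ne hk]
          by_cases hl : l = i
          · subst hl
            rw [Function.update_self, mul_sub, hort hkl', hek k hk, sub_zero]
          · rw [Function.update_of_ne hl, hort hkl']
  · rw [Fin.sum_univ_succ]
    simp only [Fin.cons_zero, Fin.cons_succ]
    rw [Finset.sum_update_of_mem (Finset.mem_univ i), ← add_assoc, add_sub_cancel,
      Finset.sdiff_singleton_eq_erase, Finset.add_sum_erase _ _ (Finset.mem_univ i),
      he.complete.complete]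
  · refine Fin.cases h0 (fun k => ?_) k
    rw [Fin.cons_succ]
    by_cases hk : k = i
    · subst hk
      rw [Function.update_self]
      exact sub_ne_zero.2 h1.symm
    · rw [Function.update_of_ne hk]
      exact he.ne_zero k

variable [ConnectedSpace X] [CompactSpace X] [T2Space X]

/-- An automorphism φ satisfies φ² = 1 and is therefore self-adjoint, so (1 + φ)/2 is an orthogonal
projection. It is 0 for φ = −1 and 1 for φ = 1. -/
theorem IsStable.isSimple (hM : M.IsStable)
    (h : ∀ e : ∀ b x, Module.End ℂ ((M.bdl b).Fiber x), M.IsOrthProj e → e = 0 ∨ e = 1) :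
    M.IsSimple := by
  refine fun a => ⟨fun ha => ?_, ?_⟩
  · have hφ := mem_Aut_iff.1 ha
    obtain ⟨f, g⟩ := a
    set φ : ∀ b x, (M.bdl b).Fiber x ≃ₗ[ℂ] (M.bdl b).Fiber x := ofPair f g with hφdef
    have hsq := hM.apply_apply_of_isHiggsIso hφ
    have hadj : ∀ b x v w, (M.comp b).form x (φ b x v) w = (M.comp b).form x v (φ b x w) :=
      fun b x v w => by rw [← hφ.form b x v, hsq]
    have he : M.IsOrthProj fun b x => (2⁻¹ : ℂ) • (LinearMap.id + (φ b x).toLinearMap) := by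
      refine ⟨((IsHiggsHom.id M).add hφ.isHiggsHom).smul _, fun b x v => ?_, fun b x v w => ?_⟩
      · simp only [LinearMap.smul_apply, LinearMap.add_apply, LinearMap.id_apply,
          LinearEquiv.coe_coe, map_smul, map_add, hsq]
        module
      · simp [hadj]
    rcases h _ he with h0 | h0
    · right
      have key : ∀ b x v, φ b x v = -v := by
        intro b x v
        have h1 := LinearMap.congr_fun (congrFun (congrFun h0 b) x) v
        have h2 := (smul_eq_zero.1 h1).resolve_left (inv_ne_zero two_ne_zero)
        exact eq_neg_of_add_eq_zero_right h2
      exact Prod.ext (funext fun x => LinearEquiv.ext (key false x))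
        (funext fun x => LinearEquiv.ext (key true x))
    · left
      have key : ∀ b x v, φ b x v = v := by
        intro b x v
        have h1 : (2⁻¹ : ℂ) • (v + φ b x v) = v :=
          LinearMap.congr_fun (congrFun (congrFun h0 b) x) v
        have h2 : φ b x v = (2 : ℂ) • ((2⁻¹ : ℂ) • (v + φ b x v)) - v := by module
        rw [h2, h1]
        module
      exact Prod.ext (funext fun x => LinearEquiv.ext (key false x))
        (funext fun x => LinearEquiv.ext (key true x))
  · rintro (rfl | rfl)
    exacts [M.Aut.one_mem, M.neg_one_mem_Aut]

/-- This bounds the length of a decomposition. Each projection is nonzero at x, and nonzero vectors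
from the images of orthogonal projections are independent. -/
theorem IsOrthDecomp.le_finrank (hM : M.IsStable) {r : ℕ}
    {e : Fin r → ∀ b x, Module.End ℂ ((M.bdl b).Fiber x)} (he : M.IsOrthDecomp e) (x : X) :
    r ≤ Module.finrank ℂ (∀ b, (M.bdl b).Fiber x) := by
  choose b v hv using fun i => (he.isOrthProj i).exists_ne_zero hM (he.ne_zero i) x
  have hli : LinearIndependent ℂ fun i => Pi.single (M := fun b => (M.bdl b).Fiber x) (b i)
      (e i (b i) x (v i)) := by
    refine linearIndependent_iff'.2 fun s c hc i hi => ?_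
    have h1 := congrArg (e i (b i) x) (congrFun hc (b i))
    rw [Finset.sum_apply, map_sum, Finset.sum_eq_single i] at h1
    · rw [Pi.smul_apply, Pi.single_eq_same, map_smul, (he.isOrthProj i).idem, Pi.zero_apply,
        map_zero] at h1
      exact (smul_eq_zero.1 h1).resolve_right (hv i)
    · intro j _ hji
      rw [Pi.smul_apply, map_smul]
      by_cases hb : b i = b j
      · have h2 := LinearMap.congr_fun (congrFun (congrFun (he.complete.ortho hji.symm) (b j)) x)
          (v j)
        change e i (b j) x (e j (b j) x (v j)) = 0 at h2
        rw [hb, Pi.single_eq_same, h2, smul_zero]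
      · rw [Pi.single_eq_of_ne hb, map_zero, smul_zero]
    · exact fun h => absurd hi h
  simpa using hli.fintype_card_le_finrank

/-- Distinct orthogonal summands of a stable Higgs bundle are not isomorphic. -/
theorem IsHiggsSum.not_isomorphic (hM : M.IsStable) {r : ℕ} {P Q : Fin r → ℕ}
    {N : ∀ i, SpHiggsBundle X (P i) (Q i)}
    {ι : ∀ i b x, ((N i).bdl b).Fiber x →ₗ[ℂ] (M.bdl b).Fiber x}
    {ϖ : ∀ i b x, (M.bdl b).Fiber x →ₗ[ℂ] ((N i).bdl b).Fiber x} (h : M.IsHiggsSum N ι ϖ)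
    (hPQ : ∀ i, P i ≠ 0 ∨ Q i ≠ 0) (i j : Fin r) (hij : i ≠ j) : ¬ (N i).Isomorphic (N j) := by
  intro hiso
  obtain ⟨φ, hφ⟩ := isomorphic_iff.1 hiso
  have hadj : ∀ b x v w, ((N j).comp b).form x (φ b x v) w =
      ((N i).comp b).form x v ((φ b x).symm w) := fun b x v w => by
    rw [← hφ.form b x v, LinearEquiv.apply_symm_apply]
  -- The two terms are adjoint to each other because φ preserves the forms, so their difference is
  -- skew-adjoint and must vanish.
  have ha := (((h.isHiggsHom_incl j).comp hφ.isHiggsHom).comp (h.isHiggsHom_proj i)).sub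
    (((h.isHiggsHom_incl i).comp hφ.isHiggsHom_symm).comp (h.isHiggsHom_proj j))
  obtain ⟨b, hb⟩ := (N i).exists_nontrivial (hPQ i) (Classical.arbitrary X)
  obtain ⟨v, hv⟩ := exists_ne (0 : ((N i).bdl b).Fiber (Classical.arbitrary X))
  have h0 := LinearMap.congr_fun (hM.eq_zero_of_skew ha (fun b x v w => by
    simp only [LinearMap.sub_apply, LinearMap.comp_apply, LinearEquiv.coe_coe, map_sub,
      h.form_incl, (M.comp b).form_swap x v, hadj]
    rw [((N i).comp b).form_swap x ((φ b x).symm (ϖ j b x v)),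
      ((N i).comp b).form_swap x ((φ b x).symm (ϖ j b x w))]
    ring) b _) (ι i b _ v)
  simp only [LinearMap.sub_apply, LinearMap.comp_apply, LinearEquiv.coe_coe, h.proj_incl,
    h.proj_incl_of_ne j i hij.symm, map_zero, sub_zero, LinearMap.zero_apply] at h0
  have h1 := congrArg (ϖ j b _) h0
  rw [h.proj_incl, map_zero] at h1
  exact hv ((φ b _).map_eq_zero_iff.1 h1)

/-- A stable Higgs bundle that is not simple is a sum of stable and simple ones. -/
theorem IsStable.exists_isStableSimpleSum (hM : M.IsStable) (hM' : ¬ M.IsSimple) :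
    ∃ (r : ℕ) (P Q : Fin r → ℕ) (N : ∀ i, SpHiggsBundle X (P i) (Q i)),
      M.IsStableSimpleSum N := by
  obtain ⟨f, hf, hf0, hf1⟩ : ∃ f : ∀ b x, Module.End ℂ ((M.bdl b).Fiber x),
      M.IsOrthProj f ∧ f ≠ 0 ∧ f ≠ 1 := by
    by_contra! h
    exact hM' (hM.isSimple fun e he => or_iff_not_imp_left.2 (h e he))
  have hone : M.IsOrthDecomp fun _ : Fin 1 => (1 : ∀ b x, Module.End ℂ ((M.bdl b).Fiber x)) :=
    ⟨⟨⟨fun _ => mul_one 1, fun i j hij => absurd (Subsingleton.elim i j) hij⟩, by simp⟩,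
      fun _ => M.isOrthProj_one, fun _ h => hf0 (by rw [← mul_one f, h, mul_zero])⟩
  -- The possible lengths of decompositions. They are bounded by the dimension of a fibre, and
  -- splitting 1 into f and 1 − f gives length 2. A decomposition of maximal length cannot be
  -- refined, which makes its summands simple.
  let R : Set ℕ := {r | ∃ e : Fin r → ∀ b x, Module.End ℂ ((M.bdl b).Fiber x), M.IsOrthDecomp e}
  have htwo : 2 ∈ R := hone.exists_succ 0 hf (one_mul f) (mul_one f) hf0 hf1
  have hbdd : BddAbove R := ⟨_, by rintro r ⟨e, he⟩; exact he.le_finrank hM (Classical.arbitrary X)⟩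
  obtain ⟨e, he⟩ : sSup R ∈ R := Nat.sSup_mem ⟨2, htwo⟩ hbdd
  have hr : 1 < sSup R := le_csSup hbdd htwo
  have hmax : ∀ i, ∀ f : ∀ b x, Module.End ℂ ((M.bdl b).Fiber x), M.IsOrthProj f →
      e i * f = f → f * e i = f → f = 0 ∨ f = e i := by
    intro i f hf hef hfe
    by_contra! h
    have h1 := le_csSup hbdd (show sSup R + 1 ∈ R from he.exists_succ i hf hef hfe h.1 h.2)
    omega
  choose P Q N ι ϖ h using fun i =>
    ((he.isOrthProj i).exists_subbundle hM).elim ((he.isOrthProj i).exists_isSummand)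
  have hPQ : ∀ i, P i ≠ 0 ∨ Q i ≠ 0 := by
    intro i
    by_contra! h0
    refine he.ne_zero i (funext fun b => funext fun x => LinearMap.ext fun v => ?_)
    have : Subsingleton (((N i).bdl b).Fiber x) := by
      refine Module.finrank_zero_iff (R := ℂ).1 ?_
      rw [((N i).bdl b).finrank_fiber, h0.1, h0.2]
      cases b <;> rfl
    rw [← (h i).incl_proj, Subsingleton.elim (ϖ i b x v) 0, map_zero]
    rfl
  have hsum : M.IsHiggsSum N ι ϖ := by
    refine ⟨fun i => (h i).isHiggsHom_incl, fun i => (h i).isHiggsHom_proj,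
      fun i => (h i).proj_incl, fun i j hij b x v => ?_, fun b x v => ?_, fun i => (h i).form_incl⟩
    · refine Function.LeftInverse.injective ((h i).proj_incl b x) ?_
      rw [map_zero, (h i).incl_proj, ← (h j).proj_incl b x v, (h j).incl_proj]
      exact LinearMap.congr_fun (congrFun (congrFun (he.complete.ortho hij) b) x) _
    · simp only [(h _).incl_proj]
      have h1 := LinearMap.congr_fun (congrFun (congrFun he.complete.complete b) x) v
      simpa using h1
  have hstab : ∀ i, (N i).IsStable := fun i => (h i).isStable hM
  refine ⟨sSup R, P, Q, N, hr, hPQ, fun i => ⟨hstab i, (hstab i).isSimple fun g hg => ?_⟩,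
    hsum.not_isomorphic hM hPQ, hsum.isDirectSum⟩
  have hle : ∀ b x v, e i b x (ι i b x v) = ι i b x v := fun b x v => by
    rw [← (h i).incl_proj, (h i).proj_incl]
  have hpe : ∀ b x v, ϖ i b x (e i b x v) = ϖ i b x v := fun b x v => by
    rw [← (h i).incl_proj, (h i).proj_incl]
  have hback : ∀ b x v, g b x v = ϖ i b x (ι i b x (g b x (ϖ i b x (ι i b x v)))) := fun b x v => by
    rw [(h i).proj_incl, (h i).proj_incl]
  -- An orthogonal projection `g` of the summand extends by zero to one of M below `e i`, which is 0
  -- or `e i` by maximality; compressing back gives g = 0 or g = 1.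
  rcases hmax i _ ((h i).isOrthProj hg)
    (funext fun b => funext fun x => LinearMap.ext fun v => hle b x _)
    (funext fun b => funext fun x => LinearMap.ext fun v =>
      congrArg (fun w => ι i b x (g b x w)) (hpe b x v)) with h0 | h0
  · left
    refine funext fun b => funext fun x => LinearMap.ext fun v => (hback b x v).trans ?_
    exact (congrArg (ϖ i b x) (LinearMap.congr_fun (congrFun (congrFun h0 b) x) _)).trans
      (map_zero _)
  · right
    refine funext fun b => funext fun x => LinearMap.ext fun v => (hback b x v).trans ?_
    exact (congrArg (ϖ i b x) (LinearMap.congr_fun (congrFun (congrFun h0 b) x) _)).trans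
      (by rw [hle, (h i).proj_incl]; rfl)

end SpHiggsBundle

/-! ### The proposition -/

theorem mainTheorem10 {X : Type*} [TopologicalSpace X] [T2Space X] [CompactSpace X]
    [ConnectedSpace X] [ChartedSpace ℂ X] [IsManifold 𝓘(ℂ) ω X] {p q : ℕ}
    (M : SpHiggsBundle X p q) :
    (M.IsStable ∧ ¬ M.IsSimple ↔
      ∃ (r : ℕ) (P Q : Fin r → ℕ) (N : ∀ i, SpHiggsBundle X (P i) (Q i)),
        M.IsStableSimpleSum N) ∧
    ∀ (r : ℕ) (P Q : Fin r → ℕ) (N : ∀ i, SpHiggsBundle X (P i) (Q i)),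
      M.IsStableSimpleSum N → Nonempty (M.Aut ≃* (Fin r → Multiplicative (ZMod 2))) := by
  have hsum : ∀ (r : ℕ) (P Q : Fin r → ℕ) (N : ∀ i, SpHiggsBundle X (P i) (Q i)),
      M.IsStableSimpleSum N → M.IsStable ∧ ¬ M.IsSimple ∧
        Nonempty (M.Aut ≃* (Fin r → Multiplicative (ZMod 2))) := by
    rintro r P Q N ⟨hr, hPQ, hN, hne, hMN⟩
    obtain ⟨ι, ϖ, h⟩ := hMN.exists_isHiggsSum
    have hM := h.isStable hPQ hN hne
    exact ⟨hM, h.not_isSimple hr hPQ, h.nonempty_mulEquiv hPQ hM fun i => (hN i).2⟩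
  refine ⟨⟨fun h => h.1.exists_isStableSimpleSum h.2, ?_⟩, fun r P Q N h => (hsum r P Q N h).2.2⟩
  rintro ⟨r, P, Q, N, h⟩
  exact ⟨(hsum r P Q N h).1, (hsum r P Q N h).2.1⟩
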